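/- For a predicate $P:\{-1,1\}^k\to\{0,1\}$, an instance $\mathcal I$ of $\mathrm{CSP}(P)$ over $n$ variables is a multiset of constraints $(c,S)\in\{-1,1\}^k\times[n]^k$; an assignment $x\in\{-1,1\}^n$ satisfies $(c,S)$ if $P(c_1x_{S_1},\dots,c_kx_{S_k})=1$, and $\mathrm{Opt}(\mathcal I)$ is the maximum over $x$ of the fraction of satisfied constraints. Let $\mathcal F_P(n,p)$ be the random instance that includes each of the $2^kn^k$ possible constraints independently with probability $p$, and let $\bar m=2^kn^kp$ be the expected number of constraints. A probability distribution on $\{-1,1\}^k$ is $t$-wise uniform if its marginal on every set of $t$ coordinates is uniform. There is an absolute constant $C$ such that the following holds. Let $2\le t\le k$, put $h=C\,k^t\,(\log k^t)^C$ (so that $h=\widetilde O(k^t)$), and let $P:\{-1,1\}^k\to\{0,1\}$ be a predicate such that no $t$-wise uniform distribution on $\{-1,1\}^k$ has its support contained in $P^{-1}(1)$. Then there is a deterministic algorithm $\mathcal A$ (depending on $k$, $t$, $P$, but not on $p$), running in time polynomial in the number of variables and the number of constraints, that on every instance outputs either "$\mathrm{Opt}(\mathcal I)\le 1-2^{-h}$"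 or "fail", such that: 1. $\mathcal A$ never errs: whenever it outputs "$\mathrm{Opt}(\mathcal I)\le 1-2^{-h}$", this inequality is true; 2. for every sequence $p=p(n)\in[0,1]$ with $\bar m=2^kn^kp(n)\ge 2^{h}\,n^{t/2}\log^5 n$ for all sufficiently large $n$, $$\Pr_{\mathcal I\sim\mathcal F_P(n,p(n))}\bigl[\mathcal A(\mathcal I)=\text{"fail"}\bigr]\longrightarrow 0\qquad(n\to\infty).$$ -/

import Mathlib

open Filter Topology MeasureTheory

namespace RandomCSP

/-! ### Constraint satisfaction problems over the Boolean domain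

The domain `{-1, 1}` is the unit group `ℤˣ`, with its multiplication. -/

/-- A predicate `P : {-1,1}^k → {0,1}`. -/
abbrev Predicate (k : ℕ) : Type := (Fin k → ℤˣ) → Bool

/-- A constraint `(c, S)`: a negation pattern `c ∈ {-1,1}^k` and a scope `S ∈ [n]^k`
(variables may be repeated in the scope). -/
abbrev Constraint (k n : ℕ) : Type := (Fin k → ℤˣ) × (Fin k → Fin n)

/-- An instance over `n` variables is a multiset of constraints. -/
abbrev Instance (k n : ℕ) : Type := Multiset (Constraint k n)

/-- The `k`-tuple `c ∘ x_S` of literal values that a constraint reads off the assignment `x`. -/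
def Constraint.literals {k n : ℕ} (C : Constraint k n) (x : Fin n → ℤˣ) : Fin k → ℤˣ :=
  fun j => C.1 j * x (C.2 j)

/-- The fraction of the constraints of `I` that the assignment `x` satisfies. (For the instance
without constraints this is `0 / 0 = 0`.) -/
noncomputable def value {k n : ℕ} (P : Predicate k) (I : Instance k n) (x : Fin n → ℤˣ) : ℝ :=
  (I.countP (fun C => P (C.literals x) = true) : ℝ) / (Multiset.card I : ℝ)

/-- The optimum of `I`: the maximum of `value P I x` over the finitely many assignments `x`. -/
noncomputable def opt {k n : ℕ} (P : Predicate k) (I : Instance k n) : ℝ :=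
  Finset.univ.sup' Finset.univ_nonempty (fun x : Fin n → ℤˣ => value P I x)

/-! ### Limited uniformity -/

/-- `D` is `t`-wise uniform: for every `S ⊆ [k]` with `|S| = t` the marginal of `D` on the
coordinates in `S` is the uniform distribution. -/
def IsTWiseUniform {k : ℕ} (t : ℕ) (D : PMF (Fin k → ℤˣ)) : Prop :=
  ∀ S : Finset (Fin k), S.card = t →
    D.map (fun (z : Fin k → ℤˣ) (i : S) => z i) = PMF.uniformOfFintype (S → ℤˣ)

/-- `P` is `t`-wise supporting: some `t`-wise uniform distribution is supported on `P⁻¹(1)`. -/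
def Supports {k : ℕ} (t : ℕ) (P : Predicate k) : Prop :=
  ∃ D : PMF (Fin k → ℤˣ), IsTWiseUniform t D ∧ D.support ⊆ {z | P z = true}

/-! ### The random model -/

/-- Every one of the `2^k n^k` possible constraints is selected independently with
probability `p`. -/
noncomputable def randomSelection (k n : ℕ) (p : unitInterval) :
    Measure (Constraint k n → Bool) :=
  Measure.pi fun _ => ProbabilityTheory.bernoulliMeasure true false p

/-- The instance made of the selected constraints. -/
def instanceOf {k n : ℕ} (ω : Constraint k n → Bool) : Instance k n :=
  (Finset.univ.filter fun C => ω C = true).val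

/-- The expected number of constraints, `2^k n^k p`. -/
noncomputable def expectedSize (k n : ℕ) (p : unitInterval) : ℝ :=
  (2 : ℝ) ^ k * (n : ℝ) ^ k * (p : ℝ)

/-! ### Algorithms and their running time

Algorithms are deterministic random access programs: structured programs over finitely many arrays
of natural numbers with indirect addressing, under the logarithmic cost criterion (every operation
costs one plus the bit lengths of all addresses and operands that it handles). Polynomial time in
this model is polynomial time on Turing machines. -/

/-- The memory: `s a i` is the content of cell `i` of array `a`. -/
abbrev Memory : Type := ℕ → ℕ → ℕ

/-- Arithmetic expressions. -/
inductive AExp : Type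
  | lit (c : ℕ) : AExp
  /-- the content of the cell of array `a` whose index is the value of the expression `i` -/
  | get (a : ℕ) (i : AExp) : AExp
  | add (e f : AExp) : AExp
  /-- truncated subtraction -/
  | sub (e f : AExp) : AExp
  | mul (e f : AExp) : AExp
  /-- division rounded down, with value `0` for the divisor `0` -/
  | div (e f : AExp) : AExp

/-- The value of an expression. -/
def AExp.val (s : Memory) : AExp → ℕ
  | .lit c => c
  | .get a i => s a (i.val s)
  | .add e f => e.val s + f.val s
  | .sub e f => e.val s - f.val s
  | .mul e f => e.val s * f.val s
  | .div e f => e.val s / f.val s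

/-- The cost of evaluating an expression; `Nat.size` is the bit length. -/
def AExp.cost (s : Memory) : AExp → ℕ
  | .lit c => 1 + c.size
  | .get a i => i.cost s + (1 + (i.val s).size + (s a (i.val s)).size)
  | .add e f => e.cost s + f.cost s + (1 + (e.val s).size + (f.val s).size)
  | .sub e f => e.cost s + f.cost s + (1 + (e.val s).size + (f.val s).size)
  | .mul e f => e.cost s + f.cost s + (1 + (e.val s).size + (f.val s).size)
  | .div e f => e.cost s + f.cost s + (1 + (e.val s).size + (f.val s).size)

/-- Programs. Tests succeed on nonzero values. -/
inductive Prog : Type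
  | skip : Prog
  /-- `a[i] := e` -/
  | assign (a : ℕ) (i e : AExp) : Prog
  | seq (c d : Prog) : Prog
  | ite (e : AExp) (c d : Prog) : Prog
  /-- repeat `c` as long as `e` is nonzero -/
  | loop (e : AExp) (c : Prog) : Prog

/-- `Exec c s T s'`: started with memory `s`, the program `c` halts with memory `s'`, and the cost
of this run is `T`. -/
inductive Exec : Prog → Memory → ℕ → Memory → Prop
  | skip (s : Memory) : Exec .skip s 1 s
  | assign (a : ℕ) (i e : AExp) (s : Memory) :
      Exec (.assign a i e) s
        (i.cost s + e.cost s + (1 + (i.val s).size + (e.val s).size))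
        (Function.update s a (Function.update (s a) (i.val s) (e.val s)))
  | seq {c d : Prog} {s s' s'' : Memory} {T T' : ℕ} :
      Exec c s T s' → Exec d s' T' s'' → Exec (.seq c d) s (T + T') s''
  | ite_true {e : AExp} {c d : Prog} {s s' : Memory} {T : ℕ} :
      e.val s ≠ 0 → Exec c s T s' → Exec (.ite e c d) s (e.cost s + 1 + T) s'
  | ite_false {e : AExp} {c d : Prog} {s s' : Memory} {T : ℕ} :
      e.val s = 0 → Exec d s T s' → Exec (.ite e c d) s (e.cost s + 1 + T) s'
  | loop_stop {e : AExp} {c : Prog} {s : Memory} :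
      e.val s = 0 → Exec (.loop e c) s (e.cost s + 1) s
  | loop_step {e : AExp} {c : Prog} {s s' s'' : Memory} {T T' : ℕ} :
      e.val s ≠ 0 → Exec c s T s' → Exec (.loop e c) s' T' s'' →
        Exec (.loop e c) s (e.cost s + 1 + T + T') s''

/-- The initial memory on an instance over `n` variables whose constraints are listed as `L`:
array `0` holds `n` and the number of constraints; for the constraint number `i` and `j < k`,
cell `i * k + j` holds the `j`-th variable of the scope (array `1`) and whether the `j`-th literal
is negated (array `2`). All other cells are `0`. -/
def inputMemory {k n : ℕ} (L : List (Constraint k n)) : Memory := fun a q =>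
  match a with
  | 0 => if q = 0 then n else if q = 1 then L.length else 0
  | 1 =>
    if h : 0 < k then
      (L[q / k]?).elim 0 fun C => (C.2 ⟨q % k, Nat.mod_lt q h⟩ : ℕ)
    else 0
  | 2 =>
    if h : 0 < k then
      (L[q / k]?).elim 0 fun C => if C.1 ⟨q % k, Nat.mod_lt q h⟩ = -1 then 1 else 0
    else 0
  | _ => 0

/-- What an algorithm outputs on every instance: `true` stands for its certification statement,
`false` for "fail". -/
abbrev Decision (k : ℕ) : Type := ∀ n : ℕ, Instance k n → Bool

/-- `A` is computed in time polynomial in the number `n` of variables and the number of constraints: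
one program, on every listing of the constraints of every instance, halts within the time bound
with the output of `A` in cell `0` of array `3`. -/
def Decision.IsEfficient {k : ℕ} (A : Decision k) : Prop :=
  ∃ (c : Prog) (d : ℕ), ∀ (n : ℕ) (L : List (Constraint k n)), ∃ (T : ℕ) (s : Memory),
    Exec c (inputMemory L) T s ∧ T ≤ (n + L.length + 2) ^ d ∧
      s 3 0 = if A n (L : Instance k n) = true then 1 else 0

/-- `A` never errs with the certification statement "`Opt(I) ≤ 1 - δ`". -/
def Decision.NeverErrs {k : ℕ} (A : Decision k) (P : Predicate k) (δ : ℝ) : Prop :=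
  ∀ (n : ℕ) (I : Instance k n), A n I = true → opt P I ≤ 1 - δ

/-- The probability that `A` outputs "fail" on a random instance. -/
noncomputable def Decision.failProb {k : ℕ} (A : Decision k) (n : ℕ) (p : unitInterval) : ℝ :=
  (randomSelection k n p).real {ω | A n (instanceOf ω) = false}

/-- The bound `C · k^t · log^C (k^t)`, which is of the form `Õ(k^t)` when `C` is an absolute
constant. -/
noncomputable def softBound (C k t : ℕ) : ℝ :=
  (C : ℝ) * (k : ℝ) ^ t * Real.log ((k : ℝ) ^ t) ^ C

end RandomCSP

/-! Separation. A `t`-wise uniform distribution on `P⁻¹(1)` is the same as a convex combination of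
the vectors `(monomial T z)`, `z ∈ P⁻¹(1)`, over the nonempty `T` with `|T| ≤ t`, that equals `0`.
If there is none, the point `v` of least norm in the convex hull gives a polynomial `Q` of degree at
most `t` without constant term, with coefficients `v / ‖v‖²`, that is at least `1` on `P⁻¹(1)`. The
vectors have entries `±1`, so their Gram determinants are integers, and Cramer's rule bounds `1 /
‖v‖²`; hence the coefficients of `Q` have absolute sum at most `Λ = D ^ (2 * D + 3)` with `D = k ^
t` (`exists_separating_coefficients`, `exists_separating_polynomial`). If for some assignment every
monomial has average at most `1 / (2Λ)` in absolute value over the constraints, then `Q` has average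
at most `1 / 2`; as `Q ≥ -Λ` everywhere, at least a fraction `1 / (2 * (1 + Λ)) ≥ 2 ^ (-h)` of the
constraints is violated (`certifier_neverErrs`).

Certificate. It remains to bound, for each `T`, a signed sum over constraints for all assignments at
once. Split `T` into two halves and at most one remaining coordinate. Cauchy–Schwarz over the
remaining coordinate leaves a diagonal part and a quadratic form of a symmetric matrix, evaluated at
a vector of signs; the form is bounded by the trace of an even power of the matrix
(`abs_form_le_of_certificate`). Both conditions are inequalities between integers. The algorithm
checks them by repeated squaring of a matrix indexed by pairs of constraints, with an exponent of
order `log n` (`robust_certifies`). Soundness needs no probability.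

Random instances. The expected trace is a sum over closed walks of pairs of scopes. Given the scope,
the selected signs sum to a variable of mean zero, so only walks in which every scope is repeated
count. Such a walk of length `l` has at most `l` distinct scopes, and it is encoded by its
repetition pattern and the new coordinates at the first occurrences (`card_chains_le`,
`sum_chains_le`). With `l` of order `log n` and expected size at least `n ^ (t / 2) * log n ^ 5`,
Markov's inequality for both tests, a lower tail bound for the number of constraints and a union
bound over `T` make the failure probability tend to `0` (`failProb_certifier_le`). -/

namespace RandomCSP

/-! ### Compiling arithmetic terms with bounded sums -/

/-- The binary operations of the machine. -/
inductive BinOp : Type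
  | add | sub | mul | div

/-- The function computed by a binary operation. -/
def BinOp.fn : BinOp → ℕ → ℕ → ℕ
  | .add, x, y => x + y
  | .sub, x, y => x - y
  | .mul, x, y => x * y
  | .div, x, y => x / y

/-- The machine expression of a binary operation. -/
def BinOp.exp : BinOp → AExp → AExp → AExp
  | .add, x, y => .add x y
  | .sub, x, y => .sub x y
  | .mul, x, y => .mul x y
  | .div, x, y => .div x y

/-- Arithmetic terms with variables, array access and the bounded sums `∑ i < c * m ^ p`, where `m`
is the content of cell `1` of array `0`. A sum at depth `δ` binds the variable `δ`. -/
inductive Term : Type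
  | lit (c : ℕ) : Term
  | var (j : ℕ) : Term
  | read (a : ℕ) (e : Term) : Term
  | bin (o : BinOp) (e f : Term) : Term
  | sum (c p : ℕ) (e : Term) : Term

/-- The value of a term at depth `δ` under the assignment `ρ`. -/
def Term.eval (s : Memory) : Term → ℕ → (ℕ → ℕ) → ℕ
  | .lit c, _, _ => c
  | .var j, δ, ρ => if j < δ then ρ j else 0
  | .read a e, δ, ρ => if a = 3 ∨ a = 4 then 0 else s a (e.eval s δ ρ)
  | .bin o e f, δ, ρ => o.fn (e.eval s δ ρ) (f.eval s δ ρ)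
  | .sum c p e, δ, ρ =>
      ∑ i ∈ Finset.range (c * s 0 1 ^ p), e.eval s (δ + 1) (Function.update ρ δ i)

/-- The bound `c * m ^ p` as a machine expression. -/
def limExp (c : ℕ) : ℕ → AExp
  | 0 => .lit c
  | p + 1 => .mul (limExp c p) (.get 0 (.lit 1))

/-- The compiler: temporary results are kept in array `3` from cell `d` on, the variables in
array `4`. -/
def Term.compile : Term → ℕ → ℕ → Prog
  | .lit c, d, _ => .assign 3 (.lit d) (.lit c)
  | .var j, d, δ => .assign 3 (.lit d) (if j < δ then .get 4 (.lit j) else .lit 0)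
  | .read a e, d, δ => .seq (e.compile d δ)
      (.assign 3 (.lit d) (if a = 3 ∨ a = 4 then .lit 0 else .get a (.get 3 (.lit d))))
  | .bin o e f, d, δ => .seq (e.compile d δ) (.seq (f.compile (d + 1) δ)
      (.assign 3 (.lit d) (o.exp (.get 3 (.lit d)) (.get 3 (.lit (d + 1))))))
  | .sum c p e, d, δ => .seq (.assign 3 (.lit d) (.lit 0)) (.seq (.assign 4 (.lit δ) (.lit 0))
      (.loop (.sub (limExp c p) (.get 4 (.lit δ)))
        (.seq (e.compile (d + 1) (δ + 1))
          (.seq (.assign 3 (.lit d) (.add (.get 3 (.lit d)) (.get 3 (.lit (d + 1)))))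
            (.assign 4 (.lit δ) (.add (.get 4 (.lit δ)) (.lit 1)))))))

/-- `s'` agrees with `s` outside the arrays `3` and `4`. -/
def SameTables (s s' : Memory) : Prop := ∀ a i, a ≠ 3 → a ≠ 4 → s' a i = s a i

/-- `s'` agrees with `s` except for temporaries from `d` on and variables from `δ` on. -/
def Agree (d δ : ℕ) (s s' : Memory) : Prop :=
  SameTables s s' ∧ (∀ i < d, s' 3 i = s 3 i) ∧ ∀ i < δ, s' 4 i = s 4 i

/-- The cells outside the arrays `3` and `4` have at most `B` bits. -/
def CellsBounded (B : ℕ) (s : Memory) : Prop := ∀ a i, a ≠ 3 → a ≠ 4 → (s a i).size ≤ B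

theorem SameTables.trans {s s' s'' : Memory} (h : SameTables s s') (h' : SameTables s' s'') :
    SameTables s s'' := fun a i h3 h4 => (h' a i h3 h4).trans (h a i h3 h4)

theorem Agree.trans {d δ : ℕ} {s s' s'' : Memory} (h : Agree d δ s s') (h' : Agree d δ s' s'') :
    Agree d δ s s'' :=
  ⟨h.1.trans h'.1, fun i hi => (h'.2.1 i hi).trans (h.2.1 i hi),
    fun i hi => (h'.2.2 i hi).trans (h.2.2 i hi)⟩

theorem Agree.mono {d δ d' δ' : ℕ} {s s' : Memory} (h : Agree d δ s s') (hd : d' ≤ d)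
    (hδ : δ' ≤ δ) : Agree d' δ' s s' :=
  ⟨h.1, fun i hi => h.2.1 i (hi.trans_le hd), fun i hi => h.2.2 i (hi.trans_le hδ)⟩

theorem agree_update_temp (d δ : ℕ) (s : Memory) (i v : ℕ) (hi : d ≤ i) :
    Agree d δ s (Function.update s 3 (Function.update (s 3) i v)) := by
  refine ⟨fun a j h3 h4 => by simp [h3], fun j hj => ?_, fun j hj => by simp⟩
  simp [Function.update_of_ne (show j ≠ i by omega)]

theorem agree_update_var (d δ : ℕ) (s : Memory) (i v : ℕ) (hi : δ ≤ i) :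
    Agree d δ s (Function.update s 4 (Function.update (s 4) i v)) := by
  refine ⟨fun a j h3 h4 => by simp [h4], fun j hj => by simp, fun j hj => ?_⟩
  simp [Function.update_of_ne (show j ≠ i by omega)]

theorem CellsBounded.of_sameTables {B : ℕ} {s s' : Memory} (h : CellsBounded B s)
    (hs : SameTables s s') : CellsBounded B s' := fun a i h3 h4 => by
  rw [hs a i h3 h4]; exact h a i h3 h4

theorem CellsBounded.mono {B B' : ℕ} {s : Memory} (h : CellsBounded B s) (hB : B ≤ B') :
    CellsBounded B' s := fun a i h3 h4 => (h a i h3 h4).trans hB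

/-- Reads from arrays `3` and `4` are `0` by definition, so the work space of the compiled code
cannot influence the value of a term. -/
theorem Term.eval_congr {s s' : Memory} (hs : SameTables s s') (e : Term) :
    ∀ (δ : ℕ) (ρ : ℕ → ℕ), e.eval s' δ ρ = e.eval s δ ρ := by
  induction e with
  | lit c => intros; rfl
  | var j => intros; rfl
  | read a e ih =>
    intro δ ρ
    simp only [Term.eval, ih]
    split_ifs with h
    · rfl
    · push Not at h
      exact hs _ _ h.1 h.2
  | bin o e f ihe ihf => intro δ ρ; simp only [Term.eval, ihe, ihf]
  | sum c p e ih =>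
    intro δ ρ
    simp only [Term.eval, ih, hs 0 1 (by decide) (by decide)]

theorem BinOp.val_exp (o : BinOp) (e f : AExp) (s : Memory) :
    (o.exp e f).val s = o.fn (e.val s) (f.val s) := by cases o <;> rfl

theorem BinOp.cost_exp (o : BinOp) (e f : AExp) (s : Memory) :
    (o.exp e f).cost s = e.cost s + f.cost s + (1 + (e.val s).size + (f.val s).size) := by
  cases o <;> rfl

theorem size_add_le (x y : ℕ) : (x + y).size ≤ x.size + y.size + 1 := by
  rw [Nat.size_le]
  have hx := Nat.lt_size_self x
  have hy := Nat.lt_size_self y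
  have h1 : 2 ^ x.size ≤ 2 ^ (x.size + y.size) := Nat.pow_le_pow_right (by norm_num) (by omega)
  have h2 : 2 ^ y.size ≤ 2 ^ (x.size + y.size) := Nat.pow_le_pow_right (by norm_num) (by omega)
  rw [pow_succ]; omega

theorem size_mul_le (x y : ℕ) : (x * y).size ≤ x.size + y.size := by
  rw [Nat.size_le, pow_add]
  exact Nat.mul_lt_mul'' (Nat.lt_size_self x) (Nat.lt_size_self y)

theorem size_le_self (x : ℕ) : x.size ≤ x := Nat.size_le.2 Nat.lt_two_pow_self

theorem size_pow_le (x r : ℕ) : (x ^ r).size ≤ r * x.size + 1 := by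
  induction r with
  | zero => simp
  | succ r ih =>
    rw [pow_succ]
    refine (size_mul_le _ _).trans ?_
    rw [Nat.succ_mul]; omega

theorem BinOp.size_fn_le (o : BinOp) (x y : ℕ) : (o.fn x y).size ≤ x.size + y.size + 1 := by
  cases o
  · exact size_add_le x y
  · exact (Nat.size_le_size (Nat.sub_le x y)).trans (by omega)
  · exact (size_mul_le x y).trans (by omega)
  · exact (Nat.size_le_size (Nat.div_le_self x y)).trans (by omega)

/-- The crude `N` in place of its logarithm is affordable: the number of summands will itself be
polynomial. -/
theorem size_sum_range_le (f : ℕ → ℕ) (N B : ℕ) (h : ∀ i < N, (f i).size ≤ B) :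
    (∑ i ∈ Finset.range N, f i).size ≤ N + B := by
  rw [Nat.size_le, pow_add]
  rcases Nat.eq_zero_or_pos N with rfl | hN
  · simp
  calc ∑ i ∈ Finset.range N, f i ≤ ∑ _i ∈ Finset.range N, 2 ^ B :=
        Finset.sum_le_sum fun i hi => (Nat.size_le.1 (h i (Finset.mem_range.1 hi))).le
    _ = N * 2 ^ B := by simp
    _ < 2 ^ N * 2 ^ B := by
        exact Nat.mul_lt_mul_of_pos_right Nat.lt_two_pow_self (by positivity)

theorem limExp_val (c p : ℕ) (s : Memory) : (limExp c p).val s = c * s 0 1 ^ p := by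
  induction p with
  | zero => simp [limExp, AExp.val]
  | succ p ih => simp [limExp, AExp.val, ih, pow_succ, mul_assoc]

/-! Bounds of the form `x ≤ Z ^ D` -/

theorem le_pow_of_const {Z : ℕ} (hZ : 2 ≤ Z) (c : ℕ) : c ≤ Z ^ c :=
  (Nat.lt_two_pow_self (n := c)).le.trans (Nat.pow_le_pow_left hZ c)

/-- Since `Z ≥ 2`, a constant factor costs only a constant in the exponent. All time bounds are kept
in the form `Z ^ D` with `D` independent of `Z`. -/
theorem mul_le_pow_of_const {Z : ℕ} (hZ : 2 ≤ Z) {c r D x : ℕ} (hc : c ≤ 2 ^ r) (hx : x ≤ Z ^ D) :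
    c * x ≤ Z ^ (D + r) := by
  rw [pow_add, mul_comm]
  exact Nat.mul_le_mul hx (hc.trans (Nat.pow_le_pow_left hZ r))

theorem le_pow_mono {Z : ℕ} (hZ : 2 ≤ Z) {D D' x : ℕ} (hx : x ≤ Z ^ D) (h : D ≤ D') :
    x ≤ Z ^ D' := hx.trans (Nat.pow_le_pow_right (by omega) h)

theorem limExp_cost (c p : ℕ) : ∃ D, ∀ Z, 2 ≤ Z → ∀ s : Memory, s 0 1 ≤ Z →
    (limExp c p).cost s ≤ Z ^ D ∧ (limExp c p).val s ≤ Z ^ D := by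
  induction p with
  | zero =>
    refine ⟨c + 2, fun Z hZ s _ => ?_⟩
    have h1 := le_pow_of_const hZ c
    have h2 := size_le_self c
    have h3 := mul_le_pow_of_const hZ (c := 4) (r := 2) (by norm_num) (le_refl (Z ^ c))
    have h4 : 1 ≤ Z ^ c := Nat.one_le_pow _ _ (by omega)
    simp only [limExp, AExp.cost, AExp.val]
    constructor <;> omega
  | succ p ih =>
    obtain ⟨D, hD⟩ := ih
    refine ⟨D + 1 + 4, fun Z hZ s hs => ?_⟩
    obtain ⟨h1, h2⟩ := hD Z hZ s hs
    have h3 : Z ≤ Z ^ (D + 1) := Nat.le_self_pow (by omega) Z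
    have h4 : 1 ≤ Z ^ (D + 1) := Nat.one_le_pow _ _ (by omega)
    have h1' := le_pow_mono hZ h1 (show D ≤ D + 1 by omega)
    have h2' := le_pow_mono hZ h2 (show D ≤ D + 1 by omega)
    have h5 := mul_le_pow_of_const hZ (c := 10) (r := 4) (by norm_num) (le_refl (Z ^ (D + 1)))
    have h6 := size_le_self (s 0 1)
    have h7 := size_le_self ((limExp c p).val s)
    simp only [limExp, AExp.cost, AExp.val]
    have h8 : Nat.size 1 = 1 := by decide
    constructor
    · rw [h8]; omega
    · calc (limExp c p).val s * s 0 1 ≤ Z ^ D * Z := Nat.mul_le_mul h2 hs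
        _ = Z ^ (D + 1) := (pow_succ _ _).symm
        _ ≤ _ := Nat.pow_le_pow_right (by omega) (by omega)

/-- `κ` bounds the guard and `τ` the body; the `N + 1` accounts for the last, failing evaluation of
the guard. -/
theorem exec_loop {g : AExp} {c : Prog} (N κ τ : ℕ) (Inv : ℕ → Memory → Prop)
    (hstep : ∀ i < N, ∀ s, Inv i s → g.val s ≠ 0 ∧ g.cost s ≤ κ ∧
      ∃ T s', Exec c s T s' ∧ T ≤ τ ∧ Inv (i + 1) s')
    (hend : ∀ s, Inv N s → g.val s = 0 ∧ g.cost s ≤ κ) (s : Memory) (hs : Inv 0 s) :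
    ∃ T s', Exec (.loop g c) s T s' ∧ T ≤ (N + 1) * (κ + 1 + τ) ∧ Inv N s' := by
  suffices H : ∀ r i, i + r = N → ∀ s, Inv i s →
      ∃ T s', Exec (.loop g c) s T s' ∧ T ≤ (r + 1) * (κ + 1 + τ) ∧ Inv N s' from
    H N 0 (by omega) s hs
  intro r
  induction r with
  | zero =>
    intro i hi s hs
    obtain rfl : i = N := by omega
    obtain ⟨h1, h2⟩ := hend s hs
    exact ⟨_, s, Exec.loop_stop h1, by omega, hs⟩
  | succ r ih =>
    intro i hi s hs
    obtain ⟨h1, h2, T, s', hT, hTτ, hs'⟩ := hstep i (by omega) s hs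
    obtain ⟨T', s'', hT', hTb, hs''⟩ := ih (i + 1) (by omega) s' hs'
    refine ⟨_, s'', Exec.loop_step h1 hT hT', ?_, hs''⟩
    rw [Nat.succ_mul (r + 1)]
    omega

/-- The degree `D` depends on the term, on the places `d`, `δ` and on the degree `E` of the cell
sizes, but not on the input. Only temporaries from `d` on and variables from `δ` on are touched, so
an operand in cell `d` survives the computation of the next one in cell `d + 1`. -/
theorem Term.compile_spec (e : Term) : ∀ d δ E : ℕ, ∃ D, ∀ Z, 2 ≤ Z → ∀ (s : Memory) (ρ : ℕ → ℕ),
    s 0 1 ≤ Z → CellsBounded (Z ^ E) s → (∀ j < δ, s 4 j = ρ j ∧ (ρ j).size ≤ Z ^ E) →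
    (e.eval s δ ρ).size ≤ Z ^ D ∧ ∃ T s', Exec (e.compile d δ) s T s' ∧ T ≤ Z ^ D ∧
      Agree d δ s s' ∧ s' 3 d = e.eval s δ ρ := by
  induction e with
  | lit c =>
    intro d δ E
    refine ⟨c + d + 4, fun Z hZ s ρ _ _ _ => ?_⟩
    have h1 := le_pow_of_const hZ (c + d)
    have h2 := mul_le_pow_of_const hZ (c := 10) (r := 4) (by norm_num) (le_refl (Z ^ (c + d)))
    have h3 := size_le_self c
    have h4 := size_le_self d
    have h5 : 1 ≤ Z ^ (c + d) := Nat.one_le_pow _ _ (by omega)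
    refine ⟨by simp only [Term.eval]; omega, _, _, Exec.assign _ _ _ _, ?_,
      agree_update_temp d δ s _ _ le_rfl, ?_⟩
    · simp only [AExp.cost, AExp.val]; omega
    · simp [AExp.val, Term.eval]
  | var j =>
    intro d δ E
    refine ⟨(j + d + E) + 4, fun Z hZ s ρ _ _ hρ => ?_⟩
    have h1 := le_pow_of_const hZ j
    have h1' := le_pow_mono hZ h1 (show j ≤ j + d + E by omega)
    have h2 := le_pow_of_const hZ d
    have h2' := le_pow_mono hZ h2 (show d ≤ j + d + E by omega)
    have h3 := size_le_self j
    have h4 := size_le_self d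
    have h5 : 1 ≤ Z ^ (j + d + E) := Nat.one_le_pow _ _ (by omega)
    have h6 := mul_le_pow_of_const hZ (c := 16) (r := 4) (by norm_num) (le_refl (Z ^ (j + d + E)))
    have h0 : Nat.size 0 = 0 := Nat.size_zero
    by_cases hj : j < δ
    · obtain ⟨h7, h8⟩ := hρ j hj
      have h8' := le_pow_mono hZ h8 (show E ≤ j + d + E by omega)
      refine ⟨by simp only [Term.eval, if_pos hj]; omega, _, _, Exec.assign _ _ _ _, ?_,
        agree_update_temp d δ s _ _ le_rfl, ?_⟩
      · simp only [if_pos hj, AExp.cost, AExp.val, h7]; omega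
      · simp [AExp.val, Term.eval, hj, h7]
    · refine ⟨by simp [Term.eval, if_neg hj], _, _, Exec.assign _ _ _ _, ?_,
        agree_update_temp d δ s _ _ le_rfl, ?_⟩
      · simp only [if_neg hj, AExp.cost, AExp.val]; omega
      · simp [AExp.val, Term.eval, hj]
  | read a e ih =>
    intro d δ E
    obtain ⟨D, hD⟩ := ih d δ E
    refine ⟨(D + d + E) + 5, fun Z hZ s ρ hs hB hρ => ?_⟩
    obtain ⟨h1, T, s', hT, hTD, hA, hv⟩ := hD Z hZ s ρ hs hB hρ
    have h1' := le_pow_mono hZ h1 (show D ≤ D + d + E by omega)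
    have hTD' := le_pow_mono hZ hTD (show D ≤ D + d + E by omega)
    have h2' := le_pow_mono hZ (le_pow_of_const hZ d) (show d ≤ D + d + E by omega)
    have h3 := size_le_self d
    have h5 : 1 ≤ Z ^ (D + d + E) := Nat.one_le_pow _ _ (by omega)
    have h6 := mul_le_pow_of_const hZ (c := 32) (r := 5) (by norm_num) (le_refl (Z ^ (D + d + E)))
    have h0 : Nat.size 0 = 0 := Nat.size_zero
    by_cases ha : a = 3 ∨ a = 4
    · refine ⟨by simp [Term.eval, if_pos ha], _, _, Exec.seq hT (Exec.assign _ _ _ _), ?_,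
        hA.trans (agree_update_temp d δ s' _ _ le_rfl), ?_⟩
      · simp only [if_pos ha, AExp.cost, AExp.val]; omega
      · simp [AExp.val, Term.eval, ha]
    · have ha' := ha
      push Not at ha'
      have h7 := hB a (e.eval s δ ρ) ha'.1 ha'.2
      have h7' := le_pow_mono hZ h7 (show E ≤ D + d + E by omega)
      have h8 := hA.1 a (e.eval s δ ρ) ha'.1 ha'.2
      refine ⟨by simp only [Term.eval, if_neg ha]; omega, _, _,
        Exec.seq hT (Exec.assign _ _ _ _), ?_, hA.trans (agree_update_temp d δ s' _ _ le_rfl), ?_⟩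
      · simp only [if_neg ha, AExp.cost, AExp.val, hv, h8]; omega
      · simp [AExp.val, Term.eval, ha, hv, h8]
  | bin o e f ihe ihf =>
    intro d δ E
    obtain ⟨D, hD⟩ := ihe d δ E
    obtain ⟨D', hD'⟩ := ihf (d + 1) δ E
    refine ⟨(D + D' + d + 1) + 5, fun Z hZ s ρ hs hB hρ => ?_⟩
    obtain ⟨h1, T, s', hT, hTD, hA, hv⟩ := hD Z hZ s ρ hs hB hρ
    obtain ⟨h2, T', s'', hT', hTD', hA', hv'⟩ := hD' Z hZ s' ρ
      (by rw [hA.1 0 1 (by decide) (by decide)]; exact hs) (hB.of_sameTables hA.1)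
      (fun j hj => ⟨(hA.2.2 j hj).trans (hρ j hj).1, (hρ j hj).2⟩)
    rw [Term.eval_congr hA.1] at h2 hv'
    have h1' := le_pow_mono hZ h1 (show D ≤ D + D' + d + 1 by omega)
    have h2' := le_pow_mono hZ h2 (show D' ≤ D + D' + d + 1 by omega)
    have hTD2 := le_pow_mono hZ hTD (show D ≤ D + D' + d + 1 by omega)
    have hTD2' := le_pow_mono hZ hTD' (show D' ≤ D + D' + d + 1 by omega)
    have h3' := le_pow_mono hZ (le_pow_of_const hZ (d + 1)) (show d + 1 ≤ D + D' + d + 1 by omega)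
    have h3 := size_le_self d
    have h4 := size_le_self (d + 1)
    have h5 : 1 ≤ Z ^ (D + D' + d + 1) := Nat.one_le_pow _ _ (by omega)
    have h6 := mul_le_pow_of_const hZ (c := 32) (r := 5) (by norm_num)
      (le_refl (Z ^ (D + D' + d + 1)))
    have h7 := o.size_fn_le (e.eval s δ ρ) (f.eval s δ ρ)
    have h8 : s'' 3 d = e.eval s δ ρ := (hA'.2.1 d (by omega)).trans hv
    refine ⟨by simp only [Term.eval]; omega, _, _,
      Exec.seq hT (Exec.seq hT' (Exec.assign _ _ _ _)), ?_,
      (hA.trans (hA'.mono (by omega) le_rfl)).trans (agree_update_temp d δ s'' _ _ le_rfl), ?_⟩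
    · simp only [BinOp.cost_exp, BinOp.val_exp, AExp.cost, AExp.val, hv', h8]; omega
    · simp [AExp.val, BinOp.val_exp, Term.eval, hv', h8]
  | sum c p e ih =>
    intro d δ E
    obtain ⟨DL, hDL⟩ := limExp_cost c p
    -- The new loop variable is bounded by `c * m ^ p ≤ Z ^ DL`, so variables are now controlled
    -- with exponent `E + DL`.
    obtain ⟨D, hD⟩ := ih (d + 1) (δ + 1) (E + DL)
    refine ⟨(D + DL + d + δ + 1 + 4) * 2 + 4, fun Z hZ s ρ hs hB hρ => ?_⟩
    obtain ⟨hL1, hL2⟩ := hDL Z hZ s hs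
    have hLv := limExp_val c p s
    set N := c * s 0 1 ^ p with hN
    set Y := D + DL + d + δ + 1 with hY
    have hNY : N ≤ Z ^ Y := le_pow_mono hZ (hLv ▸ hL2) (by omega)
    have hbody : ∀ i < N, ∀ s', Agree d δ s s' → s' 4 δ = i →
        (e.eval s (δ + 1) (Function.update ρ δ i)).size ≤ Z ^ D ∧ ∃ T s'',
          Exec (e.compile (d + 1) (δ + 1)) s' T s'' ∧ T ≤ Z ^ D ∧ Agree (d + 1) (δ + 1) s' s'' ∧
            s'' 3 (d + 1) = e.eval s (δ + 1) (Function.update ρ δ i) := by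
      intro i hi s' hA hs'
      have := hD Z hZ s' (Function.update ρ δ i) (by rw [hA.1 0 1 (by decide) (by decide)]; exact hs)
        ((hB.mono (Nat.pow_le_pow_right (by omega) (by omega))).of_sameTables hA.1) ?_
      · rw [Term.eval_congr hA.1] at this
        exact this
      · intro j hj
        rcases Nat.lt_succ_iff_lt_or_eq.1 hj with hj | rfl
        · rw [Function.update_of_ne (by omega), hA.2.2 j hj]
          exact ⟨(hρ j hj).1, le_pow_mono hZ (hρ j hj).2 (by omega)⟩
        · rw [Function.update_self]
          refine ⟨hs', (size_le_self i).trans ?_⟩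
          have : N ≤ Z ^ DL := hLv ▸ hL2
          exact le_pow_mono hZ (hi.le.trans this) (by omega)
    have hsz : ∀ i < N, (e.eval s (δ + 1) (Function.update ρ δ i)).size ≤ Z ^ Y := by
      intro i hi
      have := (hbody i hi (Function.update s 4 (Function.update (s 4) δ i))
        (agree_update_var d δ s δ i le_rfl) (by simp)).1
      exact le_pow_mono hZ this (by omega)
    -- Every partial sum needs a size bound, because the accumulator is handled in each round.
    have hpart : ∀ i ≤ N, (∑ j ∈ Finset.range i,
        e.eval s (δ + 1) (Function.update ρ δ j)).size ≤ 2 * Z ^ Y := by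
      intro i hi
      refine (size_sum_range_le _ i (Z ^ Y) fun j hj => hsz j (by omega)).trans ?_
      omega
    have h5 : 1 ≤ Z ^ Y := Nat.one_le_pow _ _ (by omega)
    have hd1 := le_pow_mono hZ (le_pow_of_const hZ (d + 1)) (show d + 1 ≤ Y by omega)
    have hδ1 := le_pow_mono hZ (le_pow_of_const hZ δ) (show δ ≤ Y by omega)
    have h3 := size_le_self d
    have h4 := size_le_self (d + 1)
    have h4' := size_le_self δ
    have h0 : Nat.size 0 = 0 := Nat.size_zero
    have h01 : Nat.size 1 = 1 := by decide
    have hL1' := le_pow_mono hZ hL1 (show DL ≤ Y by omega)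
    have hL2' := le_pow_mono hZ hL2 (show DL ≤ Y by omega)
    have hL3 := size_le_self ((limExp c p).val s)
    have hlim : ∀ s', Agree d δ s s' → (limExp c p).val s' = N ∧ (limExp c p).cost s' ≤ Z ^ Y := by
      intro s' hA
      have h01' := hA.1 0 1 (by decide) (by decide)
      obtain ⟨h1, h2⟩ := hDL Z hZ s' (by rw [h01']; exact hs)
      exact ⟨by rw [limExp_val, h01'], le_pow_mono hZ h1 (by omega)⟩
    -- Invariant: after `i` rounds the variable `δ` is `i` and cell `d` holds the partial sum over
    -- `j < i`. The truncated difference in the guard vanishes exactly when the bound is reached.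
    -- The factors `12` and `40` are generous counts for guard and body.
    have key := exec_loop (g := .sub (limExp c p) (.get 4 (.lit δ)))
      (c := .seq (e.compile (d + 1) (δ + 1))
          (.seq (.assign 3 (.lit d) (.add (.get 3 (.lit d)) (.get 3 (.lit (d + 1)))))
            (.assign 4 (.lit δ) (.add (.get 4 (.lit δ)) (.lit 1)))))
      N (12 * Z ^ Y) (40 * Z ^ Y)
      (fun i s' => Agree d δ s s' ∧ s' 4 δ = i ∧ s' 3 d = ∑ j ∈ Finset.range i,
        e.eval s (δ + 1) (Function.update ρ δ j)) ?_ ?_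
      (Function.update (Function.update s 3 (Function.update (s 3) d 0)) 4
        (Function.update (Function.update s 3 (Function.update (s 3) d 0) 4) δ 0)) ?_
    · obtain ⟨T, s', hT, hTb, hA, hi, hv⟩ := key
      constructor
      · refine (hpart N le_rfl).trans ?_
        have := mul_le_pow_of_const hZ (c := 2) (r := Y + 12) (D := Y)
          (by calc 2 = 2 ^ 1 := rfl
                _ ≤ _ := Nat.pow_le_pow_right (by norm_num) (by omega)) (le_refl (Z ^ Y))
        refine this.trans (Nat.pow_le_pow_right (by omega) (by omega))
      · refine ⟨_, s', Exec.seq (Exec.assign _ _ _ _) (Exec.seq (Exec.assign _ _ _ _) hT), ?_, hA, hv⟩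
        simp only [AExp.cost, AExp.val, h0]
        have hT2 : T ≤ (2 * Z ^ Y) * (53 * Z ^ Y) :=
          hTb.trans (Nat.mul_le_mul (by omega) (by omega))
        have hT3 : (2 * Z ^ Y) * (53 * Z ^ Y) + 10 * Z ^ Y ≤ (16 * Z ^ Y) * (16 * Z ^ Y) := by
          nlinarith
        have h16 := mul_le_pow_of_const hZ (c := 16) (r := 4) (by norm_num) (le_refl (Z ^ Y))
        have hfin : (16 * Z ^ Y) * (16 * Z ^ Y) ≤ Z ^ ((Y + 4) * 2 + 4) := by
          calc _ ≤ Z ^ (Y + 4) * Z ^ (Y + 4) := Nat.mul_le_mul h16 h16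
            _ = Z ^ ((Y + 4) * 2) := by rw [← pow_add, mul_two]
            _ ≤ _ := Nat.pow_le_pow_right (by omega) (by omega)
        omega
    · rintro i hi s' ⟨hA, hi', hv⟩
      obtain ⟨hl1, hl2⟩ := hlim s' hA
      have hsi := size_le_self i
      have hsN := size_le_self N
      refine ⟨by simp only [AExp.val, hl1, hi']; omega, ?_, ?_⟩
      · simp only [AExp.cost, AExp.val, hl1, hi']; omega
      · obtain ⟨hz, T, s'', hT, hTD, hA', hv'⟩ := hbody i hi s' hA hi'
        have hz' := le_pow_mono hZ hz (show D ≤ Y by omega)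
        have hTD' := le_pow_mono hZ hTD (show D ≤ Y by omega)
        have e1 : s'' 3 d = ∑ j ∈ Finset.range i, e.eval s (δ + 1) (Function.update ρ δ j) :=
          (hA'.2.1 d (by omega)).trans hv
        have e2 : s'' 4 δ = i := (hA'.2.2 δ (by omega)).trans hi'
        have hp := hpart i hi.le
        have hp' := hpart (i + 1) hi
        rw [Finset.sum_range_succ] at hp'
        have hsi' := size_le_self (i + 1)
        refine ⟨_, _, Exec.seq hT (Exec.seq (Exec.assign _ _ _ _) (Exec.assign _ _ _ _)), ?_, ?_, ?_, ?_⟩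
        · simp only [AExp.cost, AExp.val, hv', e1, e2, h01,
            Function.update_of_ne (show (4 : ℕ) ≠ 3 by decide)]
          omega
        · exact ((hA.trans (hA'.mono (by omega) (by omega))).trans
            (agree_update_temp d δ s'' _ _ le_rfl)).trans (agree_update_var d δ _ _ _ le_rfl)
        · simp [AExp.val, e2]
        · simp [AExp.val, hv', e1, Finset.sum_range_succ]
    · rintro s' ⟨hA, hi', hv⟩
      obtain ⟨hl1, hl2⟩ := hlim s' hA
      have hsN := size_le_self N
      exact ⟨by simp [AExp.val, hl1, hi'], by simp only [AExp.cost, AExp.val, hl1, hi']; omega⟩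
    · exact ⟨(agree_update_temp d δ s _ _ le_rfl).trans (agree_update_var d δ _ _ _ le_rfl),
        by simp, by simp⟩

/-! ### Tables -/

/-- The expression reads only arrays in `S`. -/
def AExp.ReadsIn (S : ℕ → Prop) : AExp → Prop
  | .lit _ => True
  | .get a i => S a ∧ i.ReadsIn S
  | .add e f => e.ReadsIn S ∧ f.ReadsIn S
  | .sub e f => e.ReadsIn S ∧ f.ReadsIn S
  | .mul e f => e.ReadsIn S ∧ f.ReadsIn S
  | .div e f => e.ReadsIn S ∧ f.ReadsIn S

theorem AExp.val_congr {S : ℕ → Prop} {s s' : Memory} (h : ∀ a, S a → ∀ i, s' a i = s a i) :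
    ∀ e : AExp, e.ReadsIn S → e.val s' = e.val s
  | .lit _, _ => rfl
  | .get a i, he => by
    simp only [AExp.val, AExp.val_congr h i he.2, h a he.1]
  | .add e f, he => by simp only [AExp.val, AExp.val_congr h e he.1, AExp.val_congr h f he.2]
  | .sub e f, he => by simp only [AExp.val, AExp.val_congr h e he.1, AExp.val_congr h f he.2]
  | .mul e f, he => by simp only [AExp.val, AExp.val_congr h e he.1, AExp.val_congr h f he.2]
  | .div e f, he => by simp only [AExp.val, AExp.val_congr h e he.1, AExp.val_congr h f he.2]

theorem cost_op_le {Z D D' x y x' y' z : ℕ} (hZ : 2 ≤ Z) (hx : x ≤ Z ^ D) (hx' : x' ≤ Z ^ D)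
    (hy : y ≤ Z ^ D') (hy' : y' ≤ Z ^ D') (hz : z ≤ x' + y' + 1) :
    x + y + (1 + x' + y') ≤ Z ^ (D + D' + 3) ∧ z ≤ Z ^ (D + D' + 3) := by
  have h5 : 1 ≤ Z ^ (D + D') := Nat.one_le_pow _ _ (by omega)
  have h6 := mul_le_pow_of_const hZ (c := 8) (r := 3) (by norm_num) (le_refl (Z ^ (D + D')))
  have h1 := le_pow_mono hZ hx (show D ≤ D + D' by omega)
  have h2 := le_pow_mono hZ hx' (show D ≤ D + D' by omega)
  have h3 := le_pow_mono hZ hy (show D' ≤ D + D' by omega)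
  have h4 := le_pow_mono hZ hy' (show D' ≤ D + D' by omega)
  constructor <;> omega

theorem AExp.cost_bound (E : ℕ) : ∀ e : AExp, e.ReadsIn (fun a => a ≠ 3 ∧ a ≠ 4) →
    ∃ D, ∀ Z, 2 ≤ Z → ∀ s : Memory, CellsBounded (Z ^ E) s →
      e.cost s ≤ Z ^ D ∧ (e.val s).size ≤ Z ^ D
  | .lit c, _ => by
    refine ⟨c + 2, fun Z hZ s _ => ?_⟩
    have h1 := le_pow_of_const hZ c
    have h2 := size_le_self c
    have h3 := mul_le_pow_of_const hZ (c := 4) (r := 2) (by norm_num) (le_refl (Z ^ c))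
    have h4 : 1 ≤ Z ^ c := Nat.one_le_pow _ _ (by omega)
    simp only [AExp.cost, AExp.val]
    constructor <;> omega
  | .get a i, he => by
    obtain ⟨D, hD⟩ := AExp.cost_bound E i he.2
    refine ⟨D + E + 3, fun Z hZ s hB => ?_⟩
    obtain ⟨h1, h2⟩ := hD Z hZ s hB
    have := cost_op_le hZ h1 h2 (Nat.zero_le _) (hB a (i.val s) he.1.1 he.1.2)
      (z := (s a (i.val s)).size) (by omega)
    simp only [AExp.cost, AExp.val]
    constructor <;> omega
  | .add e f, he => by
    obtain ⟨D, hD⟩ := AExp.cost_bound E e he.1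
    obtain ⟨D', hD'⟩ := AExp.cost_bound E f he.2
    exact ⟨D + D' + 3, fun Z hZ s hB => cost_op_le hZ (hD Z hZ s hB).1 (hD Z hZ s hB).2
      (hD' Z hZ s hB).1 (hD' Z hZ s hB).2 (BinOp.add.size_fn_le _ _)⟩
  | .sub e f, he => by
    obtain ⟨D, hD⟩ := AExp.cost_bound E e he.1
    obtain ⟨D', hD'⟩ := AExp.cost_bound E f he.2
    exact ⟨D + D' + 3, fun Z hZ s hB => cost_op_le hZ (hD Z hZ s hB).1 (hD Z hZ s hB).2
      (hD' Z hZ s hB).1 (hD' Z hZ s hB).2 (BinOp.sub.size_fn_le _ _)⟩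
  | .mul e f, he => by
    obtain ⟨D, hD⟩ := AExp.cost_bound E e he.1
    obtain ⟨D', hD'⟩ := AExp.cost_bound E f he.2
    exact ⟨D + D' + 3, fun Z hZ s hB => cost_op_le hZ (hD Z hZ s hB).1 (hD Z hZ s hB).2
      (hD' Z hZ s hB).1 (hD' Z hZ s hB).2 (BinOp.mul.size_fn_le _ _)⟩
  | .div e f, he => by
    obtain ⟨D, hD⟩ := AExp.cost_bound E e he.1
    obtain ⟨D', hD'⟩ := AExp.cost_bound E f he.2
    exact ⟨D + D' + 3, fun Z hZ s hB => cost_op_le hZ (hD Z hZ s hB).1 (hD Z hZ s hB).2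
      (hD' Z hZ s hB).1 (hD' Z hZ s hB).2 (BinOp.div.size_fn_le _ _)⟩

/-- The memory `s` with the first `q` cells of array `a` filled by the sequence `X`. -/
def withTable (s : Memory) (a : ℕ) (X : ℕ → ℕ) (q : ℕ) : Memory :=
  Function.update s a fun i => if i < q then X i else s a i

/-- Fill the first `b` cells of array `a` by course-of-values recursion: cell `q` receives the
value of the term `e`, in which the variable `0` has the value `q`. -/
def tableProg (a : ℕ) (b : AExp) (e : Term) : Prog :=
  .seq (.assign 4 (.lit 0) (.lit 0)) (.loop (.sub b (.get 4 (.lit 0)))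
    (.seq (e.compile 0 1) (.seq (.assign a (.get 4 (.lit 0)) (.get 3 (.lit 0)))
      (.assign 4 (.lit 0) (.add (.get 4 (.lit 0)) (.lit 1))))))

theorem withTable_of_ne {s : Memory} {a : ℕ} {X : ℕ → ℕ} {q a' : ℕ} (h : a' ≠ a) :
    withTable s a X q a' = s a' := Function.update_of_ne h _ _

theorem withTable_self (s : Memory) (a : ℕ) (X : ℕ → ℕ) (q i : ℕ) :
    withTable s a X q a i = if i < q then X i else s a i := by simp [withTable]

theorem CellsBounded.withTable {B : ℕ} {s : Memory} (h : CellsBounded B s) {a : ℕ} {X : ℕ → ℕ}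
    {q : ℕ} (hX : ∀ i < q, (X i).size ≤ B) : CellsBounded B (withTable s a X q) := by
  intro a' i h3 h4
  by_cases ha : a' = a
  · subst ha
    rw [withTable_self]
    split_ifs with hi
    · exact hX i hi
    · exact h _ _ h3 h4
  · rw [withTable_of_ne ha]
    exact h _ _ h3 h4

/-- The recursion hypothesis evaluates `e` in the memory in which only the cells below `q` are
filled. The length `b` must not depend on array `a`, or the guard would change during the loop; `a ≠
0` protects the ranges of the bounded sums. -/
theorem tableProg_spec (a : ℕ) (b : AExp) (e : Term) (ha0 : a ≠ 0) (ha3 : a ≠ 3) (ha4 : a ≠ 4)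
    (hb : b.ReadsIn fun j => j ≠ a ∧ j ≠ 3 ∧ j ≠ 4) (hb' : b.ReadsIn fun j => j ≠ 3 ∧ j ≠ 4)
    (E : ℕ) : ∃ D, ∀ Z, 2 ≤ Z → ∀ (s : Memory) (X : ℕ → ℕ) (Q : ℕ),
      s 0 1 ≤ Z → CellsBounded (Z ^ E) s → b.val s = Q → Q ≤ Z ^ E →
      (∀ q < Q, (X q).size ≤ Z ^ E ∧ e.eval (withTable s a X q) 1 (fun _ => q) = X q) →
      ∃ T s', Exec (tableProg a b e) s T s' ∧ T ≤ Z ^ D ∧ SameTables (withTable s a X Q) s' := by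
  obtain ⟨D₁, hD₁⟩ := AExp.cost_bound E b hb'
  obtain ⟨D₂, hD₂⟩ := e.compile_spec 0 1 E
  refine ⟨(D₁ + D₂ + E + 6) * 2, fun Z hZ s X Q hs hB hQ hQE hX => ?_⟩
  set Y := D₁ + D₂ + E with hY
  have h5 : 1 ≤ Z ^ Y := Nat.one_le_pow _ _ (by omega)
  have h0 : Nat.size 0 = 0 := Nat.size_zero
  have h01 : Nat.size 1 = 1 := by decide
  have hQY := le_pow_mono hZ hQE (show E ≤ Y by omega)
  have hsQ := size_le_self Q
  have hguard : ∀ i ≤ Q, ∀ s', SameTables (withTable s a X i) s' →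
      CellsBounded (Z ^ E) s' ∧ s' 0 1 ≤ Z ∧ b.val s' = Q ∧ b.cost s' ≤ Z ^ Y := by
    intro i hi s' hs'
    have hB' : CellsBounded (Z ^ E) s' :=
      (hB.withTable (fun j hj => (hX j (by omega)).1)).of_sameTables hs'
    refine ⟨hB', ?_, ?_, le_pow_mono hZ (hD₁ Z hZ s' hB').1 (by omega)⟩
    · rw [hs' 0 1 (by decide) (by decide), withTable_of_ne (Ne.symm ha0)]; exact hs
    · rw [← hQ]
      refine AExp.val_congr (fun j hj l => ?_) b hb
      rw [hs' j l hj.2.1 hj.2.2, withTable_of_ne hj.1]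
  have key := exec_loop (g := .sub b (.get 4 (.lit 0)))
    (c := .seq (e.compile 0 1) (.seq (.assign a (.get 4 (.lit 0)) (.get 3 (.lit 0)))
      (.assign 4 (.lit 0) (.add (.get 4 (.lit 0)) (.lit 1))))) Q (8 * Z ^ Y) (30 * Z ^ Y)
    (fun i s' => SameTables (withTable s a X i) s' ∧ s' 4 0 = i) ?_ ?_
    (Function.update s 4 (Function.update (s 4) 0 0)) ?_
  · obtain ⟨T, s', hT, hTb, hs', hv⟩ := key
    refine ⟨_, s', Exec.seq (Exec.assign _ _ _ _) hT, ?_, hs'⟩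
    simp only [AExp.cost, AExp.val, h0]
    have hT2 : T ≤ (2 * Z ^ Y) * (39 * Z ^ Y) := hTb.trans (Nat.mul_le_mul (by omega) (by omega))
    have hT3 : (2 * Z ^ Y) * (39 * Z ^ Y) + 10 * Z ^ Y ≤ (16 * Z ^ Y) * (16 * Z ^ Y) := by
      nlinarith
    have h16 := mul_le_pow_of_const hZ (c := 16) (r := 6) (by norm_num) (le_refl (Z ^ Y))
    have hfin : (16 * Z ^ Y) * (16 * Z ^ Y) ≤ Z ^ ((Y + 6) * 2) := by
      calc _ ≤ Z ^ (Y + 6) * Z ^ (Y + 6) := Nat.mul_le_mul h16 h16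
        _ = Z ^ ((Y + 6) * 2) := by rw [← pow_add, mul_two]
    omega
  · rintro i hi s' ⟨hs', hi'⟩
    obtain ⟨hB', hs01, hbv, hbc⟩ := hguard i hi.le s' hs'
    have hsi := size_le_self i
    refine ⟨by simp only [AExp.val, hbv, hi']; omega,
      by simp only [AExp.cost, AExp.val, hbv, hi', h0]; omega, ?_⟩
    obtain ⟨hz, T, s'', hT, hTD, hA, hv⟩ := hD₂ Z hZ s' (fun _ => i) hs01 hB' (by
      intro j hj
      obtain rfl : j = 0 := by omega
      exact ⟨hi', hsi.trans (hi.le.trans hQE)⟩)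
    obtain ⟨hXs, hXv⟩ := hX i hi
    rw [Term.eval_congr hs', hXv] at hv
    have hXs' := le_pow_mono hZ hXs (show E ≤ Y by omega)
    have hTD' := le_pow_mono hZ hTD (show D₂ ≤ Y by omega)
    have e2 : s'' 4 0 = i := (hA.2.2 0 (by omega)).trans hi'
    refine ⟨_, _, Exec.seq hT (Exec.seq (Exec.assign _ _ _ _) (Exec.assign _ _ _ _)), ?_, ?_, ?_⟩
    · simp only [AExp.cost, AExp.val, e2, hv, h0, h01, Function.update_of_ne (Ne.symm ha4)]
      have := size_le_self (i + 1)
      omega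
    · intro a' j h3 h4
      simp only [AExp.val, e2, hv, Function.update_of_ne h4]
      by_cases ha : a' = a
      · subst ha
        have := (hA.1 a' j h3 h4).trans (hs' a' j h3 h4)
        rw [withTable_self] at this
        rw [Function.update_self, withTable_self]
        by_cases hj : j = i
        · subst hj; simp
        · rw [Function.update_of_ne hj, this]
          have : j < i ↔ j < i + 1 := by omega
          simp only [this]
      · rw [Function.update_of_ne ha, hA.1 a' j h3 h4, hs' a' j h3 h4, withTable_of_ne ha,
          withTable_of_ne ha]
    · simp [AExp.val, e2, Function.update_of_ne (Ne.symm ha4)]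
  · rintro s' ⟨hs', hi'⟩
    obtain ⟨hB', hs01, hbv, hbc⟩ := hguard Q le_rfl s' hs'
    exact ⟨by simp [AExp.val, hbv, hi'], by simp only [AExp.cost, AExp.val, hbv, hi', h0]; omega⟩
  · refine ⟨fun a' j h3 h4 => ?_, by simp⟩
    rw [Function.update_of_ne h4]
    by_cases ha : a' = a
    · subst ha; rw [withTable_self]; simp
    · rw [withTable_of_ne ha]

/-! ### Conjunctions of decisions -/

/-- The decision `f` on lists of constraints is computed in polynomial time by a program that works
in every memory that holds the input, and that leaves the input and array `8` untouched. -/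
def Robust {k : ℕ} (f : ∀ n : ℕ, List (Constraint k n) → Prop) : Prop :=
  ∃ c : Prog, ∀ E, ∃ D, ∀ (n : ℕ) (L : List (Constraint k n)) (s : Memory),
    (∀ a < 3, s a = inputMemory L a) → CellsBounded ((n + L.length + 2) ^ E) s →
    ∃ T s', Exec c s T s' ∧ T ≤ (n + L.length + 2) ^ D ∧
      CellsBounded ((n + L.length + 2) ^ D) s' ∧ (∀ a, a < 3 ∨ a = 8 → s' a = s a) ∧
      (f n L → s' 3 0 = 1) ∧ (¬ f n L → s' 3 0 = 0)

/-- A program that multiplies cell `0` of array `8` by the truth value of `f`. -/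
def Accumulates {k : ℕ} (c : Prog) (f : ∀ n : ℕ, List (Constraint k n) → Prop) : Prop :=
  ∀ E, ∃ D, ∀ (n : ℕ) (L : List (Constraint k n)) (s : Memory),
    (∀ a < 3, s a = inputMemory L a) → CellsBounded ((n + L.length + 2) ^ E) s →
    ∃ T s', Exec c s T s' ∧ T ≤ (n + L.length + 2) ^ D ∧
      CellsBounded ((n + L.length + 2) ^ D) s' ∧ (∀ a < 3, s' a = s a) ∧
      (f n L → s' 8 0 = s 8 0) ∧ (¬ f n L → s' 8 0 = 0)

/-- The factor is `0` or `1`, so the accumulator in array `8` does not grow. -/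
theorem Robust.exists_accumulates {k : ℕ} {f : ∀ n : ℕ, List (Constraint k n) → Prop}
    (hf : Robust f) : ∃ c, Accumulates c f := by
  obtain ⟨c, hc⟩ := hf
  refine ⟨.seq c (.assign 8 (.lit 0) (.mul (.get 8 (.lit 0)) (.get 3 (.lit 0)))), fun E => ?_⟩
  obtain ⟨D, hD⟩ := hc E
  refine ⟨D + E + 5, fun n L s hs hB => ?_⟩
  obtain ⟨T, s', hT, hTD, hB', hfr, h1, h0⟩ := hD n L s hs hB
  set Z := n + L.length + 2 with hZdef
  have hZ : 2 ≤ Z := by omega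
  have hY : 1 ≤ Z ^ (D + E) := Nat.one_le_pow _ _ (by omega)
  have hTD' := le_pow_mono hZ hTD (show D ≤ D + E by omega)
  have h8 : s' 8 0 = s 8 0 := by rw [hfr 8 (Or.inr rfl)]
  have hs8 : (s 8 0).size ≤ Z ^ (D + E) := le_pow_mono hZ (hB 8 0 (by decide) (by decide)) (by omega)
  have h32 := mul_le_pow_of_const hZ (c := 32) (r := 5) (by norm_num) (le_refl (Z ^ (D + E)))
  have hz0 : Nat.size 0 = 0 := Nat.size_zero
  have h01 : Nat.size 1 = 1 := by decide
  have hv : (s' 3 0).size ≤ 1 ∧ (s 8 0 * s' 3 0).size ≤ (s 8 0).size := by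
    by_cases h : f n L
    · rw [h1 h]; simp [h01]
    · rw [h0 h]; simp
  refine ⟨_, _, Exec.seq hT (Exec.assign _ _ _ _), ?_, ?_, ?_, ?_, ?_⟩
  · simp only [AExp.cost, AExp.val, h8, hz0]; omega
  · intro a i h3 h4
    by_cases ha : a = 8
    · subst ha
      rw [Function.update_self]
      by_cases hi : i = 0
      · subst hi
        simp only [AExp.val, Function.update_self, h8]; omega
      · simp only [AExp.val, Function.update_of_ne hi]
        exact le_pow_mono hZ (hB' 8 i h3 h4) (by omega)
    · rw [Function.update_of_ne ha]
      exact le_pow_mono hZ (hB' a i h3 h4) (by omega)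
  · intro a ha
    rw [Function.update_of_ne (by omega), hfr a (Or.inl ha)]
  · intro h; simp [AExp.val, h1 h, h8]
  · intro h; simp [AExp.val, h0 h]

/-- The next program starts from the memory that the previous one leaves, so its exponent `E` is the
previous `D`. The exponents compose a number of times that depends on `F` only, hence the time stays
polynomial. -/
theorem exists_accumulates_forall {k : ℕ} {ι : Type*} (F : List ι)
    (f : ι → ∀ n : ℕ, List (Constraint k n) → Prop) (hf : ∀ j ∈ F, Robust (f j)) :
    ∃ c, Accumulates c (fun n L => ∀ j ∈ F, f j n L) := by
  induction F with
  | nil =>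
    refine ⟨.skip, fun E => ⟨E, fun n L s hs hB => ⟨1, s, Exec.skip s, ?_, hB, fun _ _ => rfl, ?_, ?_⟩⟩⟩
    · exact Nat.one_le_pow _ _ (by omega)
    · simp
    · simp
  | cons j F ih =>
    obtain ⟨c, hc⟩ := (hf j (by simp)).exists_accumulates
    obtain ⟨c', hc'⟩ := ih fun i hi => hf i (by simp [hi])
    refine ⟨.seq c c', fun E => ?_⟩
    obtain ⟨D, hD⟩ := hc E
    obtain ⟨D', hD'⟩ := hc' D
    refine ⟨D + D' + 1, fun n L s hs hB => ?_⟩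
    obtain ⟨T, s', hT, hTD, hB', hfr, h1, h0⟩ := hD n L s hs hB
    obtain ⟨T', s'', hT', hTD', hB'', hfr', h1', h0'⟩ := hD' n L s'
      (fun a ha => (hfr a ha).trans (hs a ha)) hB'
    have hZ : 2 ≤ n + L.length + 2 := by omega
    have hTa := le_pow_mono hZ hTD (show D ≤ D + D' by omega)
    have hTb := le_pow_mono hZ hTD' (show D' ≤ D + D' by omega)
    refine ⟨_, s'', Exec.seq hT hT', ?_, ?_, fun a ha => (hfr' a ha).trans (hfr a ha), ?_, ?_⟩
    · have := mul_le_pow_of_const hZ (c := 2) (r := 1) (by norm_num)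
        (le_refl ((n + L.length + 2) ^ (D + D')))
      omega
    · exact hB''.mono (Nat.pow_le_pow_right (by omega) (by omega))
    · intro h
      rw [h1' fun i hi => h i (by simp [hi]), h1 (h j (by simp))]
    · intro h
      by_cases hF : ∀ i ∈ F, f i n L
      · rw [h1' hF, h0]
        intro hj
        exact h (by simpa using ⟨hj, hF⟩)
      · exact h0' hF

theorem inputMemory_size_le {k n : ℕ} (L : List (Constraint k n)) (a i : ℕ) :
    (inputMemory L a i).size ≤ n + L.length + 2 := by
  refine (size_le_self _).trans ?_
  unfold inputMemory
  split
  · split_ifs <;> omega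
  · split_ifs with h
    · cases h' : L[i / k]? with
      | none => simp
      | some C => simp only [Option.elim_some]; have := (C.2 ⟨i % k, Nat.mod_lt i h⟩).2; omega
    · omega
  · split_ifs with h
    · cases h' : L[i / k]? with
      | none => simp
      | some C => simp only [Option.elim_some]; split_ifs <;> omega
    · omega
  · omega

/-- A decision that is a finite conjunction of robustly computable ones is efficient. -/
theorem isEfficient_of_forall_robust {k : ℕ} {ι : Type*} (F : List ι)
    (f : ι → ∀ n : ℕ, List (Constraint k n) → Prop) (hf : ∀ j ∈ F, Robust (f j)) (A : Decision k)
    (hA : ∀ n (L : List (Constraint k n)), A n (L : Instance k n) = true ↔ ∀ j ∈ F, f j n L) :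
    A.IsEfficient := by
  obtain ⟨c, hc⟩ := exists_accumulates_forall F f hf
  obtain ⟨D, hD⟩ := hc 1
  refine ⟨.seq (.assign 8 (.lit 0) (.lit 1)) (.seq c (.assign 3 (.lit 0) (.get 8 (.lit 0)))),
    D + 6, fun n L => ?_⟩
  have hZ : 2 ≤ n + L.length + 2 := by omega
  have hz0 : Nat.size 0 = 0 := Nat.size_zero
  have h01 : Nat.size 1 = 1 := by decide
  set s₀ : Memory := Function.update (inputMemory L) 8 (Function.update (inputMemory L 8) 0 1)
  obtain ⟨T, s', hT, hTD, hB', hfr, h1, h0⟩ := hD n L s₀ (fun a ha => by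
      simp only [s₀]; rw [Function.update_of_ne (by omega)]) (fun a i h3 h4 => by
      rw [pow_one]
      simp only [s₀]
      by_cases ha : a = 8
      · subst ha
        rw [Function.update_self]
        by_cases hi : i = 0
        · subst hi; rw [Function.update_self, h01]; omega
        · rw [Function.update_of_ne hi]; exact inputMemory_size_le L 8 i
      · rw [Function.update_of_ne ha]; exact inputMemory_size_le L a i)
  have h8 : s₀ 8 0 = 1 := by simp [s₀]
  rw [h8] at h1
  have hv : (s' 8 0).size ≤ 1 ∧ s' 8 0 = if A n (L : Instance k n) = true then 1 else 0 := by
    by_cases h : A n (L : Instance k n) = true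
    · rw [h1 ((hA n L).1 h)]; simp [h, h01]
    · rw [h0 (fun h' => h ((hA n L).2 h'))]; simp [h]
  refine ⟨_, _, Exec.seq (Exec.assign _ _ _ _) (Exec.seq hT (Exec.assign _ _ _ _)), ?_, ?_⟩
  · simp only [AExp.cost, AExp.val, hz0, h01]
    have h32 := mul_le_pow_of_const hZ (c := 32) (r := 6) (by norm_num)
      (le_refl ((n + L.length + 2) ^ D))
    have hY : 1 ≤ (n + L.length + 2) ^ D := Nat.one_le_pow _ _ (by omega)
    omega
  · simp [AExp.val, hv.2]

/-! ### The matrix of a bilinear chaos -/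

section Chaos

set_option linter.unusedSectionVars false

variable {R α γ E : Type*} [CommRing R]

/-- The key of a hyperedge: its two halves, and the remaining part. -/
abbrev Key (α γ : Type*) : Type _ := (Bool → α) × γ

/-- The node at which a pair of hyperedges with an orientation starts. -/
def pairSrc (κ : E → Key α γ) (p : E × E × Bool) : Bool × α × α :=
  (p.2.2, (κ p.1).1 p.2.2, (κ p.2.1).1 p.2.2)

/-- The node at which a pair of hyperedges with an orientation ends. -/
def pairDst (κ : E → Key α γ) (p : E × E × Bool) : Bool × α × α :=
  (!p.2.2, (κ p.1).1 (!p.2.2), (κ p.2.1).1 (!p.2.2))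

/-- Two hyperedges with different keys whose keys have the same remaining part. -/
def Linked (κ : E → Key α γ) (e f : E) : Prop := (κ e).2 = (κ f).2 ∧ κ e ≠ κ f

instance [DecidableEq α] [DecidableEq γ] (κ : E → Key α γ) (e f : E) : Decidable (Linked κ e f) :=
  inferInstanceAs (Decidable (_ ∧ _))

theorem sum_pairs [Fintype E] (F : E × E × Bool → R) :
    ∑ p, F p = ∑ e, ∑ f, ∑ o, F (e, f, o) := by
  rw [Fintype.sum_prod_type]
  exact Finset.sum_congr rfl fun e _ => Fintype.sum_prod_type _

variable [DecidableEq α] [DecidableEq γ] [Fintype E]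

/-- The weight of a pair of hyperedges. -/
def pairWeight (κ : E → Key α γ) (ξ : E → R) (p : E × E × Bool) : R :=
  if Linked κ p.1 p.2.1 then ξ p.1 * ξ p.2.1 else 0

/-- The symmetric matrix that collects the linked pairs of hyperedges by their halves. -/
def chaosMatrix (κ : E → Key α γ) (ξ : E → R) : Matrix (Bool × α × α) (Bool × α × α) R :=
  fun x y => ∑ p, if pairSrc κ p = x ∧ pairDst κ p = y then pairWeight κ ξ p else 0

/-- The transfer matrix on pairs of hyperedges. -/
def walkMatrix (κ : E → Key α γ) (ξ : E → R) : Matrix (E × E × Bool) (E × E × Bool) R :=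
  fun p p' => if pairDst κ p = pairSrc κ p' then pairWeight κ ξ p else 0

/-- The total weight of the hyperedges with a given key. -/
def pushWeight (κ : E → Key α γ) (ξ : E → R) (v : Key α γ) : R :=
  ∑ e, if κ e = v then ξ e else 0

variable [Fintype α] [Fintype γ]

theorem sum_mul_pushWeight (κ : E → Key α γ) (ξ : E → R) (F : Key α γ → R) :
    ∑ v, pushWeight κ ξ v * F v = ∑ e, ξ e * F (κ e) := by
  simp only [pushWeight, Finset.sum_mul, ite_mul, zero_mul]
  rw [Finset.sum_comm]
  simp

/-- Both matrices are bilinear in the weights with coefficients that depend on the keys only, so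
hyperedges with equal keys can be merged. This identifies the matrices obtained from a listing of
the constraints, from the instance, and from the scopes. -/
theorem chaosMatrix_pushWeight (κ : E → Key α γ) (ξ : E → R) :
    chaosMatrix id (pushWeight κ ξ) = chaosMatrix κ ξ := by
  ext x y
  have h : ∀ (G : Key α γ → Key α γ → R), ∑ v, ∑ w, pushWeight κ ξ v * (pushWeight κ ξ w * G v w) =
      ∑ e, ∑ f, ξ e * (ξ f * G (κ e) (κ f)) := by
    intro G
    simp only [← Finset.mul_sum, sum_mul_pushWeight]
  have := h fun v w => ∑ o : Bool, if pairSrc id (v, w, o) = x ∧ pairDst id (v, w, o) = y then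
    (if Linked id v w then 1 else 0) else 0
  simp only [chaosMatrix, sum_pairs, pairWeight]
  convert this using 1
  · refine Finset.sum_congr rfl fun v _ => Finset.sum_congr rfl fun w _ => ?_
    simp only [Finset.mul_sum]
    refine Finset.sum_congr rfl fun o _ => ?_
    split_ifs <;> simp
  · refine Finset.sum_congr rfl fun v _ => Finset.sum_congr rfl fun w _ => ?_
    simp only [Finset.mul_sum]
    refine Finset.sum_congr rfl fun o _ => ?_
    by_cases h1 : pairSrc κ (v, w, o) = x ∧ pairDst κ (v, w, o) = y
    · have h2 : pairSrc id (κ v, κ w, o) = x ∧ pairDst id (κ v, κ w, o) = y := h1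
      rw [if_pos h1, if_pos h2]
      by_cases h3 : Linked κ v w
      · have h4 : Linked id (κ v) (κ w) := h3
        rw [if_pos h3, if_pos h4, mul_one]
      · have h4 : ¬ Linked id (κ v) (κ w) := h3
        rw [if_neg h3, if_neg h4]; simp
    · have h2 : ¬ (pairSrc id (κ v, κ w, o) = x ∧ pairDst id (κ v, κ w, o) = y) := h1
      rw [if_neg h1, if_neg h2]; simp

/-- `(S * Q) ^ (l + 1) = S * (Q * S) ^ l * Q`, and the trace is cyclic. -/
theorem trace_mul_pow_comm {m n : Type*} [Fintype m] [Fintype n] [DecidableEq m] [DecidableEq n]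
    (S : Matrix m n R) (Q : Matrix n m R) (l : ℕ) :
    ((S * Q) ^ (l + 1)).trace = ((Q * S) ^ (l + 1)).trace := by
  have h : ∀ l : ℕ, (S * Q) ^ l * S = S * (Q * S) ^ l := by
    intro l
    induction l with
    | zero => simp
    | succ l ih =>
      rw [pow_succ, pow_succ, Matrix.mul_assoc, Matrix.mul_assoc, ← Matrix.mul_assoc, ih,
        Matrix.mul_assoc]
  rw [pow_succ, ← Matrix.mul_assoc, h, Matrix.mul_assoc, Matrix.trace_mul_comm, Matrix.mul_assoc,
    ← pow_succ]

/-- The two matrices are the products, in the two orders, of the source incidence matrix `S` and the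
weighted target incidence matrix `Q`. The walk matrix is indexed by pairs of hyperedges, so for a
listed instance its size is governed by the number of constraints, the only quantity over which
machine terms can sum. -/
theorem trace_walkMatrix_pow [DecidableEq E] (κ : E → Key α γ) (ξ : E → R) (l : ℕ) :
    (walkMatrix κ ξ ^ (l + 1)).trace = (chaosMatrix κ ξ ^ (l + 1)).trace := by
  let S : Matrix (Bool × α × α) (E × E × Bool) R :=
    Matrix.of fun x p => if pairSrc κ p = x then 1 else 0
  let Q : Matrix (E × E × Bool) (Bool × α × α) R := Matrix.of fun p y =>
    if pairDst κ p = y then pairWeight κ ξ p else 0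
  have h1 : chaosMatrix κ ξ = S * Q := by
    ext x y
    simp only [chaosMatrix, Matrix.mul_apply, S, Q, Matrix.of_apply]
    refine Finset.sum_congr rfl fun p _ => ?_
    by_cases h : pairSrc κ p = x <;> by_cases h' : pairDst κ p = y <;> simp [h, h']
  have h2 : walkMatrix κ ξ = Q * S := by
    ext p p'
    simp only [walkMatrix, Matrix.mul_apply, S, Q, Matrix.of_apply, mul_ite, mul_one, mul_zero]
    rw [Finset.sum_ite_eq]
    simp
  rw [h1, h2, trace_mul_pow_comm]

/-- Flipping the orientation of a pair exchanges its source and its target and keeps its weight. -/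
theorem chaosMatrix_transpose (κ : E → Key α γ) (ξ : E → R) :
    (chaosMatrix κ ξ).transpose = chaosMatrix κ ξ := by
  ext x y
  simp only [Matrix.transpose_apply, chaosMatrix]
  refine Fintype.sum_equiv (Equiv.prodCongr (Equiv.refl E) (Equiv.prodCongr (Equiv.refl E)
    Equiv.boolNot)) _ _ fun p => ?_
  obtain ⟨e, f, o⟩ := p
  simp only [Equiv.prodCongr_apply, Prod.map, Equiv.refl_apply, Equiv.boolNot_apply, pairSrc, pairDst,
    Bool.not_not, pairWeight]
  congr 1
  rw [and_comm]

/-- Each linked pair enters once per orientation with the same contribution, hence the factor `2`.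
-/
theorem quadraticForm_chaosMatrix (κ : E → Key α γ) (ξ : E → R) (X : Bool → α → R) :
    (fun x : Bool × α × α => X x.1 x.2.1 * X x.1 x.2.2) ⬝ᵥ (chaosMatrix κ ξ).mulVec
      (fun x => X x.1 x.2.1 * X x.1 x.2.2) =
    2 * ∑ e, ∑ f, if Linked κ e f then
      (ξ e * (X false ((κ e).1 false) * X true ((κ e).1 true))) *
      (ξ f * (X false ((κ f).1 false) * X true ((κ f).1 true))) else 0 := by
  have h1 : (fun x : Bool × α × α => X x.1 x.2.1 * X x.1 x.2.2) ⬝ᵥ (chaosMatrix κ ξ).mulVec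
      (fun x => X x.1 x.2.1 * X x.1 x.2.2) = ∑ p : E × E × Bool, pairWeight κ ξ p *
        ((X (pairSrc κ p).1 (pairSrc κ p).2.1 * X (pairSrc κ p).1 (pairSrc κ p).2.2) *
        (X (pairDst κ p).1 (pairDst κ p).2.1 * X (pairDst κ p).1 (pairDst κ p).2.2)) := by
    simp only [dotProduct, Matrix.mulVec, chaosMatrix, Finset.mul_sum, Finset.sum_mul]
    rw [Finset.sum_congr rfl fun x _ => Finset.sum_comm, Finset.sum_comm]
    refine Finset.sum_congr rfl fun p _ => ?_
    rw [Finset.sum_eq_single (pairSrc κ p)]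
    · rw [Finset.sum_eq_single (pairDst κ p)]
      · simp; ring
      · intro y _ hy; simp [Ne.symm hy]
      · simp
    · intro x _ hx; simp [Ne.symm hx]
    · simp
  rw [h1, Fintype.sum_prod_type, Finset.mul_sum]
  refine Finset.sum_congr rfl fun e _ => ?_
  rw [Fintype.sum_prod_type, Finset.mul_sum]
  refine Finset.sum_congr rfl fun f _ => ?_
  simp only [Fintype.sum_bool, pairWeight, pairSrc, pairDst, Bool.not_true, Bool.not_false]
  split_ifs <;> ring

variable [LinearOrder R] [IsStrictOrderedRing R]

/-- Spectral norm against trace, without eigenvalues so that it holds over `ℤ`: Cauchy–Schwarz gives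
`⟨x, A ^ l x⟩² ≤ ⟨x, x⟩ ⟨x, A ^ (2 l) x⟩`, which is iterated along powers of two. -/
theorem quadraticForm_pow_le {ι : Type*} [Fintype ι] [DecidableEq ι] (A : Matrix ι ι R)
    (hA : A.transpose = A) (x : ι → R) (J : ℕ) :
    (x ⬝ᵥ A.mulVec x) ^ 2 ^ (J + 1) ≤ (x ⬝ᵥ x) ^ 2 ^ (J + 1) * (A ^ 2 ^ (J + 1)).trace := by
  have hc : 0 ≤ x ⬝ᵥ x := Finset.sum_nonneg fun i _ => mul_self_nonneg _
  have hT : ∀ l, (A ^ l).transpose = A ^ l := fun l => by rw [Matrix.transpose_pow, hA]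
  have hsq : ∀ l, x ⬝ᵥ (A ^ (2 * l)).mulVec x = (A ^ l).mulVec x ⬝ᵥ (A ^ l).mulVec x := by
    intro l
    rw [two_mul, pow_add, ← Matrix.mulVec_mulVec, Matrix.dotProduct_mulVec, ← Matrix.mulVec_transpose, hT]
  have hCS : ∀ u v : ι → R, (u ⬝ᵥ v) ^ 2 ≤ (u ⬝ᵥ u) * (v ⬝ᵥ v) := by
    intro u v
    simp only [dotProduct, ← sq]
    exact Finset.sum_mul_sq_le_sq_mul_sq _ u v
  have h1 : ∀ l, (x ⬝ᵥ (A ^ l).mulVec x) ^ 2 ≤ (x ⬝ᵥ x) * (x ⬝ᵥ (A ^ (2 * l)).mulVec x) := by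
    intro l
    rw [hsq]; exact hCS _ _
  have h2 : ∀ j, (x ⬝ᵥ A.mulVec x) ^ 2 ^ (j + 1) ≤
      (x ⬝ᵥ x) ^ (2 ^ (j + 1) - 1) * (x ⬝ᵥ (A ^ 2 ^ (j + 1)).mulVec x) := by
    intro j
    induction j with
    | zero => simpa using h1 1
    | succ j ih =>
      have h0 : 0 ≤ (x ⬝ᵥ A.mulVec x) ^ 2 ^ (j + 1) :=
        Even.pow_nonneg ⟨2 ^ j, by rw [pow_succ]; ring⟩ _
      have h3 := pow_le_pow_left₀ h0 ih 2
      rw [← pow_mul, mul_pow, ← pow_mul, ← pow_succ] at h3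
      refine h3.trans ((mul_le_mul_of_nonneg_left (h1 _) (pow_nonneg hc _)).trans (le_of_eq ?_))
      have hp : 1 ≤ 2 ^ (j + 1) := Nat.one_le_two_pow
      rw [← mul_assoc, ← pow_succ, ← pow_succ']
      congr 2
      rw [pow_succ 2 (j + 1)]
      omega
  refine (h2 J).trans ?_
  -- With `B = A ^ 2 ^ J` the left side is `|B x|²`. Cauchy–Schwarz in each row bounds it by `|x|²`
  -- times the sum of the squared entries of `B`, which is the trace of `B * Bᵀ = B ^ 2`.
  have h4 : x ⬝ᵥ (A ^ 2 ^ (J + 1)).mulVec x ≤ (x ⬝ᵥ x) * (A ^ 2 ^ (J + 1)).trace := by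
    rw [pow_succ' 2 J, hsq, two_mul, pow_add]
    have hHH : A ^ 2 ^ J * A ^ 2 ^ J = A ^ 2 ^ J * (A ^ 2 ^ J).transpose := by rw [hT]
    rw [hHH]
    simp only [Matrix.trace, Matrix.diag, Matrix.mul_apply, Matrix.transpose_apply, Finset.mul_sum]
    change ∑ i, (A ^ 2 ^ J).mulVec x i * (A ^ 2 ^ J).mulVec x i ≤ _
    refine Finset.sum_le_sum fun i _ => ?_
    rw [← Finset.mul_sum]
    have := hCS ((A ^ 2 ^ J) i) x
    rw [mul_comm (x ⬝ᵥ x), ← sq]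
    exact this
  have hp : 2 ^ (J + 1) - 1 + 1 = 2 ^ (J + 1) := Nat.sub_add_cancel Nat.one_le_two_pow
  calc _ ≤ (x ⬝ᵥ x) ^ (2 ^ (J + 1) - 1) * ((x ⬝ᵥ x) * (A ^ 2 ^ (J + 1)).trace) :=
        mul_le_mul_of_nonneg_left h4 (pow_nonneg hc _)
    _ = _ := by rw [← mul_assoc, ← pow_succ, hp]

/-- The certificate: a bound on the multilinear form of the weights from the diagonal and the trace
of a power of the chaos matrix. -/
theorem abs_form_le_of_certificate (κ : E → Key α γ) (ξ : E → R) (X : Bool → α → R)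
    (hX : ∀ b a, X b a ^ 2 = 1) (z : γ → R) (hz : ∀ c, z c ^ 2 = 1) (J : ℕ) (K m : R)
    (hm : 0 ≤ m) (hK : 0 ≤ K)
    (h1 : 2 * K ^ 2 * Fintype.card γ * ∑ v, pushWeight κ ξ v ^ 2 ≤ m ^ 2)
    (h2 : (2 * K ^ 2 * (Fintype.card α ^ 2 * Fintype.card γ)) ^ 2 ^ (J + 1) *
      (chaosMatrix κ ξ ^ 2 ^ (J + 1)).trace ≤ (m ^ 2) ^ 2 ^ (J + 1)) :
    K * |∑ e, ξ e * (X false ((κ e).1 false) * X true ((κ e).1 true) * z (κ e).2)| ≤ m := by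
  set Y := ∑ e, ξ e * (X false ((κ e).1 false) * X true ((κ e).1 true) * z (κ e).2) with hY
  set g : E → R := fun e => ξ e * (X false ((κ e).1 false) * X true ((κ e).1 true)) with hg
  set a₀ := ∑ e, ∑ f, if Linked κ e f then g e * g f else 0 with ha₀
  have hsplit : Y = ∑ c, z c * ∑ e, if (κ e).2 = c then g e else 0 := by
    simp only [Finset.mul_sum, hY]
    rw [Finset.sum_comm]
    refine Finset.sum_congr rfl fun e _ => ?_
    simp [hg]; ring
  -- Cauchy–Schwarz over the remaining part removes `z`. In the expanded square, pairs with equal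
  -- keys lose their signs and give the diagonal; the other pairs are the linked ones.
  have hY2 : Y ^ 2 ≤ Fintype.card γ * (∑ v, pushWeight κ ξ v ^ 2 + a₀) := by
    have hcs := Finset.sum_mul_sq_le_sq_mul_sq Finset.univ z
      (fun c => ∑ e, if (κ e).2 = c then g e else 0)
    rw [← hsplit] at hcs
    refine hcs.trans (le_of_eq ?_)
    simp only [hz, Finset.sum_const, Finset.card_univ, nsmul_eq_mul, mul_one]
    congr 1
    have e1 : ∑ c, (∑ e, if (κ e).2 = c then g e else 0) ^ 2 =
        ∑ e, ∑ f, if (κ e).2 = (κ f).2 then g e * g f else 0 := by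
      simp only [sq, Finset.sum_mul_sum]
      rw [Finset.sum_comm]
      refine Finset.sum_congr rfl fun e _ => ?_
      rw [Finset.sum_comm]
      refine Finset.sum_congr rfl fun f _ => ?_
      simp only [ite_mul, zero_mul]
      rw [Finset.sum_ite_eq]
      simp [eq_comm]
    have e2 : ∑ v, pushWeight κ ξ v ^ 2 = ∑ e, ∑ f, if κ e = κ f then g e * g f else 0 := by
      simp only [sq, pushWeight, Finset.sum_mul_sum]
      rw [Finset.sum_comm]
      refine Finset.sum_congr rfl fun e _ => ?_
      rw [Finset.sum_comm]
      refine Finset.sum_congr rfl fun f _ => ?_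
      simp only [ite_mul, zero_mul]
      rw [Finset.sum_ite_eq]
      simp only [Finset.mem_univ, if_true, mul_ite, mul_zero]
      by_cases h : κ e = κ f
      · rw [if_pos h, if_pos h.symm]
        simp only [hg, h]
        have ha := hX false ((κ f).1 false)
        have hb := hX true ((κ f).1 true)
        calc ξ e * ξ f = ξ e * ξ f * (X false ((κ f).1 false) ^ 2 * X true ((κ f).1 true) ^ 2) := by
              rw [ha, hb]; ring
          _ = _ := by ring
      · rw [if_neg h, if_neg (Ne.symm h)]
    rw [e1, e2, ha₀, ← Finset.sum_add_distrib]
    refine Finset.sum_congr rfl fun e _ => ?_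
    rw [← Finset.sum_add_distrib]
    refine Finset.sum_congr rfl fun f _ => ?_
    by_cases h : κ e = κ f
    · simp [h, Linked]
    · by_cases h' : (κ e).2 = (κ f).2 <;> simp [h, h', Linked]
  have hquad := quadraticForm_chaosMatrix κ ξ X
  have hpow := quadraticForm_pow_le (chaosMatrix κ ξ) (chaosMatrix_transpose κ ξ)
    (fun x => X x.1 x.2.1 * X x.1 x.2.2) J
  have hnorm : (fun x : Bool × α × α => X x.1 x.2.1 * X x.1 x.2.2) ⬝ᵥ
      (fun x => X x.1 x.2.1 * X x.1 x.2.2) = 2 * (Fintype.card α : R) ^ 2 := by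
    have : ∀ x : Bool × α × α, (X x.1 x.2.1 * X x.1 x.2.2) * (X x.1 x.2.1 * X x.1 x.2.2) = 1 := by
      intro x
      rw [mul_mul_mul_comm, ← sq, ← sq, hX, hX, one_mul]
    simp only [dotProduct, this]
    simp [sq]
  rw [hquad, hnorm] at hpow
  -- The root of order `2 ^ (J + 1)` is taken by contradiction, through strict monotonicity of
  -- powers, since `R` need not contain roots.
  have ha₀' : 2 * K ^ 2 * Fintype.card γ * a₀ ≤ m ^ 2 := by
    have hpos : (2 : ℕ) ^ (J + 1) ≠ 0 := by positivity
    have heven : Even (2 ^ (J + 1)) := ⟨2 ^ J, by rw [pow_succ]; ring⟩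
    have h3 : (2 * K ^ 2 * Fintype.card γ * a₀) ^ 2 ^ (J + 1) ≤ (m ^ 2) ^ 2 ^ (J + 1) := by
      refine le_trans ?_ h2
      have e1 : 2 * K ^ 2 * Fintype.card γ * a₀ = (K ^ 2 * Fintype.card γ) * (2 * a₀) := by ring
      have e2 : 2 * K ^ 2 * ((Fintype.card α : R) ^ 2 * Fintype.card γ) =
        (K ^ 2 * Fintype.card γ) * (2 * (Fintype.card α : R) ^ 2) := by ring
      rw [e1, e2, mul_pow, mul_pow _ (2 * _) , mul_assoc]
      exact mul_le_mul_of_nonneg_left hpow (heven.pow_nonneg _)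
    by_contra hlt
    push Not at hlt
    exact absurd h3 (not_le.2 (pow_lt_pow_left₀ hlt (sq_nonneg m) hpos))
  -- The diagonal and the linked pairs use at most half of `m ^ 2` each; this is the factor `2` in
  -- both tests.
  have hfin : (K * |Y|) ^ 2 ≤ m ^ 2 := by
    rw [mul_pow, sq_abs]
    have := mul_le_mul_of_nonneg_left hY2 (sq_nonneg K)
    nlinarith
  exact (pow_le_pow_iff_left₀ (mul_nonneg hK (abs_nonneg _)) hm two_ne_zero).1 hfin

end Chaos

/-! ### Splits of coordinate sets and the certificate of an instance -/

/-- A set of coordinates that is split into two halves of the same size and a remaining part. -/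
structure Split (k : ℕ) where
  q : ℕ
  u : ℕ
  half : Bool → Fin q → Fin k
  last : Fin u → Fin k
  inj : Function.Injective (Sum.elim (fun x : Bool × Fin q => half x.1 x.2) last)

namespace Split

variable {k : ℕ} (σ : Split k)

/-- The key of a scope. -/
def key {n : ℕ} (S : Fin k → Fin n) : Key (Fin σ.q → Fin n) (Fin σ.u → Fin n) :=
  (fun b i => S (σ.half b i), fun i => S (σ.last i))

/-- The product of the entries of a tuple on the coordinates of the split. -/
def sign (c : Fin k → ℤˣ) : ℤ :=
  ((∏ i, (c (σ.half false i) : ℤ)) * ∏ i, (c (σ.half true i) : ℤ)) * ∏ i, (c (σ.last i) : ℤ)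

/-- The total signs of the constraints of an instance by the keys of their scopes. -/
def instWeight {n : ℕ} (I : Instance k n) (v : Key (Fin σ.q → Fin n) (Fin σ.u → Fin n)) : ℤ :=
  (I.map fun C => if σ.key C.2 = v then σ.sign C.1 else 0).sum

/-- The logarithm of the exponent of the trace in the certificate. -/
def logExp (n : ℕ) : ℕ := n.size.size + 1

/-- The conditions checked by the algorithm for one split. -/
def Certifies (K : ℕ) {n : ℕ} (I : Instance k n) : Prop :=
  2 * (K : ℤ) ^ 2 * n ^ σ.u * ∑ v, σ.instWeight I v ^ 2 ≤ (Multiset.card I : ℤ) ^ 2 ∧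
  (2 * (K : ℤ) ^ 2 * ((n ^ σ.q) ^ 2 * n ^ σ.u)) ^ 2 ^ logExp n *
    (chaosMatrix id (σ.instWeight I) ^ 2 ^ logExp n).trace ≤
      ((Multiset.card I : ℤ) ^ 2) ^ 2 ^ logExp n

theorem pushWeight_list {n : ℕ} (L : List (Constraint k n)) :
    pushWeight (fun i : Fin L.length => σ.key (L[i]).2) (fun i => σ.sign (L[i]).1) =
      σ.instWeight (L : Instance k n) := by
  funext v
  simp only [pushWeight, instWeight, Multiset.map_coe, Multiset.sum_coe]
  rw [← Fin.sum_univ_fun_getElem]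
  rfl

/-- The list of all coordinates of the split. -/
def coords : List (Fin k) :=
  List.ofFn (σ.half false) ++ (List.ofFn (σ.half true) ++ List.ofFn σ.last)

end Split

/-! ### The program that checks the certificate of a split -/

namespace Term

/-- Equality test. -/
def eqT (x y : Term) : Term := .bin .sub (.lit 1) (.bin .add (.bin .sub x y) (.bin .sub y x))

/-- Test of `x ≤ y`. -/
def leT (x y : Term) : Term := .bin .sub (.lit 1) (.bin .sub x y)

/-- Remainder. -/
def modT (x y : Term) : Term := .bin .sub x (.bin .mul (.bin .div x y) y)

/-- Power with a fixed exponent. -/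
def powT (x : Term) : ℕ → Term
  | 0 => .lit 1
  | r + 1 => .bin .mul (powT x r) x

/-- The number of constraints. -/
def sizeT : Term := .read 0 (.lit 1)

/-- The entry of coordinate `l` of the constraint `i` in the array `a`. -/
def entryT (k a : ℕ) (l : Fin k) (i : Term) : Term :=
  .read a (.bin .add (.bin .mul i (.lit k)) (.lit l))

/-- Test whether the scopes of two constraints agree on a list of coordinates. -/
def sameT {k : ℕ} (i j : Term) : List (Fin k) → Term
  | [] => .lit 1
  | l :: cs => .bin .mul (eqT (entryT k 1 l i) (entryT k 1 l j)) (sameT i j cs)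

/-- The number of negations of a constraint on a list of coordinates. -/
def negT {k : ℕ} (i : Term) : List (Fin k) → Term
  | [] => .lit 0
  | l :: cs => .bin .add (entryT k 2 l i) (negT i cs)

variable (s : Memory) (δ : ℕ) (ρ : ℕ → ℕ)

theorem eval_eqT (x y : Term) :
    (eqT x y).eval s δ ρ = if x.eval s δ ρ = y.eval s δ ρ then 1 else 0 := by
  simp only [eqT, eval, BinOp.fn]
  split_ifs <;> omega

theorem eval_leT (x y : Term) :
    (leT x y).eval s δ ρ = if x.eval s δ ρ ≤ y.eval s δ ρ then 1 else 0 := by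
  simp only [leT, eval, BinOp.fn]
  split_ifs <;> omega

theorem eval_modT (x y : Term) : (modT x y).eval s δ ρ = x.eval s δ ρ % y.eval s δ ρ := by
  simp only [modT, eval, BinOp.fn]
  have := Nat.div_add_mod' (x.eval s δ ρ) (y.eval s δ ρ)
  omega

theorem eval_powT (x : Term) (r : ℕ) : (powT x r).eval s δ ρ = x.eval s δ ρ ^ r := by
  induction r with
  | zero => rfl
  | succ r ih => simp only [powT, eval, BinOp.fn, ih, pow_succ]

end Term

/-! ### Values of the basic terms in a memory that holds an instance. -/

section Input

variable {k n : ℕ} {L : List (Constraint k n)} {s : Memory}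

/-- The memory holds the input `L`. -/
def Holds (L : List (Constraint k n)) (s : Memory) : Prop := ∀ a < 3, s a = inputMemory L a

theorem Holds.size (h : Holds L s) : s 0 1 = L.length := by rw [h 0 (by decide)]; rfl

theorem Holds.vars (h : Holds L s) : s 0 0 = n := by rw [h 0 (by decide)]; rfl

theorem index_div (k : ℕ) (l : Fin k) (i : ℕ) : (i * k + l) / k = i ∧ (i * k + l) % k = l := by
  have hk : 0 < k := l.pos
  constructor
  · rw [mul_comm, Nat.mul_add_div hk, Nat.div_eq_of_lt l.2, add_zero]
  · rw [mul_comm, Nat.mul_add_mod, Nat.mod_eq_of_lt l.2]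

theorem Holds.scope (h : Holds L s) (l : Fin k) {i : ℕ} (hi : i < L.length) :
    s 1 (i * k + l) = ((L[i]).2 l : ℕ) := by
  rw [h 1 (by decide)]
  obtain ⟨h1, h2⟩ := index_div k l i
  have hk : 0 < k := l.pos
  simp only [inputMemory, dif_pos hk, h1, h2, List.getElem?_eq_getElem hi, Option.elim_some]

theorem Holds.neg (h : Holds L s) (l : Fin k) {i : ℕ} (hi : i < L.length) :
    s 2 (i * k + l) = if (L[i]).1 l = -1 then 1 else 0 := by
  rw [h 2 (by decide)]
  obtain ⟨h1, h2⟩ := index_div k l i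
  have hk : 0 < k := l.pos
  simp only [inputMemory, dif_pos hk, h1, h2, List.getElem?_eq_getElem hi, Option.elim_some]

variable (δ : ℕ) (ρ : ℕ → ℕ)

theorem Holds.eval_sizeT (h : Holds L s) : Term.sizeT.eval s δ ρ = L.length := by
  simp [Term.sizeT, Term.eval, h.size]

theorem Holds.eval_sameT (h : Holds L s) {i j : ℕ} (hi : i < L.length) (hj : j < L.length)
    {x y : Term} (hx : x.eval s δ ρ = i) (hy : y.eval s δ ρ = j) (cs : List (Fin k)) :
    (Term.sameT x y cs).eval s δ ρ = if ∀ l ∈ cs, (L[i]).2 l = (L[j]).2 l then 1 else 0 := by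
  induction cs with
  | nil => simp [Term.sameT, Term.eval]
  | cons l cs ih =>
    simp only [Term.sameT, Term.eval, BinOp.fn, ih, Term.eval_eqT, Term.entryT, hx, hy]
    simp only [show ¬ (1 = 3 ∨ 1 = 4) by decide, if_false, h.scope l hi, h.scope l hj, Fin.val_inj,
      List.forall_mem_cons, ite_and]
    split_ifs <;> simp

theorem Holds.eval_negT (h : Holds L s) {i : ℕ} (hi : i < L.length)
    {x : Term} (hx : x.eval s δ ρ = i) (cs : List (Fin k)) :
    (-1 : ℤ) ^ (Term.negT x cs).eval s δ ρ = (cs.map fun l => ((L[i]).1 l : ℤ)).prod := by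
  induction cs with
  | nil => simp [Term.negT, Term.eval]
  | cons l cs ih =>
    simp only [Term.negT, Term.eval, BinOp.fn, pow_add, ih, Term.entryT, hx]
    simp only [show ¬ (2 = 3 ∨ 2 = 4) by decide, if_false, h.neg l hi, List.map_cons, List.prod_cons]
    congr 1
    rcases Int.units_eq_one_or ((L[i]).1 l) with h1 | h1 <;> rw [h1] <;> simp

end Input

/-! ### Powers of integer matrices by repeated squaring in natural numbers. -/

/-- The layers of squared matrices; the entries are split into a positive part (`β = 0`) and a
negative part (`β = 1`). -/
def layer (N : ℕ) (base : ℕ → ℕ → ℕ → ℕ) : ℕ → ℕ → ℕ → ℕ → ℕ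
  | 0, x, y, β => base x y β
  | t + 1, x, y, β => ∑ z ∈ Finset.range N, ∑ c ∈ Finset.range 2,
      layer N base t x z c * layer N base t z y ((β + c) % 2)

/-- Each squaring turns an exponent `a` of `2 * N` into `2 * a + 1`, starting from `0`. -/
theorem layer_le (N : ℕ) (base : ℕ → ℕ → ℕ → ℕ) (hb : ∀ x y β, base x y β ≤ 1) (t : ℕ) :
    ∀ x y β, layer N base t x y β ≤ (2 * N) ^ (2 ^ t - 1) := by
  induction t with
  | zero => simpa [layer] using hb
  | succ t ih =>
    intro x y β
    calc layer N base (t + 1) x y β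
        ≤ ∑ z ∈ Finset.range N, ∑ c ∈ Finset.range 2,
          (2 * N) ^ (2 ^ t - 1) * (2 * N) ^ (2 ^ t - 1) :=
          Finset.sum_le_sum fun z _ => Finset.sum_le_sum fun c _ => Nat.mul_le_mul (ih _ _ _) (ih _ _ _)
      _ = (2 * N) * ((2 * N) ^ (2 ^ t - 1) * (2 * N) ^ (2 ^ t - 1)) := by
          simp only [Finset.sum_const, Finset.card_range, smul_eq_mul]; ring
      _ = (2 * N) ^ (2 ^ (t + 1) - 1) := by
          rw [← pow_add, ← pow_succ']
          congr 1
          have : 1 ≤ 2 ^ t := Nat.one_le_two_pow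
          rw [pow_succ]; omega

/-- `(A - B)² = (A A + B B) - (A B + B A)`: the sign index of a product is the sum of the sign
indices modulo `2`. -/
theorem layer_sub (N : ℕ) (base : ℕ → ℕ → ℕ → ℕ) (t : ℕ) : ∀ x y : Fin N,
    (layer N base t x y 0 : ℤ) - layer N base t x y 1 =
      ((Matrix.of fun x y : Fin N => (base x y 0 : ℤ) - base x y 1) ^ 2 ^ t) x y := by
  induction t with
  | zero => intro x y; simp [layer]
  | succ t ih =>
    intro x y
    rw [pow_succ, pow_mul, sq, Matrix.mul_apply]
    simp only [← ih]
    simp only [layer, Finset.sum_range_succ, Finset.sum_range_zero, zero_add, Nat.zero_mod]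
    push_cast
    rw [Finset.sum_range, Finset.sum_range, ← Finset.sum_sub_distrib]
    refine Finset.sum_congr rfl fun z _ => ?_
    ring

theorem Split.key_fst_eq {k n : ℕ} (σ : Split k) (S S' : Fin k → Fin n) (b : Bool) :
    (σ.key S).1 b = (σ.key S').1 b ↔ ∀ l ∈ List.ofFn (σ.half b), S l = S' l := by
  simp [Split.key, funext_iff]

theorem Split.key_snd_eq {k n : ℕ} (σ : Split k) (S S' : Fin k → Fin n) :
    (σ.key S).2 = (σ.key S').2 ↔ ∀ l ∈ List.ofFn σ.last, S l = S' l := by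
  simp [Split.key, funext_iff]

theorem Split.key_eq {k n : ℕ} (σ : Split k) (S S' : Fin k → Fin n) :
    σ.key S = σ.key S' ↔ ∀ l ∈ σ.coords, S l = S' l := by
  rw [Prod.ext_iff, key_snd_eq, funext_iff, Bool.forall_bool, key_fst_eq, key_fst_eq]
  simp only [coords, List.mem_append, or_imp, forall_and, and_assoc]

theorem Split.prod_coords {k : ℕ} (σ : Split k) (c : Fin k → ℤˣ) :
    (σ.coords.map fun l => (c l : ℤ)).prod = σ.sign c := by
  simp [coords, sign, List.map_ofFn, List.prod_ofFn, Function.comp_def, mul_assoc]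

theorem Split.sign_eq_or {k : ℕ} (σ : Split k) (c : Fin k → ℤˣ) : σ.sign c = 1 ∨ σ.sign c = -1 := by
  have : σ.sign c = (((∏ i, c (σ.half false i)) * ∏ i, c (σ.half true i)) * ∏ i, c (σ.last i) : ℤˣ) := by
    simp [sign]
  rw [this]
  rcases Int.units_eq_one_or
    (((∏ i, c (σ.half false i)) * ∏ i, c (σ.half true i)) * ∏ i, c (σ.last i)) with h | h
  · exact Or.inl (by rw [h]; rfl)
  · exact Or.inr (by rw [h]; rfl)

/-! ### The transfer matrix on numbered pairs of constraints. -/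

/-- The pair of positions with an orientation that a number encodes. -/
def decodeState {m : ℕ} (x : Fin (2 * m ^ 2)) : Fin m × Fin m × Bool :=
  (⟨x / 2 / m, by
      rw [Nat.div_div_eq_div_mul, Nat.div_lt_iff_lt_mul (by
        rcases Nat.eq_zero_or_pos m with rfl | h
        · exact absurd x.2 (by simp)
        · omega)]
      have := x.2; nlinarith⟩,
    ⟨x / 2 % m, Nat.mod_lt _ (by
        rcases Nat.eq_zero_or_pos m with rfl | h
        · exact absurd x.2 (by simp)
        · exact h)⟩,
    decide ((x : ℕ) % 2 = 1))

/-- The number of the state `(i, j, o)` is `2 * (i * m + j) + o`. -/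
theorem decodeState_bijective (m : ℕ) : Function.Bijective (decodeState (m := m)) := by
  rw [Fintype.bijective_iff_injective_and_card]
  constructor
  · intro x y h
    simp only [decodeState, Prod.mk.injEq, Fin.mk.injEq, decide_eq_decide] at h
    obtain ⟨h1, h2, h3⟩ := h
    have h4 : (x : ℕ) / 2 = y / 2 := by
      rw [← Nat.div_add_mod ((x : ℕ) / 2) m, ← Nat.div_add_mod ((y : ℕ) / 2) m, h1, h2]
    apply Fin.ext
    omega
  · simp; ring

section Base

variable {k n : ℕ} (σ : Split k) (L : List (Constraint k n))

/-- The keys of the listed constraints. -/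
def listKey (i : Fin L.length) : Key (Fin σ.q → Fin n) (Fin σ.u → Fin n) := σ.key (L[i]).2

/-- The signs of the listed constraints. -/
def listSign (i : Fin L.length) : ℤ := σ.sign (L[i]).1

/-- The positive (`β = 0`) and negative (`β = 1`) part of the transfer matrix. -/
def walkBase (x y β : ℕ) : ℕ :=
  if h : x < 2 * L.length ^ 2 ∧ y < 2 * L.length ^ 2 then
    if Linked (listKey σ L) (decodeState ⟨x, h.1⟩).1 (decodeState ⟨x, h.1⟩).2.1 ∧
      pairDst (listKey σ L) (decodeState ⟨x, h.1⟩) = pairSrc (listKey σ L) (decodeState ⟨y, h.2⟩) ∧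
      β = (if listSign σ L (decodeState ⟨x, h.1⟩).1 * listSign σ L (decodeState ⟨x, h.1⟩).2.1 = 1
        then 0 else 1) then 1 else 0
  else 0

theorem walkBase_le (x y β : ℕ) : walkBase σ L x y β ≤ 1 := by
  unfold walkBase
  split_ifs <;> simp

theorem walkBase_sub (x y : Fin (2 * L.length ^ 2)) :
    (walkBase σ L x y 0 : ℤ) - walkBase σ L x y 1 =
      walkMatrix (listKey σ L) (listSign σ L) (decodeState x) (decodeState y) := by
  have hs : ∀ i j, listSign σ L i * listSign σ L j = 1 ∨ listSign σ L i * listSign σ L j = -1 := by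
    intro i j
    rcases σ.sign_eq_or (L[i]).1 with h | h <;> rcases σ.sign_eq_or (L[j]).1 with h' | h' <;>
      simp only [listSign, h, h'] <;> decide
  simp only [walkBase, x.2, y.2, and_self, dif_pos, walkMatrix, pairWeight]
  by_cases h1 : Linked (listKey σ L) (decodeState x).1 (decodeState x).2.1 <;>
  by_cases h2 : pairDst (listKey σ L) (decodeState x) = pairSrc (listKey σ L) (decodeState y) <;>
  rcases hs (decodeState x).1 (decodeState x).2.1 with h3 | h3 <;>
  simp [h1, h2, h3]

/-- The trace does not change under renumbering of the states, passage from the walk matrix to the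
chaos matrix, and merging of equal keys; the result depends on the multiset of constraints but not
on its listing. -/
theorem trace_walkBase_pow (t : ℕ) :
    ((Matrix.of fun x y : Fin (2 * L.length ^ 2) =>
      (walkBase σ L x y 0 : ℤ) - walkBase σ L x y 1) ^ 2 ^ t).trace =
    (chaosMatrix id (σ.instWeight (L : Instance k n)) ^ 2 ^ t).trace := by
  let e := Equiv.ofBijective _ (decodeState_bijective L.length)
  have h1 : (Matrix.of fun x y : Fin (2 * L.length ^ 2) =>
      (walkBase σ L x y 0 : ℤ) - walkBase σ L x y 1) =
      Matrix.reindexAlgEquiv ℤ ℤ e.symm (walkMatrix (listKey σ L) (listSign σ L)) := by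
    ext x y
    simp only [Matrix.of_apply, walkBase_sub]
    rfl
  have h2 : (2 : ℕ) ^ t = (2 ^ t - 1) + 1 := (Nat.sub_add_cancel Nat.one_le_two_pow).symm
  rw [h1, ← map_pow]
  have h3 : ∀ M : Matrix (Fin L.length × Fin L.length × Bool) (Fin L.length × Fin L.length × Bool) ℤ,
      (Matrix.reindexAlgEquiv ℤ ℤ e.symm M).trace = M.trace := by
    intro M
    simp only [Matrix.trace, Matrix.diag, Matrix.coe_reindexAlgEquiv, Matrix.reindex_apply,
      Matrix.submatrix_apply]
    exact Equiv.sum_comp e fun i => M i i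
  rw [h3, h2, trace_walkMatrix_pow, ← chaosMatrix_pushWeight]
  rw [show pushWeight (listKey σ L) (listSign σ L) = _ from σ.pushWeight_list L]

end Base

namespace Term

variable {k : ℕ} (σ : Split k)

/-- First position of an encoded state. -/
def fstT (x : Term) : Term := .bin .div (.bin .div x (.lit 2)) sizeT

/-- Second position of an encoded state. -/
def sndT (x : Term) : Term := modT (.bin .div x (.lit 2)) sizeT

/-- Parity of the number of negations of two constraints. -/
def parityT (i j : Term) : Term := modT (.bin .add (negT i σ.coords) (negT j σ.coords)) (.lit 2)

/-- The term for `walkBase`. -/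
def baseT (x y b : Term) : Term :=
  .bin .mul (.bin .mul (.bin .mul (sameT (fstT x) (sndT x) (List.ofFn σ.last))
    (.bin .sub (.lit 1) (sameT (fstT x) (sndT x) σ.coords)))
    (eqT b (parityT σ (fstT x) (sndT x))))
    (.bin .add
      (.bin .mul (.bin .mul (eqT (modT x (.lit 2)) (.lit 0)) (eqT (modT y (.lit 2)) (.lit 1)))
        (.bin .mul (sameT (fstT x) (fstT y) (List.ofFn (σ.half true)))
          (sameT (sndT x) (sndT y) (List.ofFn (σ.half true)))))
      (.bin .mul (.bin .mul (eqT (modT x (.lit 2)) (.lit 1)) (eqT (modT y (.lit 2)) (.lit 0)))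
        (.bin .mul (sameT (fstT x) (fstT y) (List.ofFn (σ.half false)))
          (sameT (sndT x) (sndT y) (List.ofFn (σ.half false))))))

end Term

section BaseEval

variable {k n : ℕ} {L : List (Constraint k n)} {s : Memory} (δ : ℕ) (ρ : ℕ → ℕ) (σ : Split k)

theorem Holds.eval_parityT (h : Holds L s) (i j : Fin L.length) {x y : Term}
    (hx : x.eval s δ ρ = i) (hy : y.eval s δ ρ = j) :
    (Term.parityT σ x y).eval s δ ρ = if listSign σ L i * listSign σ L j = 1 then 0 else 1 := by
  have h1 := h.eval_negT δ ρ i.2 hx σ.coords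
  have h2 := h.eval_negT δ ρ j.2 hy σ.coords
  rw [σ.prod_coords] at h1 h2
  simp only [Term.parityT, Term.eval_modT, Term.eval, BinOp.fn]
  have h3 : listSign σ L i * listSign σ L j =
      (-1) ^ ((Term.negT x σ.coords).eval s δ ρ + (Term.negT y σ.coords).eval s δ ρ) := by
    rw [pow_add, h1, h2]; rfl
  rw [h3]
  rcases Nat.even_or_odd
    ((Term.negT x σ.coords).eval s δ ρ + (Term.negT y σ.coords).eval s δ ρ) with h4 | h4
  · rw [h4.neg_one_pow, if_pos rfl, Nat.even_iff.1 h4]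
  · rw [h4.neg_one_pow, if_neg (by decide), Nat.odd_iff.1 h4]

theorem Holds.eval_baseT (h : Holds L s) {vx vy vb : ℕ} (hvx : vx < 2 * L.length ^ 2)
    (hvy : vy < 2 * L.length ^ 2) {x y b : Term} (hx : x.eval s δ ρ = vx)
    (hy : y.eval s δ ρ = vy) (hb : b.eval s δ ρ = vb) :
    (Term.baseT σ x y b).eval s δ ρ = walkBase σ L vx vy vb := by
  set p := decodeState (⟨vx, hvx⟩ : Fin (2 * L.length ^ 2)) with hp
  set p' := decodeState (⟨vy, hvy⟩ : Fin (2 * L.length ^ 2)) with hp'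
  have hf : (Term.fstT x).eval s δ ρ = p.1 := by
    simp [Term.fstT, Term.eval, BinOp.fn, hx, h.eval_sizeT, hp, decodeState]
  have hs : (Term.sndT x).eval s δ ρ = p.2.1 := by
    simp [Term.sndT, Term.eval, BinOp.fn, hx, h.eval_sizeT, hp, decodeState, Term.eval_modT]
  have hf' : (Term.fstT y).eval s δ ρ = p'.1 := by
    simp [Term.fstT, Term.eval, BinOp.fn, hy, h.eval_sizeT, hp', decodeState]
  have hs' : (Term.sndT y).eval s δ ρ = p'.2.1 := by
    simp [Term.sndT, Term.eval, BinOp.fn, hy, h.eval_sizeT, hp', decodeState, Term.eval_modT]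
  have ho : p.2.2 = decide (vx % 2 = 1) := rfl
  have ho' : p'.2.2 = decide (vy % 2 = 1) := rfl
  simp only [Term.baseT, Term.eval, BinOp.fn, Term.eval_eqT, Term.eval_modT,
    h.eval_sameT δ ρ p.1.2 p.2.1.2 hf hs, h.eval_sameT δ ρ p.1.2 p'.1.2 hf hf',
    h.eval_sameT δ ρ p.2.1.2 p'.2.1.2 hs hs', h.eval_parityT δ ρ σ p.1 p.2.1 hf hs, hx, hy, hb]
  simp only [walkBase, hvx, hvy, and_self, dif_pos, ← hp, ← hp', Linked, pairDst, pairSrc,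
    Prod.mk.injEq, ho, ho']
  have hm : ∀ v : ℕ, v % 2 = 0 ∨ v % 2 = 1 := fun v => by omega
  have hmul : ∀ (a b : Prop) [Decidable a] [Decidable b],
      (if a then 1 else 0) * (if b then 1 else 0) = if a ∧ b then 1 else 0 := by
    intro a b _ _
    by_cases ha : a <;> by_cases hb : b <;> simp [ha, hb]
  have hsub : ∀ (a : Prop) [Decidable a], 1 - (if a then 1 else 0) = if ¬ a then 1 else 0 := by
    intro a _
    by_cases ha : a <;> simp [ha]
  -- The two summands of `Term.baseT` belong to the two orientations of the first state and cannot
  -- both be nonzero, so their sum is again a truth value.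
  have hor : ∀ (a b c d : Prop) [Decidable a] [Decidable b] [Decidable c] [Decidable d],
      ¬ (a ∧ b) → (a → c → d) → (b → c → d) → (c → d → a ∨ b) → (d → c) →
      (if c then 1 else 0) * ((if a then 1 else 0) + (if b then 1 else 0)) = if d then 1 else 0 := by
    intro a b c d _ _ _ _
    by_cases ha : a <;> by_cases hb : b <;> by_cases hc : c <;> by_cases hd : d <;>
      simp [ha, hb, hc, hd]
  simp only [hmul, hsub]
  apply hor
  · omega
  all_goals
    rcases hm vx with h4 | h4 <;> rcases hm vy with h5 | h5 <;>
    simp only [h4, h5, zero_ne_one, one_ne_zero, decide_true, decide_false, Bool.not_true,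
      Bool.not_false, Bool.true_eq_false, Bool.false_eq_true, listKey, σ.key_snd_eq, σ.key_eq,
      σ.key_fst_eq, ne_eq, Fin.getElem_fin, false_and, and_false, true_and, and_true, false_or,
      or_false] <;> tauto

end BaseEval

/-! ### Terms for the three tables and for the two tests. -/

namespace Term

/-- The number of encoded states. -/
def statesT : Term := .bin .mul (.lit 2) (powT sizeT 2)

/-- The index of an entry of a layer. -/
def indexT (t x y b : Term) : Term :=
  .bin .add (.bin .mul (.bin .add (.bin .mul (.bin .add (.bin .mul t statesT) x) statesT) y)
    (.lit 2)) b

/-- The sign part of the index `q`. -/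
def idxSign (q : Term) : Term := modT q (.lit 2)

/-- The column part of the index `q`. -/
def idxCol (q : Term) : Term := modT (.bin .div q (.lit 2)) statesT

/-- The row part of the index `q`. -/
def idxRow (q : Term) : Term := modT (.bin .div (.bin .div q (.lit 2)) statesT) statesT

/-- The layer part of the index `q`. -/
def idxLayer (q : Term) : Term := .bin .div (.bin .div (.bin .div q (.lit 2)) statesT) statesT

/-- The recursion for the layers of squared matrices, kept in array `7`. -/
def layerT {k : ℕ} (σ : Split k) : Term :=
  .bin .add (.bin .mul (eqT (idxLayer (.var 0)) (.lit 0))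
      (baseT σ (idxRow (.var 0)) (idxCol (.var 0)) (idxSign (.var 0))))
    (.bin .mul (.bin .sub (.lit 1) (eqT (idxLayer (.var 0)) (.lit 0)))
      (.sum 2 2 (.sum 2 0 (.bin .mul
        (.read 7 (indexT (.bin .sub (idxLayer (.var 0)) (.lit 1)) (idxRow (.var 0)) (.var 1) (.var 2)))
        (.read 7 (indexT (.bin .sub (idxLayer (.var 0)) (.lit 1)) (.var 1) (idxCol (.var 0))
          (modT (.bin .add (idxSign (.var 0)) (.var 2)) (.lit 2))))))))

/-- The recursion for the bit length, kept in array `5`. -/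
def bitLengthT : Term :=
  .bin .mul (.bin .sub (.lit 1) (eqT (.var 0) (.lit 0)))
    (.bin .add (.read 5 (.bin .div (.var 0) (.lit 2))) (.lit 1))

/-- The recursion for the iterated squares of `x` and `y`, kept in array `6`. -/
def squaresT (x y : Term) : Term :=
  .bin .add
    (.bin .mul (eqT (.bin .div (.var 0) (.lit 2)) (.lit 0))
      (.bin .add (.bin .mul (eqT (modT (.var 0) (.lit 2)) (.lit 0)) x)
        (.bin .mul (eqT (modT (.var 0) (.lit 2)) (.lit 1)) y)))
    (.bin .mul (.bin .sub (.lit 1) (eqT (.bin .div (.var 0) (.lit 2)) (.lit 0)))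
      (.bin .mul (.read 6 (.bin .sub (.var 0) (.lit 2))) (.read 6 (.bin .sub (.var 0) (.lit 2)))))

/-- The number of variables. -/
def varsT : Term := .read 0 (.lit 0)

/-- The factor of the trace in the certificate. -/
def traceFactorT {k : ℕ} (σ : Split k) (K : ℕ) : Term :=
  .bin .mul (.lit (2 * K ^ 2)) (.bin .mul (powT (powT varsT σ.q) 2) (powT varsT σ.u))

/-- The logarithm of the exponent of the trace. -/
def logExpT : Term := .bin .add (.read 5 (.read 5 varsT)) (.lit 1)

/-- One part of the trace. -/
def traceT (b : ℕ) : Term := .sum 2 2 (.read 7 (indexT logExpT (.var 0) (.var 0) (.lit b)))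

/-- The test on the trace. -/
def traceTestT : Term :=
  leT (.bin .mul (.read 6 (.bin .add (.bin .mul (.lit 2) logExpT) (.lit 1))) (traceT 0))
    (.bin .add (.read 6 (.bin .mul (.lit 2) logExpT))
      (.bin .mul (.read 6 (.bin .add (.bin .mul (.lit 2) logExpT) (.lit 1))) (traceT 1)))

/-- One part of the diagonal. -/
def diagT {k : ℕ} (σ : Split k) (b : ℕ) : Term :=
  .sum 1 1 (.sum 1 1 (.bin .mul (sameT (.var 0) (.var 1) σ.coords)
    (eqT (.lit b) (parityT σ (.var 0) (.var 1)))))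

/-- The factor of the diagonal in the certificate. -/
def diagFactorT {k : ℕ} (σ : Split k) (K : ℕ) : Term :=
  .bin .mul (.lit (2 * K ^ 2)) (powT varsT σ.u)

/-- The test on the diagonal. -/
def diagTestT {k : ℕ} (σ : Split k) (K : ℕ) : Term :=
  leT (.bin .mul (diagFactorT σ K) (diagT σ 0))
    (.bin .add (powT sizeT 2) (.bin .mul (diagFactorT σ K) (diagT σ 1)))

end Term

theorem size_eq_succ {q : ℕ} (hq : q ≠ 0) : q.size = (q / 2).size + 1 := by
  conv_lhs => rw [← Nat.bit_testBit_zero_shiftRight_one q]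
  rw [Nat.size_bit, Nat.shiftRight_one]
  rwa [Nat.bit_testBit_zero_shiftRight_one]

theorem two_pow_size_le (a : ℕ) : 2 ^ a.size ≤ 2 * a + 1 := by
  rcases Nat.eq_zero_or_pos a with rfl | h
  · simp
  · have h1 : a.size ≠ 0 := by
      rw [Ne, Nat.size_eq_zero]; omega
    have h2 : a.size - 1 < a.size := by omega
    have h3 := Nat.lt_size.1 h2
    have h4 : 2 ^ a.size = 2 * 2 ^ (a.size - 1) := by
      rw [← pow_succ']; congr 1; omega
    omega

theorem two_pow_logExp_le (n : ℕ) : 2 ^ Split.logExp n ≤ 4 * n + 2 := by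
  have h1 := two_pow_size_le n.size
  have h2 := size_le_self n
  rw [Split.logExp, pow_succ]
  omega

theorem layer_index_decode {N t x y b : ℕ} (hx : x < N) (hy : y < N) (hb : b < 2) :
    (((t * N + x) * N + y) * 2 + b) % 2 = b ∧
    (((t * N + x) * N + y) * 2 + b) / 2 % N = y ∧
    (((t * N + x) * N + y) * 2 + b) / 2 / N % N = x ∧
    (((t * N + x) * N + y) * 2 + b) / 2 / N / N = t := by
  have hN : 0 < N := by omega
  have h1 : (((t * N + x) * N + y) * 2 + b) / 2 = (t * N + x) * N + y := by omega
  have h2 : ((t * N + x) * N + y) / N = t * N + x := by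
    rw [mul_comm, Nat.mul_add_div hN, Nat.div_eq_of_lt hy, add_zero]
  have h3 : (t * N + x) / N = t := by
    rw [mul_comm, Nat.mul_add_div hN, Nat.div_eq_of_lt hx, add_zero]
  refine ⟨by omega, ?_, ?_, ?_⟩
  · rw [h1, mul_comm, Nat.mul_add_mod, Nat.mod_eq_of_lt hy]
  · rw [h1, h2, mul_comm, Nat.mul_add_mod, Nat.mod_eq_of_lt hx]
  · rw [h1, h2, h3]

/-- The contents of array `7`. -/
def layerTable (N : ℕ) (base : ℕ → ℕ → ℕ → ℕ) (q : ℕ) : ℕ :=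
  layer N base (q / 2 / N / N) (q / 2 / N % N) (q / 2 % N) (q % 2)

/-- The contents of array `6`. -/
def squaresTable (x y q : ℕ) : ℕ := (if q % 2 = 0 then x else y) ^ 2 ^ (q / 2)

section Eval

variable {k n : ℕ} {L : List (Constraint k n)} {s : Memory}

theorem Holds.eval_statesT (h : Holds L s) (δ : ℕ) (ρ : ℕ → ℕ) :
    Term.statesT.eval s δ ρ = 2 * L.length ^ 2 := by
  simp [Term.statesT, Term.eval, BinOp.fn, Term.eval_powT, h.eval_sizeT]

theorem Holds.eval_varsT (h : Holds L s) (δ : ℕ) (ρ : ℕ → ℕ) : Term.varsT.eval s δ ρ = n := by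
  simp [Term.varsT, Term.eval, h.vars]

theorem eval_bitLengthT (s : Memory) (q : ℕ) :
    Term.bitLengthT.eval (withTable s 5 Nat.size q) 1 (fun _ => q) = q.size := by
  simp only [Term.bitLengthT, Term.eval, Term.eval_eqT, BinOp.fn, withTable_self]
  by_cases hq : q = 0
  · simp [hq]
  · have : q / 2 < q := by omega
    simp [hq, this, ← size_eq_succ hq]

theorem eval_squaresT (s : Memory) (q : ℕ) (x y : Term) (vx vy : ℕ)
    (hx : x.eval (withTable s 6 (squaresTable vx vy) q) 1 (fun _ => q) = vx)
    (hy : y.eval (withTable s 6 (squaresTable vx vy) q) 1 (fun _ => q) = vy) :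
    (Term.squaresT x y).eval (withTable s 6 (squaresTable vx vy) q) 1 (fun _ => q) =
      squaresTable vx vy q := by
  simp only [Term.squaresT, Term.eval, Term.eval_eqT, Term.eval_modT, BinOp.fn, hx, hy, withTable_self,
    Nat.zero_lt_one, if_true]
  by_cases hq : q / 2 = 0
  · rcases (show q % 2 = 0 ∨ q % 2 = 1 by omega) with h1 | h1 <;> simp [hq, h1, squaresTable]
  · have h1 : q - 2 < q := by omega
    have h2 : (q - 2) % 2 = q % 2 := by omega
    have h3 : q / 2 = (q - 2) / 2 + 1 := by omega
    simp only [squaresTable, h1, h2, hq, if_false, if_true, Nat.sub_zero, zero_mul, zero_add, one_mul,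
      show ¬ (6 = 3 ∨ 6 = 4) by decide]
    rw [h3, pow_succ 2, pow_mul, sq]

theorem Holds.eval_layerT (h : Holds L s) (σ : Split k) {q : ℕ} (hN : 0 < 2 * L.length ^ 2) :
    (Term.layerT σ).eval (withTable s 7 (layerTable (2 * L.length ^ 2) (walkBase σ L)) q) 1
      (fun _ => q) = layerTable (2 * L.length ^ 2) (walkBase σ L) q := by
  set N := 2 * L.length ^ 2 with hNdef
  set X := layerTable N (walkBase σ L) with hX
  set s' := withTable s 7 X q with hs'
  have h' : Holds L s' := fun a ha => by rw [hs', withTable_of_ne (by omega), h a ha]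
  have hst : ∀ δ ρ, Term.statesT.eval s' δ ρ = N := fun δ ρ => h'.eval_statesT δ ρ
  have hy : q / 2 % N < N := Nat.mod_lt _ hN
  have hx : q / 2 / N % N < N := Nat.mod_lt _ hN
  have hvar : ∀ (δ : ℕ) (ρ : ℕ → ℕ), 0 < δ → ρ 0 = q →
      (Term.idxSign (.var 0)).eval s' δ ρ = q % 2 ∧ (Term.idxCol (.var 0)).eval s' δ ρ = q / 2 % N ∧
      (Term.idxRow (.var 0)).eval s' δ ρ = q / 2 / N % N ∧
      (Term.idxLayer (.var 0)).eval s' δ ρ = q / 2 / N / N := by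
    intro δ ρ hδ hρ
    simp only [Term.idxSign, Term.idxCol, Term.idxRow, Term.idxLayer, Term.eval_modT, Term.eval,
      BinOp.fn, hst, hδ, if_true, hρ, and_self]
  obtain ⟨h1, h2, h3, h4⟩ := hvar 1 (fun _ => q) (by omega) rfl
  simp only [Term.layerT, Term.eval, Term.eval_eqT, BinOp.fn]
  rw [h'.eval_baseT 1 (fun _ => q) σ hx hy h3 h2 h1, h4]
  by_cases ht : q / 2 / N / N = 0
  · simp only [ht, if_true, one_mul, Nat.sub_self, zero_mul, add_zero]
    simp only [hX, layerTable, ht, layer]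
  · simp only [ht, if_false, zero_mul, zero_add, one_mul, Nat.sub_zero, h'.size, pow_zero, mul_one,
      show ¬ (7 = 3 ∨ 7 = 4) by decide, if_false]
    obtain ⟨t, ht'⟩ : ∃ t, q / 2 / N / N = t + 1 := ⟨q / 2 / N / N - 1, by omega⟩
    have hq1 : q = (((t + 1) * N + q / 2 / N % N) * N + q / 2 % N) * 2 + q % 2 := by
      have e1 := Nat.div_add_mod' q 2
      have e2 := Nat.div_add_mod' (q / 2) N
      have e3 := Nat.div_add_mod' (q / 2 / N) N
      rw [← ht', e3, e2, e1]
    conv_rhs => rw [hX, layerTable, ht', layer]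
    refine Finset.sum_congr rfl fun z hz => Finset.sum_congr rfl fun c hc => ?_
    rw [Finset.mem_range] at hz hc
    -- The numbering is by layers, so all of layer `t` precedes every index of layer `t + 1`: the
    -- recursion reads only filled cells.
    have hlt : ∀ x y b, x < N → y < N → b < 2 → ((t * N + x) * N + y) * 2 + b < q := by
      intro x y b hx hy hb
      rw [hq1]
      have e1 : t * N + x + 1 ≤ (t + 1) * N + q / 2 / N % N := by
        rw [Nat.succ_mul]; omega
      have e2 := Nat.mul_le_mul_right N e1
      rw [Nat.succ_mul] at e2
      omega
    have hread : ∀ x y b, x < N → y < N → b < 2 → s' 7 (((t * N + x) * N + y) * 2 + b) =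
        layer N (walkBase σ L) t x y b := by
      intro x y b hx hy hb
      obtain ⟨d1, d2, d3, d4⟩ := layer_index_decode (t := t) hx hy hb
      rw [hs', withTable_self, if_pos (hlt x y b hx hy hb), hX, layerTable, d1, d2, d3, d4]
    obtain ⟨g1, g2, g3, g4⟩ := hvar 3 (Function.update (Function.update (fun _ => q) 1 z) 2 c)
      (by omega) (by simp [Function.update])
    simp only [Term.indexT, Term.eval, BinOp.fn, Term.eval_modT, hst, g1, g2, g3, g4, ht',
      Nat.add_sub_cancel]
    simp only [show (1 : ℕ) < 3 by decide, show (2 : ℕ) < 3 by decide, if_true, Function.update_self,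
      Function.update_of_ne (show (1 : ℕ) ≠ 2 by decide)]
    rw [hread _ _ _ hx hz hc, hread _ _ _ hz hy (Nat.mod_lt _ (by decide))]

end Eval

section Eval

variable {k n : ℕ} {L : List (Constraint k n)} {s : Memory}

theorem Holds.eval_traceT (h : Holds L s) (σ : Split k) (h5 : ∀ i ≤ n, s 5 i = i.size)
    (h7 : ∀ q < (Split.logExp n + 1) * (2 * L.length ^ 2 * (2 * L.length ^ 2) * 2),
      s 7 q = layerTable (2 * L.length ^ 2) (walkBase σ L) q) (ρ : ℕ → ℕ) {b : ℕ} (hb : b < 2) :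
    (Term.traceT b).eval s 0 ρ = ∑ x ∈ Finset.range (2 * L.length ^ 2),
      layer (2 * L.length ^ 2) (walkBase σ L) (Split.logExp n) x x b := by
  simp only [Term.traceT, Term.eval, h.size, show ¬ (7 = 3 ∨ 7 = 4) by decide, if_false]
  refine Finset.sum_congr rfl fun x hx => ?_
  rw [Finset.mem_range] at hx
  simp only [Term.indexT, Term.logExpT, Term.eval, BinOp.fn, h.eval_statesT, h.eval_varsT,
    show ¬ (5 = 3 ∨ 5 = 4) by decide, if_false, h5 n le_rfl, h5 n.size (size_le_self n),
    zero_add, Nat.zero_lt_one, if_true, Function.update_self]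
  change s 7 (((Split.logExp n * _ + x) * _ + x) * 2 + b) = _
  set N := 2 * L.length ^ 2 with hN
  obtain ⟨d1, d2, d3, d4⟩ := layer_index_decode (t := Split.logExp n) hx hx hb
  rw [h7, layerTable, d1, d2, d3, d4]
  have e1 : Split.logExp n * N + x + 1 ≤ (Split.logExp n + 1) * N := by
    rw [Nat.succ_mul]; omega
  have e2 := Nat.mul_le_mul_right N e1
  rw [Nat.succ_mul] at e2
  have e3 : (Split.logExp n + 1) * (N * N * 2) = (Split.logExp n + 1) * N * N * 2 := by ring
  rw [e3]
  omega

/-- The machine has no negative numbers: the negative part of the trace is moved to the other side.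
In array `6` the powers of `m ^ 2` have even and those of the trace factor odd indices. -/
theorem Holds.eval_traceTestT (h : Holds L s) (σ : Split k) (K : ℕ) (h5 : ∀ i ≤ n, s 5 i = i.size)
    (h6 : ∀ q < (Split.logExp n + 1) * 2, s 6 q = squaresTable (L.length ^ 2)
      (2 * K ^ 2 * ((n ^ σ.q) ^ 2 * n ^ σ.u)) q)
    (h7 : ∀ q < (Split.logExp n + 1) * (2 * L.length ^ 2 * (2 * L.length ^ 2) * 2),
      s 7 q = layerTable (2 * L.length ^ 2) (walkBase σ L) q) (ρ : ℕ → ℕ) :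
    Term.traceTestT.eval s 0 ρ = if (2 * (K : ℤ) ^ 2 * ((n ^ σ.q) ^ 2 * n ^ σ.u)) ^ 2 ^ Split.logExp n *
      (chaosMatrix id (σ.instWeight (L : Instance k n)) ^ 2 ^ Split.logExp n).trace ≤
        ((L.length : ℤ) ^ 2) ^ 2 ^ Split.logExp n then 1 else 0 := by
  have hJ : Term.logExpT.eval s 0 ρ = Split.logExp n := by
    simp only [Term.logExpT, Term.eval, BinOp.fn, h.eval_varsT,
      show ¬ (5 = 3 ∨ 5 = 4) by decide, if_false, h5 n le_rfl, h5 n.size (size_le_self n)]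
    rfl
  simp only [Term.traceTestT, Term.eval_leT, Term.eval, BinOp.fn, hJ,
    h.eval_traceT σ h5 h7 ρ (show 0 < 2 by decide), h.eval_traceT σ h5 h7 ρ (show 1 < 2 by decide),
    show ¬ (6 = 3 ∨ 6 = 4) by decide, if_false]
  rw [h6 _ (by omega), h6 _ (by omega)]
  have e1 : (2 * Split.logExp n + 1) % 2 = 1 := by omega
  have e2 : (2 * Split.logExp n + 1) / 2 = Split.logExp n := by omega
  have e3 : (2 * Split.logExp n) % 2 = 0 := by omega
  have e4 : (2 * Split.logExp n) / 2 = Split.logExp n := by omega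
  simp only [squaresTable, e1, e2, e3, e4, if_true, one_ne_zero, if_false]
  refine if_congr ?_ rfl rfl
  rw [← trace_walkBase_pow]
  simp only [Matrix.trace, Matrix.diag, ← layer_sub]
  rw [← Nat.cast_le (α := ℤ)]
  push_cast
  rw [Finset.sum_range, Finset.sum_range, Finset.sum_sub_distrib, mul_sub]
  constructor <;> intro h <;> linarith

theorem Holds.eval_diagT (h : Holds L s) (σ : Split k) (ρ : ℕ → ℕ) (b : ℕ) :
    (Term.diagT σ b).eval s 0 ρ = ∑ i : Fin L.length, ∑ j : Fin L.length,
      if listKey σ L i = listKey σ L j ∧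
        b = (if listSign σ L i * listSign σ L j = 1 then 0 else 1) then 1 else 0 := by
  simp only [Term.diagT, Term.eval, h.size, pow_one, one_mul]
  rw [Finset.sum_range]
  refine Finset.sum_congr rfl fun i _ => ?_
  rw [Finset.sum_range]
  refine Finset.sum_congr rfl fun j _ => ?_
  set ρ' := Function.update (Function.update ρ 0 (i : ℕ)) (0 + 1) (j : ℕ)
  have hi : (Term.var 0).eval s (0 + 1 + 1) ρ' = i := by simp [Term.eval, ρ', Function.update]
  have hj : (Term.var 1).eval s (0 + 1 + 1) ρ' = j := by simp [Term.eval, ρ']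
  simp only [BinOp.fn, h.eval_sameT _ ρ' i.2 j.2 hi hj, Term.eval_eqT,
    h.eval_parityT _ ρ' σ i j hi hj, Term.eval]
  simp only [listKey, σ.key_eq, Fin.getElem_fin]
  generalize (if listSign σ L i * listSign σ L j = 1 then 0 else 1) = B
  by_cases h1 : ∀ l ∈ σ.coords, (L[(i : ℕ)]).2 l = (L[(j : ℕ)]).2 l
  · rw [if_pos h1, one_mul]
    exact if_congr (by tauto) rfl rfl
  · rw [if_neg h1, zero_mul, if_neg fun h => h1 h.1]

/-- The machine cannot range over all keys; pairs of listed constraints with equal keys give the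
same sum. -/
theorem sum_instWeight_sq (σ : Split k) (L : List (Constraint k n)) :
    ∑ v, σ.instWeight (L : Instance k n) v ^ 2 = ∑ i : Fin L.length, ∑ j : Fin L.length,
      if listKey σ L i = listKey σ L j then listSign σ L i * listSign σ L j else 0 := by
  have h1 : σ.instWeight (L : Instance k n) = pushWeight (listKey σ L) (listSign σ L) :=
    (σ.pushWeight_list L).symm
  rw [h1]
  simp only [sq]
  rw [sum_mul_pushWeight]
  refine Finset.sum_congr rfl fun i _ => ?_
  rw [pushWeight, Finset.mul_sum]
  refine Finset.sum_congr rfl fun j _ => ?_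
  simp only [mul_ite, mul_zero, eq_comm]

theorem Holds.eval_diagTestT (h : Holds L s) (σ : Split k) (K : ℕ) (ρ : ℕ → ℕ) :
    (Term.diagTestT σ K).eval s 0 ρ = if 2 * (K : ℤ) ^ 2 * n ^ σ.u *
      ∑ v, σ.instWeight (L : Instance k n) v ^ 2 ≤ (L.length : ℤ) ^ 2 then 1 else 0 := by
  simp only [Term.diagTestT, Term.eval_leT, Term.eval, BinOp.fn, h.eval_diagT, Term.diagFactorT,
    Term.eval_powT, h.eval_varsT, h.eval_sizeT]
  refine if_congr ?_ rfl rfl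
  rw [sum_instWeight_sq, ← Nat.cast_le (α := ℤ)]
  have : ∀ i j, (if listKey σ L i = listKey σ L j then listSign σ L i * listSign σ L j else 0) =
      (if listKey σ L i = listKey σ L j ∧
        0 = (if listSign σ L i * listSign σ L j = 1 then 0 else 1) then (1 : ℤ) else 0) -
      (if listKey σ L i = listKey σ L j ∧
        1 = (if listSign σ L i * listSign σ L j = 1 then 0 else 1) then (1 : ℤ) else 0) := by
    intro i j
    by_cases h1 : listKey σ L i = listKey σ L j
    · rcases σ.sign_eq_or (L[i]).1 with h | h <;> rcases σ.sign_eq_or (L[j]).1 with h' | h' <;>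
        simp only [listSign, h, h', h1] <;> decide
    · simp [h1]
  simp only [this, Finset.sum_sub_distrib, mul_sub]
  push_cast
  constructor <;> intro h <;> linarith

end Eval

/-! ### The complete checking program and its running time. -/

theorem AExp.readsIn_limExp {S : ℕ → Prop} (h0 : S 0) (c p : ℕ) : (limExp c p).ReadsIn S := by
  induction p with
  | zero => trivial
  | succ p ih => exact ⟨ih, h0, trivial⟩

/-- The program that checks the certificate of a split. -/
def certProg {k : ℕ} (σ : Split k) (K : ℕ) : Prog :=
  .seq (tableProg 5 (.add (.get 0 (.lit 0)) (.lit 1)) Term.bitLengthT)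
    (.seq (tableProg 6 (.mul (.add (.get 5 (.get 5 (.get 0 (.lit 0)))) (.lit 2)) (.lit 2))
      (Term.squaresT (Term.powT Term.sizeT 2) (Term.traceFactorT σ K)))
    (.seq (tableProg 7 (.mul (.add (.get 5 (.get 5 (.get 0 (.lit 0)))) (.lit 2))
        (.mul (.mul (limExp 2 2) (limExp 2 2)) (.lit 2))) (Term.layerT σ))
      ((Term.bin .mul Term.traceTestT (Term.diagTestT σ K)).compile 0 0)))

/-- All tables have polynomially many entries, and all entries have polynomially many bits because
the exponents `2 ^ t` that occur are at most linear in `n`. -/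
theorem robust_certifies {k : ℕ} (σ : Split k) (K : ℕ) :
    Robust fun n (L : List (Constraint k n)) => σ.Certifies K (L : Instance k n) := by
  refine ⟨certProg σ K, fun E₀ => ?_⟩
  -- The trace factor is at most `Z ^ (2 * K ^ 2 + 2 * σ.q + σ.u)`; `E₀` is the size of the given
  -- memory, and `20` leaves room for the table lengths and entries.
  set E := E₀ + 20 + 2 * K ^ 2 + 2 * σ.q + σ.u with hE
  obtain ⟨D₅, hD₅⟩ := tableProg_spec 5 (.add (.get 0 (.lit 0)) (.lit 1)) Term.bitLengthT
    (by decide) (by decide) (by decide) (by simp [AExp.ReadsIn]) (by simp [AExp.ReadsIn]) E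
  obtain ⟨D₆, hD₆⟩ := tableProg_spec 6 (.mul (.add (.get 5 (.get 5 (.get 0 (.lit 0)))) (.lit 2)) (.lit 2))
    (Term.squaresT (Term.powT Term.sizeT 2) (Term.traceFactorT σ K))
    (by decide) (by decide) (by decide) (by simp [AExp.ReadsIn]) (by simp [AExp.ReadsIn]) E
  obtain ⟨D₇, hD₇⟩ := tableProg_spec 7 (.mul (.add (.get 5 (.get 5 (.get 0 (.lit 0)))) (.lit 2))
        (.mul (.mul (limExp 2 2) (limExp 2 2)) (.lit 2))) (Term.layerT σ)
    (by decide) (by decide) (by decide)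
    (by simp [AExp.ReadsIn, AExp.readsIn_limExp]) (by simp [AExp.ReadsIn, AExp.readsIn_limExp]) E
  obtain ⟨D₈, hD₈⟩ := (Term.bin .mul Term.traceTestT (Term.diagTestT σ K)).compile_spec 0 0 E
  refine ⟨D₅ + D₆ + D₇ + D₈ + E + 2, fun n L s hs hB => ?_⟩
  set Z := n + L.length + 2 with hZdef
  have hZ : 2 ≤ Z := by omega
  have hpow : ∀ {a b : ℕ}, a ≤ b → Z ^ a ≤ Z ^ b := fun h => Nat.pow_le_pow_right (by omega) h
  set N := 2 * L.length ^ 2 with hN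
  set B := 2 * K ^ 2 * ((n ^ σ.q) ^ 2 * n ^ σ.u) with hBdef
  have hm : L.length ≤ Z := by omega
  have hn : n ≤ Z := by omega
  have hNZ : N ≤ Z ^ 3 := by
    calc N ≤ Z * Z ^ 2 := Nat.mul_le_mul hZ (Nat.pow_le_pow_left hm 2)
      _ = Z ^ 3 := by ring
  have hJsz : n.size.size + 2 ≤ Z := by
    have h1 := size_le_self n.size
    have h2 := size_le_self n
    omega
  have hJ : Split.logExp n + 1 = n.size.size + 2 := rfl
  -- The true order is `log n`; a polynomial bound suffices for the running time.
  have hexp : ∀ t ≤ Split.logExp n, 2 ^ t ≤ Z ^ 3 := by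
    intro t ht
    calc 2 ^ t ≤ 2 ^ Split.logExp n := Nat.pow_le_pow_right (by omega) ht
      _ ≤ 4 * n + 2 := two_pow_logExp_le n
      _ ≤ 2 ^ 2 * Z := by omega
      _ ≤ Z ^ 2 * Z := Nat.mul_le_mul_right _ (Nat.pow_le_pow_left hZ 2)
      _ = Z ^ 3 := by ring
  have hBZ : B ≤ Z ^ (2 * K ^ 2 + 2 * σ.q + σ.u) := by
    calc B ≤ Z ^ (2 * K ^ 2) * ((Z ^ σ.q) ^ 2 * Z ^ σ.u) :=
          Nat.mul_le_mul (le_pow_of_const hZ _) (Nat.mul_le_mul (Nat.pow_le_pow_left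
            (Nat.pow_le_pow_left hn _) _) (Nat.pow_le_pow_left hn _))
      _ = _ := by rw [← pow_mul, ← pow_add, ← pow_add]; congr 1; ring
  have hZ1 : ∀ a, 1 ≤ Z ^ a := fun a => Nat.one_le_pow _ _ (by omega)
  have hBs : CellsBounded (Z ^ E) s := hB.mono (hpow (by omega))
  have hs01 : s 0 1 ≤ Z := by rw [hs 0 (by decide)]; exact hm
  have hH : Holds L s := hs
  -- bit lengths
  obtain ⟨T₅, s₅, hT₅, hT₅Z, hs₅⟩ := hD₅ Z hZ s Nat.size (n + 1) hs01 hBs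
    (by simp [AExp.val, hH.vars]) (by
      calc n + 1 ≤ Z ^ 1 := by rw [pow_one]; omega
        _ ≤ _ := hpow (by omega)) (by
      intro q hq
      refine ⟨(size_le_self _).trans ((size_le_self q).trans ?_), eval_bitLengthT s q⟩
      calc q ≤ Z ^ 1 := by rw [pow_one]; omega
        _ ≤ _ := hpow (by omega))
  have hB₅ : CellsBounded (Z ^ E) s₅ := (hBs.withTable (by
      intro q hq
      refine (size_le_self _).trans ((size_le_self q).trans ?_)
      calc q ≤ Z ^ 1 := by rw [pow_one]; omega
        _ ≤ _ := hpow (by omega))).of_sameTables hs₅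
  have hfr₅ : ∀ a, a ≠ 3 → a ≠ 4 → a ≠ 5 → s₅ a = s a := by
    intro a h3 h4 h5
    funext i
    rw [hs₅ a i h3 h4, withTable_of_ne h5]
  have hH₅ : Holds L s₅ := fun a ha => by rw [hfr₅ a (by omega) (by omega) (by omega), hs a ha]
  have h5 : ∀ i ≤ n, s₅ 5 i = i.size := by
    intro i hi
    rw [hs₅ 5 i (by decide) (by decide), withTable_self, if_pos (by omega)]
  have hval : ∀ s' : Memory, Holds L s' → (∀ i ≤ n, s' 5 i = i.size) →
      (AExp.get 5 (.get 5 (.get 0 (.lit 0)))).val s' = n.size.size := by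
    intro s' hH' h5'
    simp only [AExp.val, hH'.vars, h5' n le_rfl, h5' n.size (size_le_self n)]
  -- squares
  have hX₆ : ∀ q < (n.size.size + 2) * 2, (squaresTable (L.length ^ 2) B q).size ≤ Z ^ E := by
    intro q hq
    have hb : (if q % 2 = 0 then L.length ^ 2 else B) ≤ Z ^ (2 + (2 * K ^ 2 + 2 * σ.q + σ.u)) := by
      split_ifs
      · exact (Nat.pow_le_pow_left hm 2).trans (hpow (by omega))
      · exact hBZ.trans (hpow (by omega))
    refine (size_pow_le _ _).trans ?_
    have h1 := (size_le_self _).trans hb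
    have h2 := Nat.mul_le_mul (hexp (q / 2) (by omega)) h1
    rw [← pow_add] at h2
    have h3 := mul_le_pow_of_const hZ (c := 2) (r := 1) (by norm_num)
      (le_refl (Z ^ (3 + (2 + (2 * K ^ 2 + 2 * σ.q + σ.u)))))
    have h4 := hZ1 (3 + (2 + (2 * K ^ 2 + 2 * σ.q + σ.u)))
    have h5 : Z ^ (3 + (2 + (2 * K ^ 2 + 2 * σ.q + σ.u)) + 1) ≤ Z ^ E := hpow (by omega)
    omega
  obtain ⟨T₆, s₆, hT₆, hT₆Z, hs₆⟩ := hD₆ Z hZ s₅ (squaresTable (L.length ^ 2) B)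
    ((n.size.size + 2) * 2) (by rw [hH₅.size]; exact hm) hB₅
    (by
      have := hval s₅ hH₅ h5
      simp only [AExp.val] at this ⊢
      rw [this]) (by
      calc (n.size.size + 2) * 2 ≤ Z * Z := Nat.mul_le_mul hJsz hZ
        _ = Z ^ 2 := by ring
        _ ≤ _ := hpow (by omega)) (by
      intro q hq
      refine ⟨hX₆ q hq, ?_⟩
      have hH' : Holds L (withTable s₅ 6 (squaresTable (L.length ^ 2) B) q) := fun a ha => by
        rw [withTable_of_ne (by omega), hH₅ a ha]
      apply eval_squaresT
      · rw [Term.eval_powT, hH'.eval_sizeT]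
      · simp only [Term.traceFactorT, Term.eval, BinOp.fn, Term.eval_powT, hH'.eval_varsT]
        rfl)
  have hB₆ : CellsBounded (Z ^ E) s₆ := (hB₅.withTable hX₆).of_sameTables hs₆
  have hfr₆ : ∀ a, a ≠ 3 → a ≠ 4 → a ≠ 6 → s₆ a = s₅ a := by
    intro a h3 h4 h6
    funext i
    rw [hs₆ a i h3 h4, withTable_of_ne h6]
  have hH₆ : Holds L s₆ := fun a ha => by rw [hfr₆ a (by omega) (by omega) (by omega), hH₅ a ha]
  have h5' : ∀ i ≤ n, s₆ 5 i = i.size := by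
    intro i hi
    rw [hfr₆ 5 (by decide) (by decide) (by decide), h5 i hi]
  -- layers
  have hX₇ : ∀ q < (n.size.size + 2) * (N * N * 2),
      (layerTable N (walkBase σ L) q).size ≤ Z ^ E := by
    intro q hq
    have ht : q / 2 / N / N ≤ Split.logExp n := by
      rw [Nat.div_div_eq_div_mul, Nat.div_div_eq_div_mul]
      have hpos : 0 < 2 * (N * N) := by
        rcases Nat.eq_zero_or_pos N with h0 | h0
        · rw [h0] at hq; simp at hq
        · positivity
      have : q / (2 * (N * N)) < n.size.size + 2 := by
        rw [Nat.div_lt_iff_lt_mul hpos]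
        calc q < _ := hq
          _ = _ := by ring
      have h1 : Split.logExp n = n.size.size + 1 := rfl
      omega
    have h1 := layer_le N (walkBase σ L) (walkBase_le σ L) (q / 2 / N / N) (q / 2 / N % N)
      (q / 2 % N) (q % 2)
    refine (Nat.size_le_size h1).trans ((size_pow_le _ _).trans ?_)
    have h2 : (2 * N).size ≤ Z ^ 4 := by
      refine (size_le_self _).trans ?_
      calc 2 * N ≤ Z * Z ^ 3 := Nat.mul_le_mul hZ hNZ
        _ = Z ^ 4 := by ring
    have h3 := Nat.mul_le_mul ((Nat.sub_le _ 1).trans (hexp _ ht)) h2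
    rw [← pow_add] at h3
    have h4 := mul_le_pow_of_const hZ (c := 2) (r := 1) (by norm_num) (le_refl (Z ^ (3 + 4)))
    have h5 := hZ1 (3 + 4)
    have h6 : Z ^ (3 + 4 + 1) ≤ Z ^ E := hpow (by omega)
    omega
  obtain ⟨T₇, s₇, hT₇, hT₇Z, hs₇⟩ := hD₇ Z hZ s₆ (layerTable N (walkBase σ L))
    ((n.size.size + 2) * (N * N * 2)) (by rw [hH₆.size]; exact hm) hB₆
    (by
      have := hval s₆ hH₆ h5'
      simp only [AExp.val, limExp_val, hH₆.size] at this ⊢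
      rw [this]) (by
      calc (n.size.size + 2) * (N * N * 2) ≤ Z * (Z ^ 3 * Z ^ 3 * Z) :=
            Nat.mul_le_mul hJsz (Nat.mul_le_mul (Nat.mul_le_mul hNZ hNZ) hZ)
        _ = Z ^ 8 := by ring
        _ ≤ _ := hpow (by omega)) (by
      intro q hq
      refine ⟨hX₇ q hq, hH₆.eval_layerT σ ?_⟩
      rcases Nat.eq_zero_or_pos N with h0 | h0
      · rw [h0] at hq; simp at hq
      · exact h0)
  have hB₇ : CellsBounded (Z ^ E) s₇ := (hB₆.withTable hX₇).of_sameTables hs₇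
  have hfr₇ : ∀ a, a ≠ 3 → a ≠ 4 → a ≠ 7 → s₇ a = s₆ a := by
    intro a h3 h4 h7
    funext i
    rw [hs₇ a i h3 h4, withTable_of_ne h7]
  have hH₇ : Holds L s₇ := fun a ha => by rw [hfr₇ a (by omega) (by omega) (by omega), hH₆ a ha]
  have h5'' : ∀ i ≤ n, s₇ 5 i = i.size := by
    intro i hi
    rw [hfr₇ 5 (by decide) (by decide) (by decide), h5' i hi]
  have h6 : ∀ q < (Split.logExp n + 1) * 2, s₇ 6 q = squaresTable (L.length ^ 2) B q := by
    intro q hq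
    rw [hfr₇ 6 (by decide) (by decide) (by decide), hs₆ 6 q (by decide) (by decide), withTable_self]
    exact if_pos hq
  have h7 : ∀ q < (Split.logExp n + 1) * (N * N * 2), s₇ 7 q = layerTable N (walkBase σ L) q := by
    intro q hq
    rw [hs₇ 7 q (by decide) (by decide), withTable_self]
    exact if_pos hq
  -- the final test
  obtain ⟨-, T₈, s₈, hT₈, hT₈Z, hA, hv⟩ := hD₈ Z hZ s₇ (fun _ => 0)
    (by rw [hH₇.size]; exact hm) hB₇ (by simp)
  refine ⟨_, s₈, Exec.seq hT₅ (Exec.seq hT₆ (Exec.seq hT₇ hT₈)), ?_, ?_, ?_, ?_, ?_⟩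
  · have g : ∀ {T D}, T ≤ Z ^ D → D ≤ D₅ + D₆ + D₇ + D₈ + E → T ≤ Z ^ (D₅ + D₆ + D₇ + D₈ + E) :=
      fun h h' => h.trans (hpow h')
    have g5 := g hT₅Z (by omega)
    have g6 := g hT₆Z (by omega)
    have g7 := g hT₇Z (by omega)
    have g8 := g hT₈Z (by omega)
    have := mul_le_pow_of_const hZ (c := 4) (r := 2) (by norm_num)
      (le_refl (Z ^ (D₅ + D₆ + D₇ + D₈ + E)))
    omega
  · exact (hB₇.mono (hpow (by omega))).of_sameTables hA.1
  · intro a ha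
    funext i
    rw [hA.1 a i (by omega) (by omega), hfr₇ a (by omega) (by omega) (by omega),
      hfr₆ a (by omega) (by omega) (by omega), hfr₅ a (by omega) (by omega) (by omega)]
  all_goals
    intro hc
    rw [hv]
    simp only [Term.eval, BinOp.fn, hH₇.eval_traceTestT σ K h5'' h6 h7, hH₇.eval_diagTestT σ K]
    simp only [Split.Certifies, Multiset.coe_card] at hc
  · rw [if_pos hc.2, if_pos hc.1]
  · by_cases h1 : 2 * (K : ℤ) ^ 2 * n ^ σ.u * ∑ v, σ.instWeight (L : Instance k n) v ^ 2 ≤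
      (L.length : ℤ) ^ 2
    · rw [if_neg (fun h2 => hc ⟨h1, h2⟩), zero_mul]
    · rw [if_neg h1, mul_zero]

/-! ### Separating sign vectors from the origin by small coefficients -/

open scoped RealInnerProductSpace in
/-- A point of minimal norm in the convex hull of a set that does not contain the origin, written
with linearly independent points of the set. -/
theorem exists_minimal_point {E : Type*} [NormedAddCommGroup E] [InnerProductSpace ℝ E]
    {s : Set E} (hfin : s.Finite) (hne : s.Nonempty) (h0 : (0 : E) ∉ convexHull ℝ s) :
    ∃ (v : E) (τ : Type) (_ : Fintype τ) (z : τ → E) (w : τ → ℝ), v ≠ 0 ∧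
      (∀ x ∈ s, ‖v‖ ^ 2 ≤ ⟪v, x⟫) ∧ (∀ i, z i ∈ s) ∧ LinearIndependent ℝ z ∧ (∀ i, 0 ≤ w i) ∧
      ∑ i, w i = 1 ∧ ∑ i, w i • z i = v ∧ ∀ i, ⟪v, z i⟫ = ‖v‖ ^ 2 := by
  obtain ⟨v, hv, hmin⟩ := exists_norm_eq_iInf_of_complete_convex (K := convexHull ℝ s)
    hne.convexHull (hfin.isCompact_convexHull ℝ).isComplete (convex_convexHull ℝ s) 0
  have hle := (norm_eq_iInf_iff_real_inner_le_zero (convex_convexHull ℝ s) hv).1 hmin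
  have hge : ∀ x ∈ s, ‖v‖ ^ 2 ≤ ⟪v, x⟫ := by
    intro x hx
    have := hle x (subset_convexHull ℝ s hx)
    rw [zero_sub, inner_neg_left, inner_sub_right, real_inner_self_eq_norm_sq] at this
    linarith
  have hv0 : v ≠ 0 := fun h => h0 (h ▸ hv)
  obtain ⟨τ, hτ, z, w, hz, haff, hw, hw1, hwv⟩ := eq_pos_convex_span_of_mem_convexHull hv
  have hzs : ∀ i, z i ∈ s := fun i => hz ⟨i, rfl⟩
  have hsum : ∑ i, w i * ⟪v, z i⟫ = ‖v‖ ^ 2 := by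
    rw [← real_inner_self_eq_norm_sq]
    conv_rhs => arg 3; rw [← hwv]
    rw [inner_sum]
    simp [inner_smul_right]
  -- Each inner product is at least `‖v‖ ^ 2`, their average with positive weights equals it, so
  -- none can be larger.
  have heq : ∀ i, ⟪v, z i⟫ = ‖v‖ ^ 2 := by
    have h1 : ∑ i, w i * (⟪v, z i⟫ - ‖v‖ ^ 2) = 0 := by
      simp only [mul_sub, Finset.sum_sub_distrib, hsum, ← Finset.sum_mul, hw1]; ring
    rw [Finset.sum_eq_zero_iff_of_nonneg fun i _ =>
      mul_nonneg (hw i).le (sub_nonneg.2 (hge _ (hzs i)))] at h1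
    intro i
    have := h1 i (Finset.mem_univ i)
    have := (mul_eq_zero.1 this).resolve_left (hw i).ne'
    linarith
  have hpos : 0 < ‖v‖ ^ 2 := by positivity
  -- Affinely independent points on a hyperplane that misses the origin are linearly independent.
  have hli : LinearIndependent ℝ z := by
    rw [Fintype.linearIndependent_iff]
    intro g hg
    have h1 : (∑ i, g i) * ‖v‖ ^ 2 = 0 := by
      have : ⟪v, ∑ i, g i • z i⟫ = 0 := by rw [hg, inner_zero_right]
      rw [inner_sum] at this
      simpa [inner_smul_right, heq, Finset.sum_mul] using this
    have h2 : ∑ i, g i = 0 := (mul_eq_zero.1 h1).resolve_right hpos.ne'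
    exact fun i => (affineIndependent_iff.1 haff) Finset.univ g h2 hg i (Finset.mem_univ i)
  let e := Fintype.equivFin τ
  refine ⟨v, Fin (Fintype.card τ), inferInstance, z ∘ e.symm, w ∘ e.symm, hv0, hge,
    fun i => hzs _, hli.comp _ e.symm.injective, fun i => (hw _).le, ?_, ?_, fun i => heq _⟩
  · rw [← hw1]; exact e.symm.sum_comp w
  · rw [← hwv]; exact e.symm.sum_comp fun i => w i • z i

/-- An entry of the adjugate is the determinant of `G` with one row replaced by a unit vector. As `1
≤ c`, its entries are still at most `c` in absolute value, and the Leibniz formula applies. -/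
theorem abs_adjugate_le {m : Type*} [Fintype m] [DecidableEq m] (G : Matrix m m ℤ) (c : ℤ)
    (hc : 1 ≤ c) (hG : ∀ i j, |G i j| ≤ c) (i j : m) :
    |G.adjugate i j| ≤ (Fintype.card m).factorial * c ^ Fintype.card m := by
  rw [Matrix.adjugate_apply]
  have h := Matrix.det_le (A := G.updateRow j (Pi.single i 1)) (abv := AbsoluteValue.abs)
    (x := c) (by
      intro a b
      show |_| ≤ c
      by_cases ha : a = j
      · subst ha
        rw [Matrix.updateRow_self]
        by_cases hb : b = i
        · subst hb; simpa using hc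
        · simp [Pi.single_eq_of_ne hb]; omega
      · rw [Matrix.updateRow_ne ha]; exact hG a b)
  simpa [nsmul_eq_mul] using h

-- The coefficients are `v / ‖v‖²` for the point `v` of least norm, so `‖v‖²` must be bounded below.
-- The Gram matrix `G` of the independent points spanning `v` is an invertible integer matrix, hence
-- `|det G| ≥ 1`.
open scoped RealInnerProductSpace in
theorem exists_separating_coefficients {ι : Type*} [Fintype ι] {s : Set (EuclideanSpace ℝ ι)}
    (hfin : s.Finite) (hs : ∀ x ∈ s, ∀ i, x i = 1 ∨ x i = -1)
    (h0 : (0 : EuclideanSpace ℝ ι) ∉ convexHull ℝ s) :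
    ∃ q : ι → ℝ, (∀ x ∈ s, 1 ≤ ∑ i, q i * x i) ∧
      ∑ i, |q i| ≤ (Fintype.card ι : ℝ) ^ (2 * Fintype.card ι + 3) := by
  classical
  rcases s.eq_empty_or_nonempty with rfl | hne
  · refine ⟨0, by simp, ?_⟩
    simp
  obtain ⟨v, τ, _, z, w, hv0, hge, hzs, hli, hw, hw1, hwv, heq⟩ :=
    exists_minimal_point hfin hne h0
  set d := Fintype.card ι with hd
  set μ := ‖v‖ ^ 2 with hμ
  have hpos : 0 < μ := by positivity
  have hcard : Fintype.card τ ≤ d := by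
    simpa using hli.fintype_card_le_finrank
  have hτ : Nonempty τ := by
    by_contra h
    rw [not_nonempty_iff] at h
    simp at hw1
  have hd1 : 1 ≤ d := le_trans Fintype.card_pos hcard
  have hint : ∀ i j, ∃ ε : ℤ, (ε : ℝ) = z i j ∧ |ε| = 1 := by
    intro i j
    rcases hs _ (hzs i) j with h | h
    · exact ⟨1, by simp [h], by simp⟩
    · exact ⟨-1, by simp [h], by simp⟩
  choose ε hε hε1 using hint
  let G : Matrix τ τ ℤ := fun i j => ∑ l, ε i l * ε j l
  have hG : ∀ i j, (G i j : ℝ) = ⟪z i, z j⟫ := by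
    intro i j
    simp only [G, Int.cast_sum, Int.cast_mul, hε, PiLp.inner_apply]
    refine Finset.sum_congr rfl fun l _ => ?_
    simp [mul_comm]
  have hGle : ∀ i j, |G i j| ≤ (d : ℤ) := by
    intro i j
    refine (Finset.abs_sum_le_sum_abs _ _).trans ?_
    simp [abs_mul, hε1, hd]
  let GR : Matrix τ τ ℝ := G.map (Int.castRingHom ℝ)
  have hGR : ∀ i j, GR i j = ⟪z i, z j⟫ := hG
  have hmul : ∀ (a : τ → ℝ) i, (GR.mulVec a) i = ⟪z i, ∑ j, a j • z j⟫ := by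
    intro a i
    rw [inner_sum]
    simp only [Matrix.mulVec, dotProduct, hGR, inner_smul_right]
    exact Finset.sum_congr rfl fun j _ => mul_comm _ _
  have hdet : G.det ≠ 0 := by
    intro h
    have h' : GR.det = 0 := by
      have := (Int.castRingHom ℝ).map_det G
      rw [h, map_zero] at this
      exact this.symm
    obtain ⟨a, ha, hGa⟩ := Matrix.exists_mulVec_eq_zero_iff.2 h'
    have h1 : ⟪∑ i, a i • z i, ∑ j, a j • z j⟫ = 0 := by
      rw [sum_inner]
      refine Finset.sum_eq_zero fun i _ => ?_
      rw [inner_smul_left, ← hmul, hGa]; simp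
    have h2 := inner_self_eq_zero.1 h1
    exact ha (funext fun i => Fintype.linearIndependent_iff.1 hli a h2 i)
  have hGw : GR.mulVec w = fun _ => μ := by
    funext i
    rw [hmul, hwv, real_inner_comm, heq]
  -- The weights of `v` solve `G w = μ • 1`, so `det G • w = μ • adj G 1`; summing the coordinates
  -- and using `∑ w = 1` gives the identity.
  have hadj : (GR.det : ℝ) = μ * ∑ i, ∑ j, GR.adjugate i j := by
    have h1 : (GR.adjugate * GR).mulVec w = GR.det • w := by
      rw [Matrix.adjugate_mul, Matrix.smul_mulVec, Matrix.one_mulVec]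
    rw [← Matrix.mulVec_mulVec, hGw] at h1
    have h2 := congrArg (fun f : τ → ℝ => ∑ i, f i) h1
    simp only [Matrix.mulVec, dotProduct, Pi.smul_apply, smul_eq_mul, ← Finset.mul_sum, hw1,
      mul_one, ← Finset.sum_mul] at h2
    rw [← h2, mul_comm]
  have hadj2 : ∀ i j, |GR.adjugate i j| ≤ (d : ℝ) ^ (2 * d) := by
    intro i j
    have h1 : GR.adjugate i j = ((G.adjugate i j : ℤ) : ℝ) := by
      have := (Int.castRingHom ℝ).map_adjugate G
      have := congrFun (congrFun this i) j
      exact this.symm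
    have h2 := abs_adjugate_le G d (by exact_mod_cast hd1) hGle i j
    have h3 : |GR.adjugate i j| ≤ ((Fintype.card τ).factorial : ℝ) * (d : ℝ) ^ Fintype.card τ := by
      rw [h1]; exact_mod_cast h2
    refine h3.trans ?_
    have hd1' : (1 : ℝ) ≤ d := by exact_mod_cast hd1
    have h4 : ((Fintype.card τ).factorial : ℝ) ≤ (d : ℝ) ^ d := by
      exact_mod_cast (Nat.factorial_le hcard).trans (Nat.factorial_le_pow d)
    rw [two_mul, pow_add]
    exact mul_le_mul h4 (pow_le_pow_right₀ hd1' hcard) (by positivity) (by positivity)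
  have hone : 1 ≤ μ * (d : ℝ) ^ (2 * d + 2) := by
    have h1 : (1 : ℝ) ≤ |GR.det| := by
      have h2 : GR.det = ((G.det : ℤ) : ℝ) := ((Int.castRingHom ℝ).map_det G).symm
      rw [h2]
      exact_mod_cast Int.one_le_abs hdet
    rw [hadj, abs_mul, abs_of_pos hpos] at h1
    refine h1.trans (mul_le_mul_of_nonneg_left ?_ hpos.le)
    calc |∑ i, ∑ j, GR.adjugate i j|
        ≤ ∑ i, ∑ j, |GR.adjugate i j| :=
          (Finset.abs_sum_le_sum_abs _ _).trans
            (Finset.sum_le_sum fun i _ => Finset.abs_sum_le_sum_abs _ _)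
      _ ≤ ∑ i : τ, ∑ j : τ, (d : ℝ) ^ (2 * d) :=
          Finset.sum_le_sum fun i _ => Finset.sum_le_sum fun j _ => hadj2 i j
      _ = (Fintype.card τ : ℝ) * ((Fintype.card τ : ℝ) * (d : ℝ) ^ (2 * d)) := by simp
      _ ≤ (d : ℝ) * ((d : ℝ) * (d : ℝ) ^ (2 * d)) := by gcongr
      _ = (d : ℝ) ^ (2 * d + 2) := by ring
  have hv1 : ∀ j, |v j| ≤ 1 := by
    intro j
    have : v j = ∑ i, w i * z i j := by
      rw [← hwv]; simp
    rw [this, ← hw1]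
    refine (Finset.abs_sum_le_sum_abs _ _).trans (Finset.sum_le_sum fun i _ => ?_)
    rw [abs_mul, abs_of_nonneg (hw i)]
    rcases hs _ (hzs i) j with h | h <;> simp [h]
  refine ⟨fun i => v i / μ, fun x hx => ?_, ?_⟩
  · have h1 := hge x hx
    have h2 : ⟪v, x⟫ = ∑ i, v i * x i := by
      rw [PiLp.inner_apply]
      exact Finset.sum_congr rfl fun l _ => by simp [mul_comm]
    have h3 : ∑ i, v i / μ * x i = ⟪v, x⟫ / μ := by
      rw [h2, Finset.sum_div]
      exact Finset.sum_congr rfl fun l _ => by ring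
    rw [h3, le_div_iff₀ hpos, one_mul]
    exact h1
  · have hinv : 1 / μ ≤ (d : ℝ) ^ (2 * d + 2) := by
      rw [div_le_iff₀ hpos, mul_comm]; exact hone
    calc ∑ i, |v i / μ| ≤ ∑ i : ι, (d : ℝ) ^ (2 * d + 2) := by
          refine Finset.sum_le_sum fun i _ => ?_
          rw [abs_div, abs_of_pos hpos]
          exact (div_le_div_of_nonneg_right (hv1 i) hpos.le).trans hinv
      _ = (d : ℝ) ^ (2 * d + 3) := by
          rw [Finset.sum_const, Finset.card_univ, nsmul_eq_mul]; ring

/-! ### Separating polynomials of predicates without uniform distributions -/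

/-- The monomial of a set of coordinates. -/
def monomial {k : ℕ} (T : Finset (Fin k)) (z : Fin k → ℤˣ) : ℝ := ∏ i ∈ T, ((z i : ℤ) : ℝ)

theorem intUnit_cases (a : ℤˣ) : ((a : ℤ) : ℝ) = 1 ∨ ((a : ℤ) : ℝ) = -1 := by
  rcases Int.units_eq_one_or a with h | h <;> simp [h]

theorem monomial_cases {k : ℕ} (T : Finset (Fin k)) (z : Fin k → ℤˣ) :
    monomial T z = 1 ∨ monomial T z = -1 := by
  classical
  unfold monomial
  induction T using Finset.induction_on with
  | empty => simp
  | insert i T hi ih =>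
    rw [Finset.prod_insert hi]
    rcases intUnit_cases (z i) with h | h <;> rcases ih with h' | h' <;> simp [h, h']

/-- The nonempty sets of at most `t` coordinates. -/
def lowSets (k t : ℕ) : Finset (Finset (Fin k)) :=
  Finset.univ.filter fun T => T.Nonempty ∧ T.card ≤ t

/-- A nonempty set of at most `t` elements is the image of a `t`-tuple, padded by one of its
elements. -/
theorem card_lowSets_le (k t : ℕ) : (lowSets k t).card ≤ k ^ t := by
  classical
  have : lowSets k t ⊆ Finset.univ.image fun f : Fin t → Fin k => Finset.univ.image f := by
    intro T hT
    simp only [lowSets, Finset.mem_filter, Finset.mem_univ, true_and] at hT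
    obtain ⟨⟨a, ha⟩, hT⟩ := hT
    simp only [Finset.mem_image, Finset.mem_univ, true_and]
    have e := T.equivFin
    refine ⟨fun i => if h : (i : ℕ) < T.card then e.symm ⟨i, h⟩ else a, ?_⟩
    ext x
    simp only [Finset.mem_image, Finset.mem_univ, true_and]
    constructor
    · rintro ⟨i, rfl⟩
      split_ifs
      · exact (e.symm _).2
      · exact ha
    · intro hx
      refine ⟨⟨e ⟨x, hx⟩, lt_of_lt_of_le (e ⟨x, hx⟩).2 hT⟩, ?_⟩
      simp
  refine (Finset.card_le_card this).trans (Finset.card_image_le.trans ?_)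
  simp

/-- Fourier expansion of a point indicator: expand `∏ (1 + a i * y i)`, whose factors are `2` or
`0`. -/
theorem indicator_eq_prod {ι : Type*} [Fintype ι] [DecidableEq ι] (a y : ι → ℤˣ) :
    (if a = y then (2 : ℝ) ^ Fintype.card ι else 0) =
      ∑ T : Finset ι, (∏ i ∈ T, ((a i : ℤ) : ℝ)) * ∏ i ∈ T, ((y i : ℤ) : ℝ) := by
  have h : ∏ i, (1 + ((a i : ℤ) : ℝ) * ((y i : ℤ) : ℝ)) =
      ∑ T : Finset ι, (∏ i ∈ T, ((a i : ℤ) : ℝ)) * ∏ i ∈ T, ((y i : ℤ) : ℝ) := by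
    rw [Finset.prod_one_add]
    simp [Finset.prod_mul_distrib, Finset.powerset_univ]
  rw [← h]
  split_ifs with hay
  · subst hay
    have : ∀ i, 1 + ((a i : ℤ) : ℝ) * ((a i : ℤ) : ℝ) = 2 := by
      intro i
      rcases intUnit_cases (a i) with h | h <;> rw [h] <;> norm_num
    simp [this, Finset.card_univ]
  · obtain ⟨i, hi⟩ := Function.ne_iff.1 hay
    refine (Finset.prod_eq_zero (Finset.mem_univ i) ?_).symm
    rcases Int.units_eq_one_or (a i) with h | h <;> rcases Int.units_eq_one_or (y i) with h' | h' <;>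
      simp_all

/-- Weights with vanishing low moments give a uniform distribution. -/
theorem supports_of_moments {k t : ℕ} (P : Predicate k) {τ : Type} [Fintype τ] (w : τ → ℝ)
    (y : τ → Fin k → ℤˣ) (hw : ∀ i, 0 ≤ w i) (hw1 : ∑ i, w i = 1) (hy : ∀ i, P (y i) = true)
    (hm : ∀ T ∈ lowSets k t, ∑ i, w i * monomial T (y i) = 0) : Supports t P := by
  classical
  have hsum : ∑ i, ENNReal.ofReal (w i) = 1 := by
    rw [← ENNReal.ofReal_sum_of_nonneg fun i _ => hw i, hw1, ENNReal.ofReal_one]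
  refine ⟨(PMF.ofFintype (fun i => ENNReal.ofReal (w i)) hsum).map y, ?_, ?_⟩
  · intro S hS
    rw [PMF.map_comp]
    ext a
    rw [PMF.map_apply, tsum_fintype, PMF.uniformOfFintype_apply]
    have hcard : Fintype.card (S → ℤˣ) = 2 ^ t := by simp [hS]
    have hreal : ∑ i, (if a = (fun j : S => y i j) then w i else 0) = ((2 : ℝ) ^ t)⁻¹ := by
      have h1 : ∑ i, w i * (if a = (fun j : S => y i j) then (2 : ℝ) ^ Fintype.card S else 0) = 1 := by
        simp only [indicator_eq_prod, Finset.mul_sum]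
        -- Every nonempty set of coordinates in `S` has a vanishing moment, so only the constant
        -- Fourier coefficient remains.
        rw [Finset.sum_comm, Finset.sum_eq_single ∅]
        · simpa using hw1
        · intro T _ hT
          have hlow : T.map (Function.Embedding.subtype _) ∈ lowSets k t := by
            simp only [lowSets, Finset.mem_filter, Finset.mem_univ, true_and, Finset.map_nonempty,
              Finset.card_map]
            refine ⟨Finset.nonempty_iff_ne_empty.2 hT, ?_⟩
            simpa [hS] using Finset.card_le_univ T
          have h2 := hm _ hlow
          simp only [monomial, Finset.prod_map, Function.Embedding.subtype_apply] at h2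
          rw [← mul_zero (∏ j ∈ T, ((a j : ℤ) : ℝ)), ← h2, Finset.mul_sum]
          exact Finset.sum_congr rfl fun i _ => by ring
        · simp
      rw [← one_div, eq_div_iff (by positivity), ← h1, Finset.sum_mul]
      refine Finset.sum_congr rfl fun i _ => ?_
      rw [Fintype.card_coe, hS]
      split_ifs <;> simp
    refine Eq.trans (b := ∑ i, ENNReal.ofReal (if a = (fun j : S => y i j) then w i else 0)) ?_ ?_
    · refine Finset.sum_congr rfl fun i _ => ?_
      simp only [Function.comp, PMF.ofFintype_apply]
      split_ifs <;> simp
    calc ∑ i, ENNReal.ofReal (if a = (fun j : S => y i j) then w i else 0)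
        = ENNReal.ofReal (((2 : ℝ) ^ t)⁻¹) := by
          rw [← ENNReal.ofReal_sum_of_nonneg, hreal]
          intro i _
          split_ifs
          · exact hw i
          · exact le_rfl
      _ = ((Fintype.card (S → ℤˣ) : ℕ) : ENNReal)⁻¹ := by
          rw [hcard, ENNReal.ofReal_inv_of_pos (by positivity)]
          congr 1
          rw [ENNReal.ofReal_pow (by norm_num)]
          simp
  · intro z hz
    rw [PMF.mem_support_map_iff] at hz
    obtain ⟨i, _, rfl⟩ := hz
    exact hy i

/-- A predicate without `t`-wise uniform distributions has a separating polynomial of degree at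
most `t` with small coefficients. -/
theorem exists_separating_polynomial {k t : ℕ} (hk : 1 ≤ k) (P : Predicate k)
    (hP : ¬ Supports t P) :
    ∃ q : Finset (Fin k) → ℝ, (∀ z, P z = true → 1 ≤ ∑ T ∈ lowSets k t, q T * monomial T z) ∧
      ∑ T ∈ lowSets k t, |q T| ≤ ((k : ℝ) ^ t) ^ (2 * k ^ t + 3) := by
  classical
  let χ : (Fin k → ℤˣ) → EuclideanSpace ℝ (lowSets k t) :=
    fun z => WithLp.toLp 2 fun T => monomial T.1 z
  -- A convex combination equal to the origin would be a distribution on `P⁻¹(1)` all of whose low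
  -- moments vanish.
  have h0 : (0 : EuclideanSpace ℝ (lowSets k t)) ∉ convexHull ℝ (χ '' {z | P z = true}) := by
    intro h
    rw [mem_convexHull_iff_exists_fintype] at h
    obtain ⟨τ, _, w, x, hw, hw1, hx, hwx⟩ := h
    choose y hy hyx using hx
    refine hP (supports_of_moments P w y hw hw1 hy fun T hT => ?_)
    have h1 := congrArg (fun v : EuclideanSpace ℝ (lowSets k t) => v ⟨T, hT⟩) hwx
    simpa [← hyx, χ] using h1
  obtain ⟨q, hq1, hq2⟩ := exists_separating_coefficients
    ((Set.toFinite {z | P z = true}).image χ)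
    (by rintro _ ⟨z, _, rfl⟩ T; exact monomial_cases _ _) h0
  refine ⟨fun T => if h : T ∈ lowSets k t then q ⟨T, h⟩ else 0, fun z hz => ?_, ?_⟩
  · refine (hq1 _ ⟨z, hz, rfl⟩).trans_eq ?_
    rw [← Finset.sum_coe_sort (lowSets k t)]
    exact Finset.sum_congr rfl fun T _ => by simp [χ]
  · have h1 : ∑ T ∈ lowSets k t, |if h : T ∈ lowSets k t then q ⟨T, h⟩ else 0| = ∑ T, |q T| := by
      rw [← Finset.sum_coe_sort (lowSets k t)]
      exact Finset.sum_congr rfl fun T _ => by simp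
    rw [h1]
    refine hq2.trans ?_
    rw [Fintype.card_coe]
    have h2 := card_lowSets_le k t
    have h3 : ((lowSets k t).card : ℝ) ≤ (k : ℝ) ^ t := by exact_mod_cast h2
    have h4 : (1 : ℝ) ≤ (k : ℝ) ^ t := one_le_pow₀ (by exact_mod_cast hk)
    exact (pow_le_pow_left₀ (Nat.cast_nonneg _) h3 _).trans
      (pow_le_pow_right₀ h4 (by omega))

/-! ### The algorithm and its soundness -/

namespace Split

/-- The number of coordinates of a split. -/
def degree {k : ℕ} (σ : Split k) : ℕ := 2 * σ.q + σ.u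

theorem exists_of_finset {k : ℕ} (T : Finset (Fin k)) :
    ∃ σ : Split k, σ.degree = T.card ∧ σ.u ≤ 1 ∧ ∀ f : Fin k → ℤ, ∏ i ∈ T, f i =
      ((∏ i, f (σ.half false i)) * ∏ i, f (σ.half true i)) * ∏ i, f (σ.last i) := by
  have hcard : Fintype.card ((Bool × Fin (T.card / 2)) ⊕ Fin (T.card % 2)) = Fintype.card T := by
    simp
    omega
  have e := Fintype.equivOfCardEq hcard
  refine ⟨⟨T.card / 2, T.card % 2, fun b i => e (Sum.inl (b, i)), fun i => e (Sum.inr i), ?_⟩,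
    ?_, ?_, fun f => ?_⟩
  · have : (Sum.elim (fun x : Bool × Fin (T.card / 2) => ((e (Sum.inl (x.1, x.2)) : T) : Fin k))
        fun i => ((e (Sum.inr i) : T) : Fin k)) = Subtype.val ∘ e := by
      funext x
      rcases x with ⟨b, i⟩ | i <;> rfl
    rw [this]
    exact Subtype.val_injective.comp e.injective
  · simp only [degree]; omega
  · simp only; omega
  · rw [← Finset.prod_coe_sort T, ← e.prod_comp, Fintype.prod_sum_type, Fintype.prod_prod_type,
      Fintype.prod_bool, mul_comm (∏ i, f (e (Sum.inl (true, i))))]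

/-- A split of a given set of coordinates into two halves and at most one remaining coordinate. -/
noncomputable def ofFinset {k : ℕ} (T : Finset (Fin k)) : Split k := (exists_of_finset T).choose

theorem degree_ofFinset {k : ℕ} (T : Finset (Fin k)) : (ofFinset T).degree = T.card :=
  (exists_of_finset T).choose_spec.1

theorem u_ofFinset_le {k : ℕ} (T : Finset (Fin k)) : (ofFinset T).u ≤ 1 :=
  (exists_of_finset T).choose_spec.2.1

theorem prod_ofFinset {k : ℕ} (T : Finset (Fin k)) (f : Fin k → ℤ) : ∏ i ∈ T, f i =
    ((∏ i, f ((ofFinset T).half false i)) * ∏ i, f ((ofFinset T).half true i)) *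
      ∏ i, f ((ofFinset T).last i) :=
  (exists_of_finset T).choose_spec.2.2 f

theorem unit_prod_sq {ι : Type*} [Fintype ι] (f : ι → ℤˣ) : (∏ i, (f i : ℤ)) ^ 2 = 1 := by
  rw [← Finset.prod_pow]
  exact Finset.prod_eq_one fun i _ => by rw [← Units.val_pow_eq_pow_val, Int.units_sq]; rfl

/-- The certificate of a split bounds the correlation of the constraints with its monomial. -/
theorem Certifies.abs_sum_le {k n K : ℕ} {T : Finset (Fin k)} {I : Instance k n}
    (h : (ofFinset T).Certifies K I) (x : Fin n → ℤˣ) :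
    (K : ℤ) * |(I.map fun C => ∏ i ∈ T, (C.literals x i : ℤ)).sum| ≤ Multiset.card I := by
  induction I using Quotient.inductionOn with
  | h L =>
    obtain ⟨h1, h2⟩ := h
    have h3 := abs_form_le_of_certificate (R := ℤ)
      (fun i : Fin L.length => (ofFinset T).key (L[i]).2) (fun i => (ofFinset T).sign (L[i]).1)
      (fun _ a => ∏ i, (x (a i) : ℤ)) (fun _ a => unit_prod_sq _)
      (fun c => ∏ i, (x (c i) : ℤ)) (fun c => unit_prod_sq _) (n.size.size) K L.length
      (by positivity) (by positivity)
      (by rw [pushWeight_list]; simpa using h1)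
      (by rw [← chaosMatrix_pushWeight, pushWeight_list]; simpa [logExp] using h2)
    refine le_trans (le_of_eq ?_) h3
    congr 2
    show ((L : Instance k n).map _).sum = _
    rw [Multiset.map_coe, Multiset.sum_coe, ← Fin.sum_univ_fun_getElem]
    refine Finset.sum_congr rfl fun i _ => ?_
    simp only [Constraint.literals, prod_ofFinset T, sign, key, Units.val_mul, Finset.prod_mul_distrib]
    show _ = _
    simp only [Fin.getElem_fin]
    ring

end Split

/-- The constant of the certificates. -/
def certConst (k t : ℕ) : ℕ := 2 * (k ^ t) ^ (2 * k ^ t + 3)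

open Classical in
/-- The algorithm that checks the certificates of all splits of low degree. -/
noncomputable def certifier (k t : ℕ) : Decision k := fun _ I =>
  decide (∀ T ∈ (lowSets k t).toList, (Split.ofFinset T).Certifies (certConst k t) I)

theorem certifier_eq_true_iff {k n : ℕ} (t : ℕ) (I : Instance k n) :
    certifier k t n I = true ↔
      ∀ T ∈ (lowSets k t).toList, (Split.ofFinset T).Certifies (certConst k t) I := by
  simp [certifier]

theorem certifier_isEfficient (k t : ℕ) : (certifier k t).IsEfficient := by
  have h : ∀ T ∈ (lowSets k t).toList, Robust fun n (L : List (Constraint k n)) =>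
      (Split.ofFinset T).Certifies (certConst k t) (L : Instance k n) :=
    fun T _ => robust_certifies (Split.ofFinset T) (certConst k t)
  refine isEfficient_of_forall_robust (lowSets k t).toList _ h (certifier k t) ?_
  intro n L
  exact certifier_eq_true_iff t (L : Instance k n)

/-- A satisfied constraint contributes at least `1` to the sum of `Q`, any other at least `-Λ`. -/
theorem sum_map_le_of_separating {k n : ℕ} (P : Predicate k) (Q : (Fin k → ℤˣ) → ℝ) (Λ : ℝ)
    (h1 : ∀ z, P z = true → 1 ≤ Q z) (h2 : ∀ z, -Λ ≤ Q z) (I : Instance k n) (x : Fin n → ℤˣ) :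
    (1 + Λ) * (I.countP (fun C => P (C.literals x) = true) : ℝ) ≤
      (I.map fun C => Q (C.literals x)).sum + Λ * Multiset.card I := by
  induction I using Multiset.induction_on with
  | empty => simp
  | cons C I ih =>
    rw [Multiset.countP_cons, Multiset.map_cons, Multiset.sum_cons, Multiset.card_cons]
    split_ifs with h
    · have := h1 _ h
      push_cast
      linarith
    · have := h2 (C.literals x)
      push_cast
      linarith

theorem map_sum_mul {α ι : Type*} (I : Multiset α) (s : Finset ι) (q : ι → ℝ) (f : ι → α → ℝ) :
    (I.map fun C => ∑ T ∈ s, q T * f T C).sum = ∑ T ∈ s, q T * (I.map (f T)).sum := by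
  induction I using Multiset.induction_on with
  | empty => simp
  | cons C I ih => simp [ih, mul_add, Finset.sum_add_distrib]

/-- With `D = k ^ t ≥ 4` the left side is at most `D ^ (3 * D) = exp (3 * D * log D)`. The constant
`5` works because `5 * log 2 ≥ 3` and `log D ≥ 1`. -/
theorem two_mul_le_two_rpow_softBound {k t : ℕ} (ht : 2 ≤ t) (hk : t ≤ k) :
    2 * (1 + ((k : ℝ) ^ t) ^ (2 * k ^ t + 3)) ≤ (2 : ℝ) ^ softBound 5 k t := by
  have hD4 : 4 ≤ k ^ t := by
    calc 4 = 2 ^ 2 := rfl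
      _ ≤ k ^ 2 := Nat.pow_le_pow_left (by omega) _
      _ ≤ k ^ t := Nat.pow_le_pow_right (by omega) ht
  obtain ⟨D, hD⟩ : ∃ D : ℕ, D = k ^ t := ⟨_, rfl⟩
  rw [← hD] at hD4 ⊢
  have hDR : (k : ℝ) ^ t = (D : ℝ) := by rw [hD]; push_cast; rfl
  have hD4' : (4 : ℝ) ≤ D := by exact_mod_cast hD4
  have hpow : (1 : ℝ) ≤ (D : ℝ) ^ (2 * D + 3) := one_le_pow₀ (by linarith)
  have hlog : 1 ≤ Real.log D := by
    have h1 : Real.log 4 ≤ Real.log D := Real.log_le_log (by norm_num) hD4'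
    have h2 : Real.log 4 = 2 * Real.log 2 := by
      rw [show (4 : ℝ) = 2 ^ 2 by norm_num, Real.log_pow]; norm_num
    have := Real.log_two_gt_d9
    linarith
  unfold softBound
  rw [hDR]
  calc 2 * (1 + (D : ℝ) ^ (2 * D + 3)) ≤ 4 * (D : ℝ) ^ (2 * D + 3) := by linarith
    _ ≤ D * (D : ℝ) ^ (2 * D + 3) := by gcongr
    _ = (D : ℝ) ^ (2 * D + 4) := by ring
    _ ≤ (D : ℝ) ^ (3 * D) := pow_le_pow_right₀ (by linarith) (by omega)
    _ = Real.exp (Real.log D * ((3 * D : ℕ) : ℝ)) := by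
        rw [← Real.rpow_natCast, Real.rpow_def_of_pos (by linarith)]
    _ ≤ Real.exp (Real.log 2 * ((5 : ℕ) * (D : ℝ) * Real.log D ^ 5)) := by
        rw [Real.exp_le_exp]
        have h1 : (1 : ℝ) ≤ Real.log D ^ 4 := one_le_pow₀ hlog
        have h2 := Real.log_two_gt_d9
        have h3 : 0 ≤ Real.log D * D := by positivity
        push_cast
        calc Real.log D * (3 * D) = 3 * (Real.log D * D) := by ring
          _ ≤ (5 * Real.log 2) * (Real.log D * D) := by gcongr; linarith
          _ ≤ (5 * Real.log 2) * (Real.log D * D) * Real.log D ^ 4 :=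
              le_mul_of_one_le_right (by positivity) h1
          _ = _ := by ring
    _ = _ := by rw [Real.rpow_def_of_pos (by norm_num)]

/-- The certificates with `K = 2 * Λ` make the average of `Q` at most `1 / 2`, which caps the
satisfied fraction at `(1 / 2 + Λ) / (1 + Λ)`. -/
theorem certifier_neverErrs {k t : ℕ} (ht : 2 ≤ t) (hk : t ≤ k) (P : Predicate k)
    (hP : ¬ Supports t P) :
    (certifier k t).NeverErrs P ((2 : ℝ) ^ (-softBound 5 k t)) := by
  intro n I hI
  rw [certifier_eq_true_iff] at hI
  obtain ⟨q, hq1, hq2⟩ := exists_separating_polynomial (by omega : 1 ≤ k) P hP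
  have hsoft := two_mul_le_two_rpow_softBound ht hk
  set Λ : ℝ := ((k : ℝ) ^ t) ^ (2 * k ^ t + 3) with hΛ
  have hΛ1 : 0 < Λ := by
    have : 0 < (k : ℝ) := by exact_mod_cast (by omega : 0 < k)
    positivity
  have hδ : (2 : ℝ) ^ (-softBound 5 k t) ≤ 1 / (2 * (1 + Λ)) := by
    rw [Real.rpow_neg (by norm_num), ← one_div]
    exact one_div_le_one_div_of_le (by positivity) hsoft
  refine Finset.sup'_le _ _ fun x _ => le_trans ?_ (sub_le_sub_left hδ 1)
  have hterm : ∀ T ∈ lowSets k t,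
      |(I.map fun C => monomial T (C.literals x)).sum| ≤ Multiset.card I / (2 * Λ) := by
    intro T hT
    have h1 := (hI T (Finset.mem_toList.2 hT)).abs_sum_le x
    have h2 : (I.map fun C => monomial T (C.literals x)).sum =
        (((I.map fun C => ∏ i ∈ T, (C.literals x i : ℤ)).sum : ℤ) : ℝ) := by
      refine Eq.trans ?_ (map_multiset_sum (Int.castRingHom ℝ) _).symm
      simp [monomial]
    rw [h2, le_div_iff₀ (by positivity), mul_comm]
    have h3 : (2 * Λ : ℝ) = ((certConst k t : ℤ) : ℝ) := by
      simp [certConst, hΛ]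
    rw [h3]
    exact_mod_cast h1
  have hQ := sum_map_le_of_separating P (fun z => ∑ T ∈ lowSets k t, q T * monomial T z) Λ hq1
    (fun z => by
      refine neg_le_of_abs_le ((Finset.abs_sum_le_sum_abs _ _).trans (le_trans ?_ hq2))
      refine Finset.sum_le_sum fun T _ => ?_
      rw [abs_mul]
      rcases monomial_cases T z with h | h <;> simp [h]) I x
  rw [map_sum_mul I _ q fun T C => monomial T (C.literals x)] at hQ
  have hsum : ∑ T ∈ lowSets k t, q T * (I.map fun C => monomial T (C.literals x)).sum ≤
      Multiset.card I / 2 := by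
    calc _ ≤ ∑ T ∈ lowSets k t, |q T| * (Multiset.card I / (2 * Λ)) := by
          refine Finset.sum_le_sum fun T hT => (le_abs_self _).trans ?_
          rw [abs_mul]
          exact mul_le_mul_of_nonneg_left (hterm T hT) (abs_nonneg _)
      _ ≤ Λ * (Multiset.card I / (2 * Λ)) := by
          rw [← Finset.sum_mul]
          exact mul_le_mul_of_nonneg_right hq2 (by positivity)
      _ = Multiset.card I / 2 := by field_simp
  unfold value
  -- The empty instance has value `0` by convention, below the nonnegative bound.
  rcases Nat.eq_zero_or_pos (Multiset.card I) with h0 | h0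
  · rw [h0]
    simp only [Nat.cast_zero, div_zero, sub_nonneg]
    rw [div_le_one (by positivity)]
    linarith
  · have h0' : (0 : ℝ) < Multiset.card I := by exact_mod_cast h0
    have h1 : (1 : ℝ) - 1 / (2 * (1 + Λ)) = (1 / 2 + Λ) / (1 + Λ) := by field_simp; ring
    rw [h1, div_le_div_iff₀ h0' (by positivity)]
    linarith

/-! ### Counting pairs of walks in which every edge is repeated -/

section Counting

variable {E α γ δ : Type*} {l : ℕ}

/-- Two walks along edges, indexed by the Boolean, that move simultaneously. The step `i` ends on
the side `o (i + 1)`. The two edges of a step are linked. -/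
def IsChain (κ : E → Key α γ) (o : Fin (l + 1) → Bool) (g : Fin (l + 1) × Bool → E) : Prop :=
  (∀ i, Linked κ (g (i, false)) (g (i, true))) ∧
    ∀ (i : Fin l) c, (κ (g (i.succ, c))).1 (o i.succ) = (κ (g (i.castSucc, c))).1 (o i.succ)

/-- `ρ x` is the first position of the value at the position `x`. -/
def IsFirst (g : Fin (l + 1) × Bool → E) (ρ : Fin (l + 1) × Bool → Fin (l + 1) × Bool) : Prop :=
  (∀ x, g (ρ x) = g x) ∧ (∀ x, (ρ x).1 ≤ x.1) ∧ ∀ x y, g x = g y → ρ x = ρ y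

theorem exists_isFirst (g : Fin (l + 1) × Bool → E) : ∃ ρ, IsFirst g ρ := by
  classical
  have h : ∀ v : Set.range g, ∃ x, g x = v ∧ ∀ y, g y = v → x.1 ≤ y.1 := by
    rintro ⟨v, x₀, rfl⟩
    obtain ⟨x, hx, hmin⟩ := Finset.exists_min_image
      (Finset.univ.filter fun x => g x = g x₀) (fun x => x.1) ⟨x₀, by simp⟩
    simp only [Finset.mem_filter, Finset.mem_univ, true_and] at hx hmin
    exact ⟨x, hx, hmin⟩
  choose φ hφ using h
  refine ⟨fun x => φ ⟨g x, x, rfl⟩, fun x => (hφ ⟨g x, x, rfl⟩).1,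
    fun x => (hφ ⟨g x, x, rfl⟩).2 x rfl, fun x y hxy => ?_⟩
  exact congrArg φ (Subtype.ext hxy)

theorem IsFirst.idem {g : Fin (l + 1) × Bool → E} {ρ} (h : IsFirst g ρ) (x) : ρ (ρ x) = ρ x :=
  h.2.2 _ _ (h.1 x)

theorem IsFirst.card_image [DecidableEq E] {g : Fin (l + 1) × Bool → E} {ρ} (h : IsFirst g ρ) :
    (Finset.univ.image g).card = Fintype.card {x // ρ x = x} := by
  rw [Fintype.card_subtype]
  have : Finset.univ.image g = (Finset.univ.filter fun x => ρ x = x).image g := by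
    ext e
    simp only [Finset.mem_image, Finset.mem_univ, true_and, Finset.mem_filter]
    constructor
    · rintro ⟨x, rfl⟩
      exact ⟨ρ x, h.idem x, h.1 x⟩
    · rintro ⟨x, _, rfl⟩
      exact ⟨x, rfl⟩
  rw [this, Finset.card_image_of_injOn]
  intro x hx y hy hxy
  simp only [Finset.coe_filter, Finset.mem_univ, true_and, Set.mem_ofPred_eq] at hx hy
  rw [← hx, ← hy, h.2.2 x y hxy]

/-- Each first position has a companion with the same value that is not a first position, and
companions of different first positions differ. So at most half of the `2 * (l + 1)` positions are
first. -/
theorem IsFirst.card_le {g : Fin (l + 1) × Bool → E} {ρ} (h : IsFirst g ρ)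
    (hrep : ∀ x, ∃ y, y ≠ x ∧ g y = g x) : Fintype.card {x // ρ x = x} ≤ l + 1 := by
  choose s hs hgs using hrep
  have hρs : ∀ x, ρ x = x → ρ (s x) = x := fun x hx => (h.2.2 _ _ (hgs x)).trans hx
  have h1 : Fintype.card {x // ρ x = x} ≤ Fintype.card {x // ¬ ρ x = x} := by
    refine Fintype.card_le_of_injective
      (fun x => ⟨s x, fun hx => hs x (hx.symm.trans (hρs x x.2))⟩) fun x y hxy => ?_
    have : s x = s y := congrArg Subtype.val hxy
    refine Subtype.ext ?_
    rw [← hρs x x.2, ← hρs y y.2, this]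
  have h2 := Fintype.card_subtype_compl (fun x => ρ x = x)
  simp only [Fintype.card_prod, Fintype.card_fin, Fintype.card_bool] at h2
  omega

/-- An invariant function factors through the classes generated by `π`, and each class contains a
representative and its distinct image. -/
theorem card_invariant_le {B : Type*} [Fintype B] [Fintype γ] [Nonempty γ] (π : B → B)
    (hπ : ∀ x, π x ≠ x) [Fintype {u : B → γ // ∀ x, u (π x) = u x}] :
    Fintype.card {u : B → γ // ∀ x, u (π x) = u x} ≤ Fintype.card γ ^ (Fintype.card B / 2) := by
  classical
  let r : B → B → Prop := fun x y => y = π x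
  have : Fintype (Quot r) := Fintype.ofFinite _
  have hq : 2 * Fintype.card (Quot r) ≤ Fintype.card B := by
    have : Fintype.card (Quot r × Bool) ≤ Fintype.card B := by
      refine Fintype.card_le_of_injective
        (fun x => if x.2 then π x.1.out else x.1.out) ?_
      have hmk : ∀ x : Quot r × Bool, Quot.mk r (if x.2 then π x.1.out else x.1.out) = x.1 := by
        rintro ⟨c, b⟩
        cases b
        · simp [Quot.out_eq]
        · simp only [if_true]
          rw [← Quot.sound (show r c.out (π c.out) from rfl), Quot.out_eq]
      rintro ⟨c, b⟩ ⟨c', b'⟩ hxy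
      have hc : c = c' := by
        exact (hmk (c, b)).symm.trans ((congrArg (Quot.mk r) hxy).trans (hmk (c', b')))
      subst hc
      have h1 := hπ c.out
      cases b <;> cases b'
      · rfl
      · exact absurd hxy.symm h1
      · exact absurd hxy h1
      · rfl
    simpa [mul_comm] using this
  have hinj : Fintype.card {u : B → γ // ∀ x, u (π x) = u x} ≤ Fintype.card (Quot r → γ) := by
    refine Fintype.card_le_of_injective
      (fun u => Quot.lift u.1 (by rintro x _ rfl; exact (u.2 x).symm)) fun u v huv => ?_
    refine Subtype.ext (funext fun x => ?_)
    exact congrFun huv (Quot.mk r x)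
  rw [Fintype.card_fun] at hinj
  exact hinj.trans (Nat.pow_le_pow_right Fintype.card_pos (by omega))

-- A chain with pattern `ρ` is determined by its two starting halves and, at each first position,
-- the far half, the part outside the key, and the remaining part of the key. The near half is
-- inherited from the previous step. Linked edges share the remaining part, which therefore is
-- chosen at most once for every two first positions; this gives the exponent `/ 2`.
open Classical in
theorem card_chains_le [Fintype E] [Fintype α] [Fintype γ] [Fintype δ] [Nonempty γ]
    (κ : E → Key α γ) (rest : E → δ) (hinj : Function.Injective fun e => (κ e, rest e))
    (o : Fin (l + 1) → Bool) (ρ : Fin (l + 1) × Bool → Fin (l + 1) × Bool) :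
    (Finset.univ.filter fun g => IsChain κ o g ∧ IsFirst g ρ).card ≤
      Fintype.card α ^ 2 * (Fintype.card α ^ Fintype.card {x // ρ x = x} *
        Fintype.card δ ^ Fintype.card {x // ρ x = x} *
        Fintype.card γ ^ (Fintype.card {x // ρ x = x} / 2)) := by
  rw [← Fintype.card_subtype]
  by_cases hne : Nonempty {g : Fin (l + 1) × Bool → E // IsChain κ o g ∧ IsFirst g ρ}
  swap
  · rw [not_nonempty_iff] at hne
    rw [Fintype.card_eq_zero]
    exact Nat.zero_le _
  have hidem : ∀ x, ρ (ρ x) = ρ x := by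
    obtain ⟨g, -, hg⟩ := hne
    exact hg.idem
  -- `π` sends a first position to the first occurrence of its partner edge. It has no fixed point,
  -- because linked edges have different keys.
  let π : {x // ρ x = x} → {x // ρ x = x} := fun x => ⟨ρ (x.1.1, !x.1.2), hidem _⟩
  have hlink : ∀ g, IsChain κ o g → ∀ i c, Linked κ (g (i, c)) (g (i, !c)) := by
    intro g hg i c
    cases c
    · exact hg.1 i
    · exact ⟨(hg.1 i).1.symm, (hg.1 i).2.symm⟩
  have hπ : ∀ x, π x ≠ x := by
    obtain ⟨g, hg, hf⟩ := hne
    intro x hx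
    have h1 : ρ (x.1.1, !x.1.2) = x.1 := congrArg Subtype.val hx
    have h2 := hf.1 (x.1.1, !x.1.2)
    rw [h1] at h2
    refine (hlink g hg x.1.1 x.1.2).2 ?_
    rw [← h2]
  have hcard : Fintype.card {g : Fin (l + 1) × Bool → E // IsChain κ o g ∧ IsFirst g ρ} ≤
      Fintype.card ((Bool → α) × ({x // ρ x = x} → α) × ({x // ρ x = x} → δ) ×
        {u : {x // ρ x = x} → γ // ∀ x, u (π x) = u x}) := by
    refine Fintype.card_le_of_injective (fun g => (fun c => (κ (g.1 (0, c))).1 (o 0),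
      fun x => (κ (g.1 x)).1 (!o x.1.1), fun x => rest (g.1 x),
      ⟨fun x => (κ (g.1 x)).2, fun x => ?_⟩)) ?_
    · show (κ (g.1 (ρ (x.1.1, !x.1.2)))).2 = _
      rw [g.2.2.1]
      exact (hlink g.1 g.2.1 x.1.1 x.1.2).1.symm
    · rintro ⟨g, hg, hf⟩ ⟨g', hg', hf'⟩ heq
      simp only [Prod.mk.injEq, Subtype.mk.injEq] at heq
      obtain ⟨hstart, hfar, hrest, hu⟩ := heq
      refine Subtype.ext (funext fun x => ?_)
      show g x = g' x
      -- Decoding proceeds step by step along the walk: a first position is read off the code, any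
      -- other repeats an earlier step.
      have key : ∀ (m : ℕ) (i : Fin (l + 1)), (i : ℕ) = m → ∀ c, g (i, c) = g' (i, c) := by
        intro m
        induction m using Nat.strong_induction_on with
        | _ m ih =>
          intro i hi c
          by_cases hx : ρ (i, c) = (i, c)
          · have hnear : (κ (g (i, c))).1 (o i) = (κ (g' (i, c))).1 (o i) := by
              induction i using Fin.cases with
              | zero => exact congrFun hstart c
              | succ i =>
                rw [hg.2 i c, hg'.2 i c, ih i (by rw [← hi]; simp) i.castSucc (by simp) c]
            have hfar' : (κ (g (i, c))).1 (!o i) = (κ (g' (i, c))).1 (!o i) :=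
              congrFun hfar ⟨(i, c), hx⟩
            have h1 : (κ (g (i, c))).1 = (κ (g' (i, c))).1 := by
              funext b
              by_cases hb : b = o i
              · rw [hb]; exact hnear
              · rw [show b = !o i by cases b <;> cases h : o i <;> simp_all]; exact hfar'
            have h2 : (κ (g (i, c))).2 = (κ (g' (i, c))).2 := congrFun hu ⟨(i, c), hx⟩
            have h3 : rest (g (i, c)) = rest (g' (i, c)) := congrFun hrest ⟨(i, c), hx⟩
            exact hinj (Prod.ext (Prod.ext h1 h2) h3)
          · rw [← hf.1 (i, c), ← hf'.1 (i, c)]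
            have hle := hf.2.1 (i, c)
            -- The first occurrence cannot lie in the same step, whose two edges are linked and
            -- hence distinct.
            have hlt : (ρ (i, c)).1 < i := by
              refine lt_of_le_of_ne hle fun h => ?_
              obtain ⟨b, hb⟩ : ∃ b, ρ (i, c) = (i, b) := ⟨(ρ (i, c)).2, Prod.ext h rfl⟩
              by_cases hbc : b = c
              · exact hx (by rw [hb, hbc])
              · have hb' : b = !c := by cases b <;> cases c <;> simp_all
                have h4 := hf.1 (i, c)
                rw [hb, hb'] at h4
                exact (hlink g hg i c).2 (by rw [h4])
            exact ih (ρ (i, c)).1 (by rw [← hi]; exact hlt) (ρ (i, c)).1 rfl (ρ (i, c)).2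
      exact key _ x.1 rfl x.2
  refine hcard.trans ?_
  have := card_invariant_le (γ := γ) π hπ
  rw [Fintype.card_prod, Fintype.card_prod, Fintype.card_prod, Fintype.card_fun, Fintype.card_fun,
    Fintype.card_fun, Fintype.card_bool, mul_assoc (Fintype.card α ^ _)]
  gcongr

open Classical in
/-- The sum over all chains in which every edge is repeated, weighted by the number of distinct
edges. -/
theorem sum_chains_le [Fintype E] [DecidableEq E] [Fintype α] [Fintype γ] [Fintype δ] [Nonempty γ]
    (κ : E → Key α γ) (rest : E → δ) (hinj : Function.Injective fun e => (κ e, rest e))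
    (o : Fin (l + 1) → Bool) {w s : ℝ} (hw : 0 ≤ w) (hs : 0 ≤ s)
    (hs2 : s ^ 2 = Fintype.card γ)
    (hB : 1 ≤ Fintype.card α * Fintype.card δ * s * w) :
    ∑ g ∈ Finset.univ.filter (fun g => IsChain κ o g ∧ ∀ x, ∃ y, y ≠ x ∧ g y = g x),
        w ^ (Finset.univ.image g).card ≤
      (2 * (l + 1 : ℕ) : ℝ) ^ (2 * (l + 1)) * ((Fintype.card α : ℝ) ^ 2 *
        (Fintype.card α * Fintype.card δ * s * w) ^ (l + 1)) := by
  set S := Finset.univ.filter (fun g => IsChain κ o g ∧ ∀ x, ∃ y, y ≠ x ∧ g y = g x) with hS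
  have hs1 : 1 ≤ s := by
    have : (1 : ℝ) ≤ s ^ 2 := by rw [hs2]; exact_mod_cast Fintype.card_pos
    exact (one_le_sq_iff₀ hs).1 this
  have h1 : ∑ g ∈ S, w ^ (Finset.univ.image g).card ≤
      ∑ g ∈ S, ∑ ρ : Fin (l + 1) × Bool → Fin (l + 1) × Bool,
        if IsFirst g ρ then w ^ (Finset.univ.image g).card else 0 := by
    refine Finset.sum_le_sum fun g _ => ?_
    obtain ⟨ρ, hρ⟩ := exists_isFirst g
    refine le_trans (le_of_eq (if_pos hρ).symm) (Finset.single_le_sum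
      (f := fun ρ => if IsFirst g ρ then w ^ (Finset.univ.image g).card else 0)
      (fun ρ _ => ?_) (Finset.mem_univ ρ))
    split_ifs
    · positivity
    · exact le_rfl
  refine h1.trans ?_
  rw [Finset.sum_comm]
  have h2 : ∀ ρ : Fin (l + 1) × Bool → Fin (l + 1) × Bool,
      (∑ g ∈ S, if IsFirst g ρ then w ^ (Finset.univ.image g).card else 0) ≤
        (Fintype.card α : ℝ) ^ 2 * (Fintype.card α * Fintype.card δ * s * w) ^ (l + 1) := by
    intro ρ
    rw [← Finset.sum_filter]
    set b := Fintype.card {x // ρ x = x} with hb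
    by_cases hne : (S.filter fun g => IsFirst g ρ).Nonempty
    swap
    · rw [Finset.not_nonempty_iff_eq_empty.1 hne, Finset.sum_empty]
      positivity
    have hbl : b ≤ l + 1 := by
      obtain ⟨g, hg⟩ := hne
      simp only [hS, Finset.mem_filter, Finset.mem_univ, true_and] at hg
      exact hg.2.card_le hg.1.2
    have hcard : ((S.filter fun g => IsFirst g ρ).card : ℝ) ≤
        (Fintype.card α : ℝ) ^ 2 * ((Fintype.card α : ℝ) ^ b * (Fintype.card δ : ℝ) ^ b *
          (Fintype.card γ : ℝ) ^ (b / 2)) := by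
      have h3 := card_chains_le κ rest hinj o ρ
      have h4 : (S.filter fun g => IsFirst g ρ).card ≤
          (Finset.univ.filter fun g => IsChain κ o g ∧ IsFirst g ρ).card := by
        refine Finset.card_le_card fun g hg => ?_
        simp only [hS, Finset.mem_filter, Finset.mem_univ, true_and] at hg ⊢
        exact ⟨hg.1.1, hg.2⟩
      exact_mod_cast h4.trans h3
    -- With `s` the square root of `card γ` the rounded exponent disappears.
    have hγ : (Fintype.card γ : ℝ) ^ (b / 2) ≤ s ^ b := by
      rw [← hs2, ← pow_mul]
      exact pow_le_pow_right₀ hs1 (by omega)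
    calc ∑ g ∈ S.filter (fun g => IsFirst g ρ), w ^ (Finset.univ.image g).card
        = ∑ g ∈ S.filter (fun g => IsFirst g ρ), w ^ b := by
          refine Finset.sum_congr rfl fun g hg => ?_
          rw [(Finset.mem_filter.1 hg).2.card_image]
      _ = (S.filter fun g => IsFirst g ρ).card * w ^ b := by
          rw [Finset.sum_const, nsmul_eq_mul]
      _ ≤ ((Fintype.card α : ℝ) ^ 2 * ((Fintype.card α : ℝ) ^ b * (Fintype.card δ : ℝ) ^ b *
          s ^ b)) * w ^ b :=
          mul_le_mul_of_nonneg_right (hcard.trans (by gcongr)) (by positivity)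
      _ = (Fintype.card α : ℝ) ^ 2 * (Fintype.card α * Fintype.card δ * s * w) ^ b := by
          rw [mul_pow, mul_pow, mul_pow]; ring
      -- The base is at least `1` by `hB`, so `b` may be replaced by its maximum `l + 1`.
      _ ≤ _ := by gcongr
  refine (Finset.sum_le_sum fun ρ _ => h2 ρ).trans (le_of_eq ?_)
  rw [Finset.sum_const, Finset.card_univ, Fintype.card_fun, nsmul_eq_mul]
  simp only [Fintype.card_prod, Fintype.card_fin, Fintype.card_bool]
  push_cast
  rw [mul_comm ((l : ℝ) + 1) 2, mul_comm (l + 1) 2]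

end Counting

/-! ### The trace as a sum over closed chains -/

section Trace

set_option linter.unusedSectionVars false

variable {R E α γ P : Type*} [CommRing R] [Fintype E] [DecidableEq E] [Fintype α] [DecidableEq α]
  [Fintype γ] [DecidableEq γ] [Fintype P] [DecidableEq P]

/-- The weight `F` on the two ends is arbitrary so that the induction can absorb the first step into
it; for the trace it becomes the closing step. -/
theorem sum_paths_mul (M : Matrix P P R) (l : ℕ) : ∀ F : P → P → R,
    ∑ p : Fin (l + 1) → P, (∏ i : Fin l, M (p i.castSucc) (p i.succ)) * F (p 0) (p (Fin.last l)) =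
      ∑ a, ∑ b, (M ^ l) a b * F a b := by
  induction l with
  | zero =>
    intro F
    simp only [Finset.univ_eq_empty, Finset.prod_empty, one_mul, pow_zero, Matrix.one_apply, ite_mul,
      zero_mul, Finset.sum_ite_eq, Finset.mem_univ, if_true]
    exact Fintype.sum_equiv (Equiv.funUnique (Fin 1) P) _ _ fun p => rfl
  | succ l ih =>
    intro F
    rw [← (Fin.consEquiv fun _ => P).sum_comp, Fintype.sum_prod_type, Finset.sum_comm]
    have h : ∀ (p : Fin (l + 1) → P) (a : P), (∏ i : Fin (l + 1),
        M ((Fin.consEquiv fun _ => P) (a, p) i.castSucc) ((Fin.consEquiv fun _ => P) (a, p) i.succ)) *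
        F ((Fin.consEquiv fun _ => P) (a, p) 0) ((Fin.consEquiv fun _ => P) (a, p) (Fin.last (l + 1))) =
        (∏ i : Fin l, M (p i.castSucc) (p i.succ)) * (M a (p 0) * F a (p (Fin.last l))) := by
      intro p a
      rw [Fin.prod_univ_succ]
      simp only [Fin.consEquiv_apply, Fin.cons_succ, ← Fin.succ_castSucc, ← Fin.succ_last,
        Fin.castSucc_zero, Fin.cons_zero]
      ring
    simp only [h, ← Finset.mul_sum]
    rw [ih fun a' b => ∑ a, M a a' * F a b]
    simp only [pow_succ', Matrix.mul_apply, Finset.mul_sum, Finset.sum_mul]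
    rw [Finset.sum_congr rfl fun _ _ => Finset.sum_comm, Finset.sum_comm]
    refine Finset.sum_congr rfl fun a _ => ?_
    rw [Finset.sum_comm]
    exact Finset.sum_congr rfl fun _ _ => Finset.sum_congr rfl fun _ _ => by ring

/-- The pairs of edges of a pair of walks. -/
def chainPair {l : ℕ} (o : Fin l → Bool) (g : Fin l × Bool → E) (i : Fin l) : E × E × Bool :=
  (g (i, false), g (i, true), o i)

/-- The pairs of walks that contribute to the trace. -/
def IsClosedChain {l : ℕ} (κ : E → Key α γ) (o : Fin (l + 1) → Bool)
    (g : Fin (l + 1) × Bool → E) : Prop :=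
  ((∀ i : Fin l, pairDst κ (chainPair o g i.castSucc) = pairSrc κ (chainPair o g i.succ)) ∧
    pairDst κ (chainPair o g (Fin.last l)) = pairSrc κ (chainPair o g 0)) ∧
    ∀ i, Linked κ (g (i, false)) (g (i, true))

instance {l : ℕ} (κ : E → Key α γ) (o : Fin (l + 1) → Bool) (g : Fin (l + 1) × Bool → E) :
    Decidable (IsClosedChain κ o g) := inferInstanceAs (Decidable (_ ∧ _))

theorem IsClosedChain.isChain {l : ℕ} {κ : E → Key α γ} {o : Fin (l + 1) → Bool}
    {g : Fin (l + 1) × Bool → E} (h : IsClosedChain κ o g) : IsChain κ o g := by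
  refine ⟨h.2, fun i c => ?_⟩
  have h1 := h.1.1 i
  simp only [pairDst, pairSrc, chainPair, Prod.mk.injEq] at h1
  obtain ⟨h2, h3, h4⟩ := h1
  rw [h2] at h3 h4
  cases c
  · exact h3.symm
  · exact h4.symm

/-- Pairs of walks as functions of the position. -/
def chainEquiv (E : Type*) (l : ℕ) :
    (Fin l → Bool) × (Fin l × Bool → E) ≃ (Fin l → E × E × Bool) where
  toFun x := chainPair x.1 x.2
  invFun p := (fun i => (p i).2.2, fun x => if x.2 then (p x.1).2.1 else (p x.1).1)
  left_inv := by
    rintro ⟨o, g⟩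
    refine Prod.ext rfl (funext ?_)
    rintro ⟨i, c⟩
    cases c <;> rfl
  right_inv p := rfl

/-- In a closed walk of the transfer matrix the incidence conditions, the links and the weights
separate into independent factors. -/
theorem trace_chaosMatrix_pow (κ : E → Key α γ) (ξ : E → R) (l : ℕ) :
    (chaosMatrix κ ξ ^ (l + 1)).trace = ∑ o : Fin (l + 1) → Bool, ∑ g : Fin (l + 1) × Bool → E,
      if IsClosedChain κ o g then ∏ x, ξ (g x) else 0 := by
  have h1 := sum_paths_mul (walkMatrix κ ξ) l fun a b => walkMatrix κ ξ b a
  rw [← trace_walkMatrix_pow, pow_succ]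
  have h2 : (walkMatrix κ ξ ^ l * walkMatrix κ ξ).trace =
      ∑ a, ∑ b, (walkMatrix κ ξ ^ l) a b * walkMatrix κ ξ b a := by
    simp only [Matrix.trace, Matrix.diag, Matrix.mul_apply]
  rw [h2, ← h1, ← (chainEquiv E (l + 1)).sum_comp, Fintype.sum_prod_type]
  refine Finset.sum_congr rfl fun o _ => Finset.sum_congr rfl fun g _ => ?_
  show (∏ i : Fin l, walkMatrix κ ξ (chainPair o g i.castSucc) (chainPair o g i.succ)) *
    walkMatrix κ ξ (chainPair o g (Fin.last l)) (chainPair o g 0) = _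
  have h3 : ∏ x, ξ (g x) = ∏ i, ξ (g (i, false)) * ξ (g (i, true)) := by
    rw [Fintype.prod_prod_type]
    exact Finset.prod_congr rfl fun i _ => by rw [Fintype.prod_bool, mul_comm]
  have h4 : ∏ i, pairWeight κ ξ (chainPair o g i) =
      if ∀ i, Linked κ (g (i, false)) (g (i, true)) then ∏ x, ξ (g x) else 0 := by
    rw [h3]
    change (∏ i, if Linked κ (g (i, false)) (g (i, true)) then
      ξ (g (i, false)) * ξ (g (i, true)) else 0) = _
    rw [Finset.prod_ite_zero]
    simp
  have h5 : (∏ i : Fin l, walkMatrix κ ξ (chainPair o g i.castSucc) (chainPair o g i.succ)) *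
      walkMatrix κ ξ (chainPair o g (Fin.last l)) (chainPair o g 0) =
      if (∀ i : Fin l, pairDst κ (chainPair o g i.castSucc) = pairSrc κ (chainPair o g i.succ)) ∧
        pairDst κ (chainPair o g (Fin.last l)) = pairSrc κ (chainPair o g 0) then
      ∏ i, pairWeight κ ξ (chainPair o g i) else 0 := by
    rw [Fin.prod_univ_castSucc]
    simp only [walkMatrix]
    rw [Finset.prod_ite_zero]
    simp only [Finset.mem_univ, true_implies]
    split_ifs <;> simp_all
  rw [h5, h4, ← ite_and]
  rfl

end Trace

/-! ### Expectations over independent selections as finite sums -/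

section Bernoulli

set_option linter.unusedSectionVars false

/-- The probability of a selection. -/
def selWeight {ι : Type*} [Fintype ι] (p : ℝ) (ω : ι → Bool) : ℝ :=
  ∏ i, if ω i = true then p else 1 - p

variable {ι A B : Type*} [Fintype ι] [DecidableEq ι] [Fintype A] [DecidableEq A] [Fintype B]
  [DecidableEq B] {p : ℝ}

theorem selWeight_nonneg (hp0 : 0 ≤ p) (hp1 : p ≤ 1) (ω : ι → Bool) : 0 ≤ selWeight p ω :=
  Finset.prod_nonneg fun i _ => by split_ifs <;> linarith

theorem sum_selWeight_mul_prod (f : ι → Bool → ℝ) :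
    ∑ ω, selWeight p ω * ∏ i, f i (ω i) = ∏ i, (p * f i true + (1 - p) * f i false) := by
  have h := Finset.prod_univ_sum (fun _ : ι => (Finset.univ : Finset Bool))
    fun i b => (if b = true then p else 1 - p) * f i b
  simp only [Fintype.sum_bool, if_true, Bool.false_eq_true, if_false, Fintype.piFinset_univ] at h
  rw [h]
  simp only [selWeight, Finset.prod_mul_distrib]

theorem sum_selWeight : ∑ ω : ι → Bool, selWeight p ω = 1 := by
  simpa using sum_selWeight_mul_prod (p := p) fun (_ : ι) _ => 1

theorem sum_selWeight_single (c : ι) : ∑ ω, selWeight p ω * (if ω c = true then 1 else 0) = p := by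
  have h := sum_selWeight_mul_prod (p := p) fun i b => if i = c then (if b = true then 1 else 0) else 1
  simp only [Finset.prod_ite_eq', Finset.mem_univ, if_true] at h
  rw [h]
  rw [Finset.prod_eq_single c] <;> simp +contextual

/-- Independence of the columns `ω (·, b)`. -/
theorem sum_selWeight_prod (F : B → (A → Bool) → ℝ) :
    ∑ ω : A × B → Bool, selWeight p ω * ∏ b, F b (fun a => ω (a, b)) =
      ∏ b, ∑ η : A → Bool, selWeight p η * F b η := by
  have h := Finset.prod_univ_sum (fun _ : B => (Finset.univ : Finset (A → Bool)))
    fun b η => selWeight p η * F b η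
  rw [h, Fintype.piFinset_univ]
  let e : (A × B → Bool) ≃ (B → A → Bool) :=
    ((Equiv.prodComm A B).arrowCongr (Equiv.refl Bool)).trans (Equiv.curry B A Bool)
  refine Fintype.sum_equiv e _ _ fun ω => ?_
  rw [Finset.prod_mul_distrib]
  congr 1
  simp only [selWeight]
  rw [Fintype.prod_prod_type, Finset.prod_comm]
  rfl

/-- The sum of the signs of the selected elements of a column. -/
def columnSum (sg : A → ℝ) (η : A → Bool) : ℝ := ∑ a, if η a = true then sg a else 0

theorem abs_columnSum_le {sg : A → ℝ} (hsg : ∀ a, |sg a| ≤ 1) (η : A → Bool) :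
    |columnSum sg η| ≤ Fintype.card A := by
  refine (Finset.abs_sum_le_sum_abs _ _).trans ?_
  refine (Finset.sum_le_sum (g := fun _ => (1 : ℝ)) fun a _ => ?_).trans (by simp)
  split_ifs
  · exact hsg a
  · simp

theorem sum_columnSum {sg : A → ℝ} (h0 : ∑ a, sg a = 0) :
    ∑ η, selWeight p η * columnSum sg η = 0 := by
  have h : ∀ η : A → Bool, selWeight p η * columnSum sg η =
      ∑ a, sg a * (selWeight p η * if η a = true then 1 else 0) := by
    intro η
    rw [columnSum, Finset.mul_sum]
    refine Finset.sum_congr rfl fun a _ => ?_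
    split_ifs <;> ring
  simp only [h]
  rw [Finset.sum_comm]
  simp only [← Finset.mul_sum, sum_selWeight_single, ← Finset.sum_mul, h0, zero_mul]

/-- As `m ≠ 0`, an empty column contributes nothing; otherwise the power is at most `card A ^ m`,
and the number of selected entries, of mean `card A * p`, is at least `1`. -/
theorem abs_sum_columnSum_pow_le {sg : A → ℝ} (hsg : ∀ a, |sg a| ≤ 1) (hp0 : 0 ≤ p) (hp1 : p ≤ 1)
    {m : ℕ} (hm : m ≠ 0) :
    |∑ η, selWeight p η * columnSum sg η ^ m| ≤ (Fintype.card A : ℝ) ^ m * (Fintype.card A * p) := by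
  refine (Finset.abs_sum_le_sum_abs _ _).trans ?_
  have h : ∀ η : A → Bool, |selWeight p η * columnSum sg η ^ m| ≤
      (Fintype.card A : ℝ) ^ m * ∑ a, selWeight p η * if η a = true then 1 else 0 := by
    intro η
    have hw := selWeight_nonneg hp0 hp1 η
    rw [abs_mul, abs_of_nonneg hw, ← Finset.mul_sum, mul_left_comm]
    refine mul_le_mul_of_nonneg_left ?_ hw
    by_cases hη : ∃ a, η a = true
    · obtain ⟨a, ha⟩ := hη
      have h1 : (1 : ℝ) ≤ ∑ a, if η a = true then 1 else 0 := by
        refine le_trans (by simp [ha]) (Finset.single_le_sum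
          (f := fun a => if η a = true then (1 : ℝ) else 0)
          (fun a _ => by positivity) (Finset.mem_univ a))
      rw [abs_pow]
      exact (pow_le_pow_left₀ (abs_nonneg _) (abs_columnSum_le hsg η) m).trans
        (le_mul_of_one_le_right (by positivity) h1)
    · have h1 : columnSum sg η = 0 :=
        Finset.sum_eq_zero fun a _ => if_neg fun ha => hη ⟨a, ha⟩
      rw [h1, zero_pow hm, abs_zero]
      positivity
  refine (Finset.sum_le_sum fun η _ => h η).trans (le_of_eq ?_)
  rw [← Finset.mul_sum, Finset.sum_comm]
  simp only [sum_selWeight_single, Finset.sum_const, Finset.card_univ, nsmul_eq_mul]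

variable {X : Type*} [Fintype X] [DecidableEq X]

theorem sum_prod_columnSum (sg : A → ℝ) (g : X → B) :
    ∑ ω : A × B → Bool, selWeight p ω * ∏ x, columnSum sg (fun a => ω (a, g x)) =
      ∏ b, ∑ η, selWeight p η * columnSum sg η ^ (Finset.univ.filter fun x => g x = b).card := by
  rw [← sum_selWeight_prod]
  refine Finset.sum_congr rfl fun ω _ => ?_
  congr 1
  have := Finset.prod_fiberwise' Finset.univ g fun b => columnSum sg fun a => ω (a, b)
  rw [← this]
  simp only [Finset.prod_const]

/-- A column that occurs once contributes its mean, which is `0`. -/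
theorem sum_prod_columnSum_eq_zero {sg : A → ℝ} (h0 : ∑ a, sg a = 0) (g : X → B)
    (hg : ¬ ∀ x, ∃ y, y ≠ x ∧ g y = g x) :
    ∑ ω : A × B → Bool, selWeight p ω * ∏ x, columnSum sg (fun a => ω (a, g x)) = 0 := by
  rw [sum_prod_columnSum]
  push Not at hg
  obtain ⟨x, hx⟩ := hg
  refine Finset.prod_eq_zero (Finset.mem_univ (g x)) ?_
  have : (Finset.univ.filter fun y => g y = g x) = {x} := by
    ext y
    simp only [Finset.mem_filter, Finset.mem_univ, true_and, Finset.mem_singleton]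
    exact ⟨fun h => by_contra fun hy => hx y hy h, fun h => h ▸ rfl⟩
  rw [this, Finset.card_singleton]
  simpa using sum_columnSum h0

/-- Each distinct column costs one factor `card A * p`, however often it occurs; the multiplicities
add up to `card X`. -/
theorem abs_sum_prod_columnSum_le {sg : A → ℝ} (hsg : ∀ a, |sg a| ≤ 1) (hp0 : 0 ≤ p) (hp1 : p ≤ 1)
    (g : X → B) :
    |∑ ω : A × B → Bool, selWeight p ω * ∏ x, columnSum sg (fun a => ω (a, g x))| ≤
      (Fintype.card A : ℝ) ^ Fintype.card X *
        (Fintype.card A * p) ^ (Finset.univ.image g).card := by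
  rw [sum_prod_columnSum, Finset.abs_prod]
  have h1 : ∀ b, |∑ η, selWeight p η * columnSum sg η ^ (Finset.univ.filter fun x => g x = b).card| ≤
      (Fintype.card A : ℝ) ^ (Finset.univ.filter fun x => g x = b).card *
        if b ∈ Finset.univ.image g then Fintype.card A * p else 1 := by
    intro b
    split_ifs with hb
    · refine abs_sum_columnSum_pow_le hsg hp0 hp1 (Finset.card_ne_zero.2 ?_)
      obtain ⟨x, -, hx⟩ := Finset.mem_image.1 hb
      exact ⟨x, by simp [hx]⟩
    · have : (Finset.univ.filter fun x => g x = b) = ∅ := by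
        refine Finset.filter_eq_empty_iff.2 fun x _ hx => hb ?_
        exact Finset.mem_image.2 ⟨x, Finset.mem_univ x, hx⟩
      rw [this]
      simp [sum_selWeight]
  refine (Finset.prod_le_prod (fun b _ => abs_nonneg _) fun b _ => h1 b).trans (le_of_eq ?_)
  rw [Finset.prod_mul_distrib, Finset.prod_pow_eq_pow_sum, Finset.prod_ite_mem, Finset.univ_inter,
    Finset.prod_const]
  congr 2
  exact (Finset.card_eq_sum_card_fiberwise fun x _ => Finset.mem_univ (g x)).symm

end Bernoulli

/-! ### The certificates on random instances -/

namespace Split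

set_option linter.unusedSectionVars false

variable {k : ℕ} (σ : Split k) {n : ℕ}

/-- The part of a scope that does not belong to the split. -/
def rest (S : Fin k → Fin n) :
    {j // j ∉ Set.range (Sum.elim (fun x : Bool × Fin σ.q => σ.half x.1 x.2) σ.last)} → Fin n :=
  fun j => S j

theorem key_rest_injective :
    Function.Injective fun S : Fin k → Fin n => (σ.key S, σ.rest S) := by
  intro S S' h
  simp only [Prod.mk.injEq] at h
  funext j
  by_cases hj : j ∈ Set.range (Sum.elim (fun x : Bool × Fin σ.q => σ.half x.1 x.2) σ.last)
  · obtain ⟨⟨b, i⟩ | i, rfl⟩ := hj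
    · exact congrFun (congrFun (congrArg Prod.fst h.1) b) i
    · exact congrFun (congrArg Prod.snd h.1) i
  · exact congrFun h.2 ⟨j, hj⟩

open Classical in
theorem card_rest : Fintype.card {j // j ∉ Set.range
    (Sum.elim (fun x : Bool × Fin σ.q => σ.half x.1 x.2) σ.last)} + σ.degree = k := by
  have h1 := Fintype.card_subtype_compl (fun j => j ∈ Set.range
    (Sum.elim (fun x : Bool × Fin σ.q => σ.half x.1 x.2) σ.last))
  have h2 : Fintype.card {j // j ∈ Set.range
      (Sum.elim (fun x : Bool × Fin σ.q => σ.half x.1 x.2) σ.last)} = σ.degree := by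
    rw [← Fintype.card_congr (Equiv.ofInjective _ σ.inj)]
    simp [degree]
  have h3 := Fintype.card_subtype_le (fun j => j ∈ Set.range
    (Sum.elim (fun x : Bool × Fin σ.q => σ.half x.1 x.2) σ.last))
  simp only [Fintype.card_fin] at h1 h3
  omega

theorem abs_sign_le (c : Fin k → ℤˣ) : |(σ.sign c : ℝ)| ≤ 1 := by
  rcases σ.sign_eq_or c with h | h <;> simp [h]

theorem nonempty_coord (h : 1 ≤ σ.degree) : Nonempty ((Bool × Fin σ.q) ⊕ Fin σ.u) := by
  unfold degree at h
  by_cases hq : σ.q = 0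
  · exact ⟨Sum.inr ⟨0, by omega⟩⟩
  · exact ⟨Sum.inl (true, ⟨0, by omega⟩)⟩

theorem sign_eq_prod (c : Fin k → ℤˣ) : σ.sign c =
    ∏ x : (Bool × Fin σ.q) ⊕ Fin σ.u,
      (c (Sum.elim (fun x : Bool × Fin σ.q => σ.half x.1 x.2) σ.last x) : ℤ) := by
  rw [Fintype.prod_sum_type, Fintype.prod_prod_type, Fintype.prod_bool]
  simp only [Sum.elim_inl, Sum.elim_inr, sign]
  ring

/-- Flipping one coordinate of the split is a bijection of the negation patterns that reverses the
sign. -/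
theorem sum_sign (h : 1 ≤ σ.degree) : ∑ c, (σ.sign c : ℝ) = 0 := by
  obtain ⟨x⟩ := σ.nonempty_coord h
  set f := Sum.elim (fun x : Bool × Fin σ.q => σ.half x.1 x.2) σ.last with hf
  let d : Fin k → ℤˣ := Function.update 1 (f x) (-1)
  have hd : σ.sign d = -1 := by
    rw [sign_eq_prod, Finset.prod_eq_single x]
    · simp [d, ← hf]
    · intro y _ hy
      have : f y ≠ f x := fun h => hy (σ.inj h)
      simp [d, ← hf, Function.update_of_ne this]
    · simp
  have hmul : ∀ c, σ.sign (d * c) = σ.sign d * σ.sign c := by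
    intro c
    simp only [sign_eq_prod, Pi.mul_apply, Units.val_mul, Finset.prod_mul_distrib]
  have h1 := Equiv.sum_comp (Equiv.mulLeft d) fun c => (σ.sign c : ℝ)
  simp only [Equiv.coe_mulLeft, hmul, hd] at h1
  push_cast at h1
  simp only [neg_mul, one_mul, Finset.sum_neg_distrib] at h1
  linarith

/-- The total sign of the selected constraints with a given scope. -/
def scopeWeight (ω : Constraint k n → Bool) (S : Fin k → Fin n) : ℝ :=
  columnSum (fun c => (σ.sign c : ℝ)) fun c => ω (c, S)

theorem instWeight_instanceOf (ω : Constraint k n → Bool) :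
    (fun v => (σ.instWeight (instanceOf ω) v : ℝ)) = pushWeight σ.key (σ.scopeWeight ω) := by
  funext v
  have h : σ.instWeight (instanceOf ω) v =
      ∑ C ∈ Finset.univ.filter (fun C => ω C = true), if σ.key C.2 = v then σ.sign C.1 else 0 := rfl
  rw [h, Finset.sum_filter]
  push_cast
  rw [Fintype.sum_prod_type, Finset.sum_comm]
  refine Finset.sum_congr rfl fun S _ => ?_
  simp only [scopeWeight, columnSum]
  split_ifs <;> simp

/-- The expansion over closed chains is a polynomial in the weights, so it commutes with the cast.
-/
theorem cast_trace (l : ℕ) (W : Key (Fin σ.q → Fin n) (Fin σ.u → Fin n) → ℤ) :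
    (((chaosMatrix id W ^ (l + 1)).trace : ℤ) : ℝ) =
      (chaosMatrix id (fun v => (W v : ℝ)) ^ (l + 1)).trace := by
  rw [trace_chaosMatrix_pow, trace_chaosMatrix_pow]
  push_cast
  rfl

theorem trace_instanceOf (l : ℕ) (ω : Constraint k n → Bool) :
    (((chaosMatrix id (σ.instWeight (instanceOf ω)) ^ (l + 1)).trace : ℤ) : ℝ) =
      (chaosMatrix σ.key (σ.scopeWeight ω) ^ (l + 1)).trace := by
  rw [cast_trace, instWeight_instanceOf, chaosMatrix_pushWeight]

variable {p : ℝ}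

/-- The expectation of the trace. -/
theorem sum_trace_le (hσ : 1 ≤ σ.degree) (hn : 1 ≤ n) (hp0 : 0 ≤ p) (hp1 : p ≤ 1) (l : ℕ)
    (hm : Real.sqrt n ^ σ.degree ≤ 2 ^ k * n ^ k * p) :
    ∑ ω : Constraint k n → Bool,
      selWeight p ω * (chaosMatrix σ.key (σ.scopeWeight ω) ^ (l + 1)).trace ≤
      2 ^ (l + 1) * ((2 ^ k) ^ (2 * (l + 1)) * ((2 * (l + 1 : ℕ)) ^ (2 * (l + 1)) *
        (((n : ℝ) ^ σ.q) ^ 2 * (2 ^ k * n ^ k * p / Real.sqrt n ^ σ.degree) ^ (l + 1)))) := by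
  classical
  have : Nonempty (Fin n) := ⟨⟨0, hn⟩⟩
  set x := Real.sqrt n with hx
  have hxx : x ^ 2 = n := Real.sq_sqrt (Nat.cast_nonneg n)
  have hx0 : 0 < x := Real.sqrt_pos.2 (by exact_mod_cast hn)
  have hcA : (Fintype.card (Fin k → ℤˣ) : ℝ) = 2 ^ k := by simp
  set δ := Fintype.card {j // j ∉ Set.range
    (Sum.elim (fun x : Bool × Fin σ.q => σ.half x.1 x.2) σ.last)} with hδ
  have hdk : δ + σ.degree = k := σ.card_rest
  -- The growth factor per step is `n ^ q * n ^ (k - d) * n ^ (u / 2) * 2 ^ k * p` with `d = 2 * q +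
  -- u`, that is, the expected size divided by `n ^ (d / 2)`.
  have hβ : (Fintype.card (Fin σ.q → Fin n) : ℝ) * Fintype.card ({j // j ∉ Set.range
      (Sum.elim (fun x : Bool × Fin σ.q => σ.half x.1 x.2) σ.last)} → Fin n) * x ^ σ.u *
      (2 ^ k * p) = 2 ^ k * n ^ k * p / x ^ σ.degree := by
    rw [eq_div_iff (by positivity)]
    simp only [Fintype.card_fun, Fintype.card_fin, ← hδ]
    push_cast
    have h1 : (n : ℝ) ^ k = n ^ σ.q * n ^ δ * x ^ σ.u * x ^ σ.degree := by
      rw [← hxx, ← pow_mul, ← pow_mul, ← pow_mul, ← pow_add, ← pow_add, ← pow_add]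
      congr 1
      unfold degree at hdk ⊢
      omega
    rw [h1]; ring
  -- Chains with an unrepeated scope have mean zero; for the others closedness is dropped and the
  -- distinct scopes are counted.
  have hterm : ∀ o (g : Fin (l + 1) × Bool → Fin k → Fin n),
      ∑ ω : Constraint k n → Bool, selWeight p ω *
        (if IsClosedChain σ.key o g then ∏ x, σ.scopeWeight ω (g x) else 0) ≤
      if IsChain σ.key o g ∧ ∀ x, ∃ y, y ≠ x ∧ g y = g x then
        (2 ^ k) ^ (2 * (l + 1)) * (2 ^ k * p) ^ (Finset.univ.image g).card else 0 := by
    intro o g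
    by_cases hc : IsClosedChain σ.key o g
    · simp only [if_pos hc]
      by_cases hr : ∀ x, ∃ y, y ≠ x ∧ g y = g x
      · rw [if_pos ⟨hc.isChain, hr⟩]
        refine (le_abs_self _).trans ((abs_sum_prod_columnSum_le σ.abs_sign_le hp0 hp1 g).trans
          (le_of_eq ?_))
        rw [hcA]
        simp [mul_comm (l + 1)]
      · rw [if_neg fun h => hr h.2]
        exact (sum_prod_columnSum_eq_zero (σ.sum_sign hσ) g hr).le
    · simp only [if_neg hc, mul_zero, Finset.sum_const_zero]
      split_ifs
      · positivity
      · exact le_rfl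
  have hchains := fun o => sum_chains_le (l := l) (σ.key (n := n)) σ.rest σ.key_rest_injective o
    (w := 2 ^ k * p) (s := x ^ σ.u) (by positivity) (by positivity)
    (by rw [← pow_mul, mul_comm, pow_mul, hxx]; simp)
    (by rw [hβ, le_div_iff₀ (by positivity), one_mul]; exact hm)
  calc ∑ ω : Constraint k n → Bool,
        selWeight p ω * (chaosMatrix σ.key (σ.scopeWeight ω) ^ (l + 1)).trace
      = ∑ o : Fin (l + 1) → Bool, ∑ g : Fin (l + 1) × Bool → Fin k → Fin n,
          ∑ ω : Constraint k n → Bool, selWeight p ω *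
            (if IsClosedChain σ.key o g then ∏ x, σ.scopeWeight ω (g x) else 0) := by
        simp only [trace_chaosMatrix_pow, Finset.mul_sum]
        rw [Finset.sum_comm]
        exact Finset.sum_congr rfl fun o _ => Finset.sum_comm
    _ ≤ ∑ o : Fin (l + 1) → Bool, (2 ^ k) ^ (2 * (l + 1)) * ((2 * (l + 1 : ℕ)) ^ (2 * (l + 1)) *
        (((n : ℝ) ^ σ.q) ^ 2 * (2 ^ k * n ^ k * p / x ^ σ.degree) ^ (l + 1))) := by
        refine Finset.sum_le_sum fun o _ => ?_
        refine (Finset.sum_le_sum fun g _ => hterm o g).trans ?_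
        rw [← Finset.sum_filter, ← Finset.mul_sum]
        refine mul_le_mul_of_nonneg_left ?_ (by positivity)
        have h1 := hchains o
        rw [hβ] at h1
        simpa using h1
    _ = _ := by
        rw [Finset.sum_const, Finset.card_univ, nsmul_eq_mul]
        simp

/-- The expectation of the diagonal part. -/
theorem sum_sq_le (hσ : 1 ≤ σ.degree) (hp0 : 0 ≤ p) (hp1 : p ≤ 1) :
    ∑ ω : Constraint k n → Bool,
      selWeight p ω * ∑ v, pushWeight σ.key (σ.scopeWeight ω) v ^ 2 ≤
      (2 ^ k) ^ 2 * (2 ^ k * n ^ k * p) := by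
  classical
  have hcA : (Fintype.card (Fin k → ℤˣ) : ℝ) = 2 ^ k := by simp
  have hexp : ∀ ω : Constraint k n → Bool, ∑ v, pushWeight σ.key (σ.scopeWeight ω) v ^ 2 =
      ∑ S, ∑ S', if σ.key S' = σ.key S then σ.scopeWeight ω S * σ.scopeWeight ω S' else 0 := by
    intro ω
    simp only [sq]
    rw [sum_mul_pushWeight]
    refine Finset.sum_congr rfl fun S _ => ?_
    rw [pushWeight, Finset.mul_sum]
    exact Finset.sum_congr rfl fun S' _ => by split_ifs <;> simp
  -- Different scopes are independent with mean zero, so only `S = S'` survives.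
  have hpair : ∀ S S' : Fin k → Fin n, ∑ ω : Constraint k n → Bool, selWeight p ω *
      (if σ.key S' = σ.key S then σ.scopeWeight ω S * σ.scopeWeight ω S' else 0) ≤
      if S = S' then (2 ^ k) ^ 2 * (2 ^ k * p) else 0 := by
    intro S S'
    let g : Bool → Fin k → Fin n := fun b => if b = true then S' else S
    have hprod : ∀ ω : Constraint k n → Bool, σ.scopeWeight ω S * σ.scopeWeight ω S' =
        ∏ b, columnSum (fun c => (σ.sign c : ℝ)) fun c => ω (c, g b) := by
      intro ω
      rw [Fintype.prod_bool, mul_comm]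
      rfl
    by_cases hS : S = S'
    · subst hS
      simp only [if_true, hprod]
      refine (le_abs_self _).trans ((abs_sum_prod_columnSum_le σ.abs_sign_le hp0 hp1 g).trans
        (le_of_eq ?_))
      have : Finset.univ.image g = {S} := by
        ext y; simp [g, eq_comm]
      rw [hcA, this]
      simp
    · rw [if_neg hS]
      by_cases hk : σ.key S' = σ.key S
      · simp only [if_pos hk, hprod]
        refine (sum_prod_columnSum_eq_zero (σ.sum_sign hσ) g ?_).le
        intro h
        obtain ⟨y, hy, hy'⟩ := h true
        rw [show y = false by simpa using hy] at hy'
        exact hS hy'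
      · simp [if_neg hk]
  simp only [hexp, Finset.mul_sum]
  rw [Finset.sum_comm]
  simp only [Finset.sum_comm (s := (Finset.univ : Finset (Constraint k n → Bool)))]
  refine (Finset.sum_le_sum fun S _ => Finset.sum_le_sum fun S' _ => hpair S S').trans
    (le_of_eq ?_)
  simp
  ring

end Split

/-! ### The failure probability -/

section Probability

variable {ι : Type*} [Fintype ι] [DecidableEq ι] {p : ℝ}

open Classical in
/-- The probability of an event, as a finite sum. -/
noncomputable def selProb (p : ℝ) (Q : (ι → Bool) → Prop) : ℝ :=
  ∑ ω, if Q ω then selWeight p ω else 0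

theorem selProb_mono_or (hp0 : 0 ≤ p) (hp1 : p ≤ 1) {Q Q₁ Q₂ : (ι → Bool) → Prop}
    (h : ∀ ω, Q ω → Q₁ ω ∨ Q₂ ω) : selProb p Q ≤ selProb p Q₁ + selProb p Q₂ := by
  unfold selProb
  rw [← Finset.sum_add_distrib]
  refine Finset.sum_le_sum fun ω _ => ?_
  have hw := selWeight_nonneg hp0 hp1 ω
  have := h ω
  split_ifs <;> first | linarith | tauto

theorem selProb_exists_le (hp0 : 0 ≤ p) (hp1 : p ≤ 1) {τ : Type*} (s : Finset τ)
    (Q : τ → (ι → Bool) → Prop) :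
    selProb p (fun ω => ∃ T ∈ s, Q T ω) ≤ ∑ T ∈ s, selProb p (Q T) := by
  unfold selProb
  rw [Finset.sum_comm]
  refine Finset.sum_le_sum fun ω _ => ?_
  have hw := selWeight_nonneg hp0 hp1 ω
  have h0 : ∀ T, 0 ≤ (open Classical in if Q T ω then selWeight p ω else 0) := fun T => by
    split_ifs <;> simp [hw]
  split_ifs with h
  · obtain ⟨T, hT, hQ⟩ := h
    refine le_trans (le_of_eq ?_) (Finset.single_le_sum (fun T _ => h0 T) hT)
    rw [if_pos hQ]
  · exact Finset.sum_nonneg fun T _ => h0 T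

theorem selProb_le_div (hp0 : 0 ≤ p) (hp1 : p ≤ 1) {Q : (ι → Bool) → Prop} {f : (ι → Bool) → ℝ}
    {a b : ℝ} (ha : 0 < a) (hf : ∀ ω, 0 ≤ f ω) (hQ : ∀ ω, Q ω → a ≤ f ω)
    (hb : ∑ ω, selWeight p ω * f ω ≤ b) : selProb p Q ≤ b / a := by
  rw [le_div_iff₀ ha]
  refine le_trans ?_ hb
  unfold selProb
  rw [Finset.sum_mul]
  refine Finset.sum_le_sum fun ω _ => ?_
  have hw := selWeight_nonneg hp0 hp1 ω
  split_ifs with h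
  · exact mul_le_mul_of_nonneg_left (hQ ω h) hw
  · rw [zero_mul]; exact mul_nonneg hw (hf ω)

/-- The lower tail of the number of selected elements. -/
theorem selProb_card_lt_le (hp0 : 0 ≤ p) (hp1 : p ≤ 1) :
    selProb p (fun ω : ι → Bool =>
      ((Finset.univ.filter fun i => ω i = true).card : ℝ) < Fintype.card ι * p / 2) ≤
      Real.exp (-(Fintype.card ι * p) / 8) := by
  set M := Fintype.card ι * p with hM
  have hf : ∀ ω : ι → Bool, ((1 : ℝ) / 2) ^ (Finset.univ.filter fun i => ω i = true).card =
      ∏ i, if ω i = true then (1 : ℝ) / 2 else 1 := by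
    intro ω
    rw [Finset.prod_ite]
    simp
  -- Chernoff's method with the base `1 / 2`: the mean is `(1 - p / 2)` to the number of trials.
  -- Markov's inequality then gives `exp (-M / 2 + log 2 * M / 2)`, and `log 2 < 3 / 4` suffices.
  have h1 : ∑ ω : ι → Bool, selWeight p ω *
      ((1 : ℝ) / 2) ^ (Finset.univ.filter fun i => ω i = true).card ≤ Real.exp (-M / 2) := by
    simp only [hf]
    rw [sum_selWeight_mul_prod fun _ b => if b = true then (1 : ℝ) / 2 else 1]
    simp only [if_true, Bool.false_eq_true, if_false, Finset.prod_const, Finset.card_univ]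
    have h2 : p * (1 / 2) + (1 - p) * 1 ≤ Real.exp (-p / 2) := by
      have := Real.add_one_le_exp (-p / 2)
      linarith
    refine (pow_le_pow_left₀ (by linarith) h2 _).trans (le_of_eq ?_)
    rw [← Real.exp_nat_mul]
    congr 1
    rw [hM]; ring
  have h2 := selProb_le_div hp0 hp1 (Q := fun ω : ι → Bool =>
    ((Finset.univ.filter fun i => ω i = true).card : ℝ) < M / 2)
    (f := fun ω => ((1 : ℝ) / 2) ^ (Finset.univ.filter fun i => ω i = true).card)
    (a := Real.exp (-Real.log 2 * (M / 2))) (Real.exp_pos _) (fun ω => by positivity)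
    (fun ω hω => by
      have h3 : (1 : ℝ) / 2 = Real.exp (-Real.log 2) := by
        rw [Real.exp_neg, Real.exp_log (by norm_num)]; norm_num
      rw [h3, ← Real.exp_nat_mul, Real.exp_le_exp]
      have := Real.log_pos (one_lt_two (α := ℝ))
      nlinarith) h1
  refine h2.trans ?_
  rw [← Real.exp_sub, Real.exp_le_exp]
  have h4 := Real.log_two_lt_d9
  have h5 : 0 ≤ M := by positivity
  nlinarith

end Probability

theorem failProb_eq {k n : ℕ} (A : Decision k) (p : unitInterval) :
    A.failProb n p = selProb (p : ℝ) fun ω => A n (instanceOf ω) = false := by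
  classical
  have hsing : ∀ ω : Constraint k n → Bool,
      (randomSelection k n p).real {ω} = selWeight (p : ℝ) ω := by
    intro ω
    rw [measureReal_def, randomSelection, Measure.pi_singleton, ENNReal.toReal_prod]
    refine Finset.prod_congr rfl fun C _ => ?_
    rw [← measureReal_def, ProbabilityTheory.bernoulliMeasure_real_apply p (measurableSet_singleton _)]
    cases ω C <;> simp
  have hset : {ω : Constraint k n → Bool | A n (instanceOf ω) = false} =
      ((Finset.univ.filter fun ω : Constraint k n → Bool => A n (instanceOf ω) = false :
        Finset _) : Set _) := by
    ext ω; simp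
  have : IsFiniteMeasure (randomSelection k n p) := by
    unfold randomSelection; infer_instance
  rw [Decision.failProb, hset, ← sum_measureReal_singleton, Finset.sum_filter]
  simp only [hsing, selProb]
  exact Finset.sum_congr rfl fun ω _ => by congr

/-! ### Failure of a single test. -/

namespace Split

variable {k : ℕ} (σ : Split k) {n : ℕ} {p : ℝ}

/-- The trace of the square of a symmetric matrix is a sum of squares; Markov's inequality needs
this sign. -/
theorem trace_pow_nonneg (ω : Constraint k n → Bool) (J : ℕ) :
    0 ≤ (chaosMatrix σ.key (σ.scopeWeight ω) ^ 2 ^ (J + 1)).trace := by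
  have hT : (chaosMatrix σ.key (σ.scopeWeight ω) ^ 2 ^ J).transpose =
      chaosMatrix σ.key (σ.scopeWeight ω) ^ 2 ^ J := by
    rw [Matrix.transpose_pow, chaosMatrix_transpose]
  rw [pow_succ, pow_mul, sq]
  nth_rewrite 2 [← hT]
  simp only [Matrix.trace, Matrix.diag, Matrix.mul_apply, Matrix.transpose_apply]
  exact Finset.sum_nonneg fun i _ => Finset.sum_nonneg fun j _ => mul_self_nonneg _

/-- Markov's inequality: with at least `M / 2` constraints, failure forces the sum of squares up to
`M ^ 2 / (8 * K ^ 2 * n ^ u)`, while its mean is at most `4 ^ k * M`. -/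
theorem selProb_sum_sq_lt_le (hσ : 1 ≤ σ.degree) (hp0 : 0 ≤ p) (hp1 : p ≤ 1) {K : ℕ} (hK : 1 ≤ K)
    (hn : 1 ≤ n) (hM : 0 < 2 ^ k * (n : ℝ) ^ k * p) :
    selProb p (fun ω : Constraint k n → Bool =>
      2 ^ k * (n : ℝ) ^ k * p / 2 ≤ Multiset.card (instanceOf ω) ∧
      ¬ 2 * (K : ℤ) ^ 2 * n ^ σ.u * ∑ v, σ.instWeight (instanceOf ω) v ^ 2 ≤
        (Multiset.card (instanceOf ω) : ℤ) ^ 2) ≤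
      8 * K ^ 2 * 4 ^ k * n ^ σ.u / (2 ^ k * (n : ℝ) ^ k * p) := by
  set M := 2 ^ k * (n : ℝ) ^ k * p with hMdef
  have hn0 : (0 : ℝ) < n := by exact_mod_cast hn
  have hK0 : (0 : ℝ) < K := by exact_mod_cast hK
  refine (selProb_le_div hp0 hp1 (f := fun ω => ∑ v, pushWeight σ.key (σ.scopeWeight ω) v ^ 2)
    (a := M ^ 2 / (8 * K ^ 2 * n ^ σ.u)) (by positivity)
    (fun ω => Finset.sum_nonneg fun v _ => sq_nonneg _) (fun ω hω => ?_)
    (σ.sum_sq_le hσ hp0 hp1)).trans (le_of_eq ?_)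
  · obtain ⟨h1, h2⟩ := hω
    rw [not_le] at h2
    have h3 : ((Multiset.card (instanceOf ω) : ℝ)) ^ 2 <
        2 * (K : ℝ) ^ 2 * n ^ σ.u * ∑ v, pushWeight σ.key (σ.scopeWeight ω) v ^ 2 := by
      rw [← instWeight_instanceOf]
      beta_reduce
      exact_mod_cast h2
    have h4 : (M / 2) ^ 2 ≤ ((Multiset.card (instanceOf ω) : ℝ)) ^ 2 :=
      pow_le_pow_left₀ (by positivity) h1 2
    rw [div_le_iff₀ (by positivity)]
    linarith
  · rw [show (4 : ℝ) ^ k = (2 ^ k) ^ 2 by rw [← pow_mul, mul_comm, pow_mul]; norm_num]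
    rw [← hMdef]
    field_simp

/-- Markov's inequality for the trace. Per step, `64 = 2 * 4 * 2 * 4` collects the orientation, the
square of the `2` in `(2 * l) ^ 2`, the `2` of the test and the loss from `M / 2`. -/
theorem selProb_trace_lt_le (hσ : 1 ≤ σ.degree) (hp0 : 0 ≤ p) (hp1 : p ≤ 1) {K : ℕ} (hK : 1 ≤ K)
    (hn : 1 ≤ n) (hM : Real.sqrt n ^ σ.degree ≤ 2 ^ k * (n : ℝ) ^ k * p) :
    selProb p (fun ω : Constraint k n → Bool =>
      2 ^ k * (n : ℝ) ^ k * p / 2 ≤ Multiset.card (instanceOf ω) ∧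
      ¬ (2 * (K : ℤ) ^ 2 * ((n ^ σ.q) ^ 2 * n ^ σ.u)) ^ 2 ^ logExp n *
        (chaosMatrix id (σ.instWeight (instanceOf ω)) ^ 2 ^ logExp n).trace ≤
          ((Multiset.card (instanceOf ω) : ℤ) ^ 2) ^ 2 ^ logExp n) ≤
      ((n : ℝ) ^ σ.q) ^ 2 * (64 * K ^ 2 * 4 ^ k * ((2 ^ logExp n : ℕ) : ℝ) ^ 2 *
        Real.sqrt n ^ σ.degree / (2 ^ k * (n : ℝ) ^ k * p)) ^ 2 ^ logExp n := by
  set M := 2 ^ k * (n : ℝ) ^ k * p with hMdef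
  have hn0 : (0 : ℝ) < n := by exact_mod_cast hn
  have hK0 : (0 : ℝ) < K := by exact_mod_cast hK
  set x := Real.sqrt n with hx
  have hxx : x ^ 2 = n := Real.sq_sqrt (Nat.cast_nonneg n)
  have hx0 : 0 < x := Real.sqrt_pos.2 hn0
  have hM0 : 0 < M := lt_of_lt_of_le (by positivity) hM
  have hl : 2 ^ logExp n = (2 ^ logExp n - 1) + 1 :=
    (Nat.sub_add_cancel Nat.one_le_two_pow).symm
  have h0 := σ.sum_trace_le (p := p) hσ hn hp0 hp1 (2 ^ logExp n - 1) hM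
  rw [← hl, ← hMdef] at h0
  refine (selProb_le_div hp0 hp1
    (f := fun ω => (chaosMatrix σ.key (σ.scopeWeight ω) ^ 2 ^ logExp n).trace)
    (a := ((M / 2) ^ 2) ^ 2 ^ logExp n / (2 * K ^ 2 * ((n ^ σ.q) ^ 2 * n ^ σ.u)) ^ 2 ^ logExp n)
    (by positivity) (fun ω => σ.trace_pow_nonneg ω _) (fun ω hω => ?_) h0).trans (le_of_eq ?_)
  · obtain ⟨h1, h2⟩ := hω
    rw [not_le] at h2
    have h3 : ((Multiset.card (instanceOf ω) : ℝ) ^ 2) ^ 2 ^ logExp n <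
        (2 * (K : ℝ) ^ 2 * ((n ^ σ.q) ^ 2 * n ^ σ.u)) ^ 2 ^ logExp n *
          (chaosMatrix σ.key (σ.scopeWeight ω) ^ 2 ^ logExp n).trace := by
      have h5 := σ.trace_instanceOf (2 ^ logExp n - 1) ω
      rw [← hl] at h5
      rw [← h5]
      exact_mod_cast h2
    have h4 : ((M / 2) ^ 2) ^ 2 ^ logExp n ≤
        ((Multiset.card (instanceOf ω) : ℝ) ^ 2) ^ 2 ^ logExp n :=
      pow_le_pow_left₀ (by positivity) (pow_le_pow_left₀ (by positivity) h1 2) _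
    rw [div_le_iff₀ (by positivity)]
    linarith
  · generalize 2 ^ logExp n = l
    have hnr : ((n : ℝ) ^ σ.q) ^ 2 * n ^ σ.u = (x ^ σ.degree) ^ 2 := by
      rw [← hxx]
      simp only [← pow_mul, ← pow_add]
      congr 1
      unfold degree
      ring
    rw [hnr, show (4 : ℝ) ^ k = (2 ^ k) ^ 2 by rw [← pow_mul, mul_comm, pow_mul]; norm_num]
    have hy : 0 < x ^ σ.degree := by positivity
    generalize x ^ σ.degree = y at hy ⊢
    have h1 : (2 : ℝ) ^ l * ((2 ^ k) ^ (2 * l) * ((2 * (l : ℝ)) ^ (2 * l) *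
        (((n : ℝ) ^ σ.q) ^ 2 * (M / y) ^ l))) / (((M / 2) ^ 2) ^ l / (2 * (K : ℝ) ^ 2 * y ^ 2) ^ l) =
        ((n : ℝ) ^ σ.q) ^ 2 * (2 * (2 ^ k) ^ 2 * (2 * (l : ℝ)) ^ 2 * (M / y) /
          ((M / 2) ^ 2 / (2 * (K : ℝ) ^ 2 * y ^ 2))) ^ l := by
      rw [pow_mul _ 2 l, pow_mul _ 2 l, ← div_pow]
      generalize (M / 2) ^ 2 / (2 * (K : ℝ) ^ 2 * y ^ 2) = Q
      generalize M / y = z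
      generalize ((2 : ℝ) ^ k) ^ 2 = a
      generalize (2 * (l : ℝ)) ^ 2 = b
      rw [div_pow, mul_pow, mul_pow, mul_pow]
      ring
    rw [h1]
    congr 2
    field_simp
    ring

end Split

/-! ### Union bound over the tests and the limit. -/

theorem failProb_certifier_le {k t n : ℕ} (ht : 2 ≤ t) (hk : t ≤ k) (hn : 1 ≤ n) (p : unitInterval)
    (hM : Real.sqrt n ^ t ≤ expectedSize k n p) (hM0 : 0 < expectedSize k n p) :
    (certifier k t).failProb n p ≤ Real.exp (-expectedSize k n p / 8) + (lowSets k t).card *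
      (8 * (certConst k t : ℝ) ^ 2 * 4 ^ k * Real.sqrt n ^ t / expectedSize k n p + (n : ℝ) ^ k *
        (64 * (certConst k t : ℝ) ^ 2 * 4 ^ k * ((2 ^ Split.logExp n : ℕ) : ℝ) ^ 2 *
          Real.sqrt n ^ t / expectedSize k n p) ^ 2 ^ Split.logExp n) := by
  set M := expectedSize k n p with hMdef
  have hMeq : 2 ^ k * (n : ℝ) ^ k * p = M := rfl
  have hp0 : (0 : ℝ) ≤ p := p.2.1
  have hp1 : (p : ℝ) ≤ 1 := p.2.2
  have hK : 1 ≤ certConst k t := by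
    have : 0 < k := by omega
    unfold certConst
    exact Nat.succ_le_of_lt (by positivity)
  have hn1 : (1 : ℝ) ≤ n := by exact_mod_cast hn
  have hx1 : 1 ≤ Real.sqrt n := Real.one_le_sqrt.2 hn1
  have hxx : Real.sqrt n ^ 2 = n := Real.sq_sqrt (Nat.cast_nonneg n)
  rw [failProb_eq]
  refine (selProb_mono_or hp0 hp1
    (Q₁ := fun ω : Constraint k n → Bool => (Multiset.card (instanceOf ω) : ℝ) < M / 2)
    (Q₂ := fun ω => ∃ T ∈ lowSets k t, M / 2 ≤ Multiset.card (instanceOf ω) ∧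
      ¬ (Split.ofFinset T).Certifies (certConst k t) (instanceOf ω)) fun ω hω => ?_).trans
    (add_le_add ?_ ?_)
  · have h1 : ¬ certifier k t n (instanceOf ω) = true := by simp [hω]
    rw [certifier_eq_true_iff] at h1
    push Not at h1
    obtain ⟨T, hT, h2⟩ := h1
    by_cases h3 : (Multiset.card (instanceOf ω) : ℝ) < M / 2
    · exact Or.inl h3
    · exact Or.inr ⟨T, Finset.mem_toList.1 hT, not_lt.1 h3, h2⟩
  · have h1 := selProb_card_lt_le (ι := Constraint k n) hp0 hp1
    have h2 : (Fintype.card (Constraint k n) : ℝ) * p = M := by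
      rw [← hMeq]; simp
    rw [h2] at h1
    exact h1
  · refine (selProb_exists_le hp0 hp1 _ _).trans ?_
    rw [← nsmul_eq_mul]
    refine Finset.sum_le_card_nsmul _ _ _ fun T hT => ?_
    simp only [lowSets, Finset.mem_filter, Finset.mem_univ, true_and] at hT
    set σ := Split.ofFinset T with hσ
    have hdeg : σ.degree = T.card := Split.degree_ofFinset T
    have hdeg1 : 1 ≤ σ.degree := by rw [hdeg]; exact Finset.card_pos.2 hT.1
    have hdegt : σ.degree ≤ t := by rw [hdeg]; exact hT.2
    have hxt : Real.sqrt n ^ σ.degree ≤ Real.sqrt n ^ t := pow_le_pow_right₀ hx1 hdegt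
    -- With at most one remaining coordinate and `2 ≤ t`, the diagonal test needs no more
    -- constraints than the threshold provides.
    have hxu : (n : ℝ) ^ σ.u ≤ Real.sqrt n ^ t := by
      have hu : σ.u ≤ 1 := Split.u_ofFinset_le T
      calc (n : ℝ) ^ σ.u = Real.sqrt n ^ (2 * σ.u) := by rw [pow_mul, hxx]
        _ ≤ Real.sqrt n ^ t := pow_le_pow_right₀ hx1 (by omega)
    have hnq : ((n : ℝ) ^ σ.q) ^ 2 ≤ (n : ℝ) ^ k := by
      rw [← pow_mul]
      refine pow_le_pow_right₀ hn1 ?_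
      unfold Split.degree at hdegt
      omega
    refine (selProb_mono_or hp0 hp1
      (Q₁ := fun ω : Constraint k n → Bool => M / 2 ≤ Multiset.card (instanceOf ω) ∧
        ¬ 2 * (certConst k t : ℤ) ^ 2 * n ^ σ.u * ∑ v, σ.instWeight (instanceOf ω) v ^ 2 ≤
          (Multiset.card (instanceOf ω) : ℤ) ^ 2)
      (Q₂ := fun ω => M / 2 ≤ Multiset.card (instanceOf ω) ∧
        ¬ (2 * (certConst k t : ℤ) ^ 2 * ((n ^ σ.q) ^ 2 * n ^ σ.u)) ^ 2 ^ Split.logExp n *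
          (chaosMatrix id (σ.instWeight (instanceOf ω)) ^ 2 ^ Split.logExp n).trace ≤
            ((Multiset.card (instanceOf ω) : ℤ) ^ 2) ^ 2 ^ Split.logExp n) fun ω hω => ?_).trans
      (add_le_add ?_ ?_)
    · by_contra h
      rw [not_or] at h
      exact hω.2 ⟨by_contra fun h' => h.1 ⟨hω.1, h'⟩, by_contra fun h' => h.2 ⟨hω.1, h'⟩⟩
    · refine (σ.selProb_sum_sq_lt_le hdeg1 hp0 hp1 hK hn hM0).trans ?_
      rw [hMeq]
      gcongr
    · refine (σ.selProb_trace_lt_le hdeg1 hp0 hp1 hK hn (hxt.trans hM)).trans ?_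
      rw [hMeq]
      gcongr

/-- The exponent is at most `4 * n.size + 2`, and `n.size ≤ log n / log 2 + 1`; the constant `14` is
generous. -/
theorem two_pow_logExp_le_log {n : ℕ} (hn : 1 ≤ Real.log n) :
    ((2 ^ Split.logExp n : ℕ) : ℝ) ≤ 14 * Real.log n := by
  have hn0 : n ≠ 0 := by
    rintro rfl
    norm_num at hn
  have h1 : 2 ^ Split.logExp n ≤ 4 * n.size + 2 := by
    have := two_pow_size_le n.size
    unfold Split.logExp
    rw [pow_succ]
    omega
  have h2 : ((n.size - 1 : ℕ) : ℝ) * Real.log 2 ≤ Real.log n := by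
    rw [← Real.log_pow]
    refine Real.log_le_log (by positivity) ?_
    have h3 : 0 < n.size := Nat.size_pos.2 (Nat.pos_of_ne_zero hn0)
    have h4 : 2 ^ (n.size - 1) ≤ n := Nat.lt_size.1 (by omega)
    exact_mod_cast h4
  have h3 : (n.size : ℝ) ≤ ((n.size - 1 : ℕ) : ℝ) + 1 := by
    exact_mod_cast (by omega : n.size ≤ n.size - 1 + 1)
  have h4 : ((2 ^ Split.logExp n : ℕ) : ℝ) ≤ 4 * n.size + 2 := by exact_mod_cast h1
  have h5 := Real.log_two_gt_d9
  have h6 : (0 : ℝ) ≤ ((n.size - 1 : ℕ) : ℝ) := Nat.cast_nonneg _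
  nlinarith

/-- The exponent is long enough that the dimension factor `n ^ k` costs at most `2 ^ k` per step of
the walk. -/
theorem le_two_pow_logExp (n : ℕ) : (n : ℝ) ≤ 2 ^ 2 ^ Split.logExp n := by
  have h1 : n < 2 ^ n.size := Nat.lt_size_self n
  have h2 : n.size < 2 ^ n.size.size := Nat.lt_size_self _
  have h3 : n.size ≤ 2 ^ Split.logExp n := by
    unfold Split.logExp
    rw [pow_succ]
    omega
  have h4 : n ≤ 2 ^ 2 ^ Split.logExp n := h1.le.trans (Nat.pow_le_pow_right (by norm_num) h3)
  exact_mod_cast h4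

/-- Of the five logarithms, two pay for the square of the exponent, since `64 * 14 ^ 2 = 12544`;
three remain to make the base of the power small. -/
theorem failProb_certifier_le_log {k t n : ℕ} (ht : 2 ≤ t) (hk : t ≤ k) (p : unitInterval)
    (hlog : 1 ≤ Real.log n)
    (hM : Real.sqrt n ^ t * Real.log n ^ 5 ≤ expectedSize k n p)
    (hr : 2 ^ k * (12544 * (certConst k t : ℝ) ^ 2 * 4 ^ k) * (Real.log n ^ 3)⁻¹ ≤ 1) :
    (certifier k t).failProb n p ≤ Real.exp (-Real.log n ^ 5 / 8) + (lowSets k t).card *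
      (8 * (certConst k t : ℝ) ^ 2 * 4 ^ k * (Real.log n ^ 5)⁻¹ +
        2 ^ k * (12544 * (certConst k t : ℝ) ^ 2 * 4 ^ k) * (Real.log n ^ 3)⁻¹) := by
  have hn0 : n ≠ 0 := by
    rintro rfl
    norm_num at hlog
  have hn : 1 ≤ n := Nat.pos_of_ne_zero hn0
  have hx1 : 1 ≤ Real.sqrt n := Real.one_le_sqrt.2 (by exact_mod_cast hn)
  have hxt : 1 ≤ Real.sqrt n ^ t := one_le_pow₀ hx1
  have hl5 : 1 ≤ Real.log n ^ 5 := one_le_pow₀ hlog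
  have hM0 : 0 < expectedSize k n p := lt_of_lt_of_le (by positivity) hM
  have hratio : Real.sqrt n ^ t / expectedSize k n p ≤ (Real.log n ^ 5)⁻¹ := by
    rw [div_le_iff₀ hM0, inv_mul_eq_div, le_div_iff₀ (by positivity)]
    exact hM
  refine (failProb_certifier_le ht hk hn p
    ((le_mul_of_one_le_right (by positivity) hl5).trans hM) hM0).trans ?_
  set c := (certConst k t : ℝ) ^ 2 * 4 ^ k with hc
  have hc0 : 0 ≤ c := by positivity
  set l := 2 ^ Split.logExp n with hl
  have hl14 : (l : ℝ) ≤ 14 * Real.log n := two_pow_logExp_le_log hlog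
  have hbase : 64 * (certConst k t : ℝ) ^ 2 * 4 ^ k * (l : ℝ) ^ 2 * Real.sqrt n ^ t /
      expectedSize k n p ≤ 12544 * (certConst k t : ℝ) ^ 2 * 4 ^ k * (Real.log n ^ 3)⁻¹ := by
    calc 64 * (certConst k t : ℝ) ^ 2 * 4 ^ k * (l : ℝ) ^ 2 * Real.sqrt n ^ t / expectedSize k n p
        = 64 * c * (l : ℝ) ^ 2 * (Real.sqrt n ^ t / expectedSize k n p) := by rw [hc]; ring
      _ ≤ 64 * c * (14 * Real.log n) ^ 2 * (Real.log n ^ 5)⁻¹ := by gcongr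
      _ = 12544 * (certConst k t : ℝ) ^ 2 * 4 ^ k * (Real.log n ^ 3)⁻¹ := by
          rw [hc]
          have : Real.log n ≠ 0 := by positivity
          field_simp
          ring
  refine add_le_add ?_ (mul_le_mul_of_nonneg_left (add_le_add ?_ ?_) (Nat.cast_nonneg _))
  · rw [Real.exp_le_exp]
    have : Real.log n ^ 5 ≤ expectedSize k n p :=
      (le_mul_of_one_le_left (by positivity) hxt).trans hM
    linarith
  · rw [mul_div_assoc]
    gcongr
  · have hnk : (n : ℝ) ^ k ≤ (2 ^ k) ^ l := by
      rw [← pow_mul, mul_comm, pow_mul]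
      exact pow_le_pow_left₀ (Nat.cast_nonneg _) (le_two_pow_logExp n) k
    calc (n : ℝ) ^ k * (64 * (certConst k t : ℝ) ^ 2 * 4 ^ k * (l : ℝ) ^ 2 * Real.sqrt n ^ t /
          expectedSize k n p) ^ l
        ≤ (2 ^ k) ^ l * (12544 * (certConst k t : ℝ) ^ 2 * 4 ^ k * (Real.log n ^ 3)⁻¹) ^ l := by
          gcongr
      _ = (2 ^ k * (12544 * (certConst k t : ℝ) ^ 2 * 4 ^ k) * (Real.log n ^ 3)⁻¹) ^ l := by
          rw [← mul_pow]; ring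
      -- The base is at most `1`, so its first power already bounds the whole and tends to `0`.
      _ ≤ (2 ^ k * (12544 * (certConst k t : ℝ) ^ 2 * 4 ^ k) * (Real.log n ^ 3)⁻¹) ^ 1 :=
          pow_le_pow_of_le_one (by positivity) hr Nat.one_le_two_pow
      _ = _ := pow_one _

theorem tendsto_failProb_certifier {k t : ℕ} (ht : 2 ≤ t) (hk : t ≤ k) (p : ℕ → unitInterval)
    (hp : ∀ᶠ n : ℕ in atTop,
      (2 : ℝ) ^ softBound 5 k t * (n : ℝ) ^ ((t : ℝ) / 2) * Real.log (n : ℝ) ^ 5 ≤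
        expectedSize k n (p n)) :
    Tendsto (fun n : ℕ => (certifier k t).failProb n (p n)) atTop (𝓝 0) := by
  have hlog : Tendsto (fun n : ℕ => Real.log n) atTop atTop :=
    Real.tendsto_log_atTop.comp tendsto_natCast_atTop_atTop
  have h3 : Tendsto (fun n : ℕ => (Real.log n ^ 3)⁻¹) atTop (𝓝 0) :=
    ((tendsto_pow_atTop (by norm_num)).comp hlog).inv_tendsto_atTop
  have h5' : Tendsto (fun n : ℕ => Real.log n ^ 5) atTop atTop :=
    (tendsto_pow_atTop (by norm_num)).comp hlog
  have h5 : Tendsto (fun n : ℕ => (Real.log n ^ 5)⁻¹) atTop (𝓝 0) := h5'.inv_tendsto_atTop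
  have hexp : Tendsto (fun n : ℕ => Real.exp (-Real.log n ^ 5 / 8)) atTop (𝓝 0) := by
    have := Real.tendsto_exp_neg_atTop_nhds_zero.comp (h5'.atTop_div_const (by norm_num : (0 : ℝ) < 8))
    refine this.congr fun n => ?_
    simp only [Function.comp]
    congr 1
    ring
  have hr := h3.const_mul (2 ^ k * (12544 * (certConst k t : ℝ) ^ 2 * 4 ^ k))
  have hlim := hexp.add (((h5.const_mul (8 * (certConst k t : ℝ) ^ 2 * 4 ^ k)).add hr).const_mul
    ((lowSets k t).card : ℝ))
  simp only [mul_zero, add_zero] at hlim hr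
  refine squeeze_zero' (Eventually.of_forall fun n => measureReal_nonneg) ?_ hlim
  filter_upwards [hp, hlog.eventually_ge_atTop 1, hr.eventually_le_const one_pos] with n h1 h2 h4
  refine failProb_certifier_le_log ht hk (p n) h2 (le_trans ?_ h1) h4
  have hsoft : 0 ≤ softBound 5 k t := by
    unfold softBound
    have : 0 ≤ Real.log ((k : ℝ) ^ t) :=
      Real.log_nonneg (one_le_pow₀ (by exact_mod_cast (by omega : 1 ≤ k)))
    positivity
  rw [Real.rpow_div_two_eq_sqrt _ (Nat.cast_nonneg n), Real.rpow_natCast]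
  -- The logarithms absorb every constant depending on `k` and `t` as `n` grows, so it suffices that
  -- this factor is at least `1`.
  have h6 : (1 : ℝ) ≤ 2 ^ softBound 5 k t := Real.one_le_rpow (by norm_num) hsoft
  rw [mul_assoc]
  exact le_mul_of_one_le_left (by positivity) h6

end RandomCSP

theorem mainTheorem2 :
    ∃ C : ℕ, ∀ k t : ℕ, 2 ≤ t → t ≤ k →
      ∀ P : RandomCSP.Predicate k, ¬ RandomCSP.Supports t P →
        ∃ A : RandomCSP.Decision k,
          A.IsEfficient ∧
          A.NeverErrs P ((2 : ℝ) ^ (-RandomCSP.softBound C k t)) ∧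
          ∀ p : ℕ → unitInterval,
            (∀ᶠ n : ℕ in atTop,
              (2 : ℝ) ^ RandomCSP.softBound C k t * (n : ℝ) ^ ((t : ℝ) / 2) * Real.log (n : ℝ) ^ 5
                ≤ RandomCSP.expectedSize k n (p n)) →
            Tendsto (fun n : ℕ => A.failProb n (p n)) atTop (𝓝 0) :=
  ⟨5, fun k t ht hk P hP => ⟨RandomCSP.certifier k t, RandomCSP.certifier_isEfficient k t,
    RandomCSP.certifier_neverErrs ht hk P hP,
    fun p hp => RandomCSP.tendsto_failProb_certifier ht hk p hp⟩⟩
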